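/- Let $m\ge 1$ be an integer. For $\operatorname{Re} s>1$ put $$\mathcal C(n,k;s)=\sum_{(p_1,p_2)\in\mathbb Z^2\setminus\{0\}}\frac{\cos^n(k\,\theta_{p_1,p_2})}{(p_1^2+p_2^2)^s},\qquad \theta_{p_1,p_2}=\arg(p_1+ip_2),$$ and denote its meromorphic continuation to $\mathbb C$ by the same symbol. Let $$\mathcal F_{2m}(s)=\frac{\Gamma(1-s+2m)\,\Gamma(s)}{\Gamma(1-s)\,\Gamma(s+2m)},\qquad \Delta_3(s)=\Delta_3(2,2m;s)=\frac{\Gamma(s)^2}{\pi^{2s}\mathcal F_{2m}(s)}\,\mathcal C(0,1;s)\,\mathcal C(1,4m;s),$$ a meromorphic function on $\mathbb C$. Write $s=\sigma+it$; the critical line is $\sigma=1/2$. A *line of constant phase* is a continuous curve $\gamma:\mathbb R\to\mathbb C$ on which $\Delta_3$ is finite and nonzero, $\Delta_3/|\Delta_3|$ is constant, and $|\Delta_3|$ is strictly monotone. (For a simple curve of constant phase that contains no zero of $\Delta_3'$ the monotonicity is automatic; at a zero of $\Delta_3'$, where several curves of constant phase cross, it specifies which branches are joined into one line.) The line *comes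 from* $\sigma=\pm\infty$ if $\operatorname{Re}\gamma(\tau)\to\pm\infty$ as $\tau\to-\infty$. Assume the Riemann hypothesis for $\Delta_3$: every zero of $\Delta_3$ lies on the critical line. Then: 1. If $\gamma$ is a line of constant phase coming from $\sigma=-\infty$, then every point $p$ of the critical line in the closure of the image of $\gamma$ is a zero of $\Delta_3$ or a point with $\frac{\partial}{\partial\sigma}\arg\Delta_3(\sigma+it)=0$. 2. Let $\gamma$ be a line of constant phase coming from $\sigma=+\infty$ and followed as far as possible, that is, $\gamma(\tau)$ does not converge, as $\tau\to+\infty$, to a point at which $\Delta_3$ is finite and nonzero. If $\gamma(\tau_0)$ lies on the critical line and is neither a zero of $\Delta_3$ nor a zero of $\frac{\partial}{\partial\sigma}\arg\Delta_3$, then $\gamma$ curves back and runs into a zero of $\Delta_3$: $\operatorname{Re}\gamma(\tau)<1/2$ for all $\tau>\tau_0$, and $\gamma(\tau)$ converges, as $\tau\to+\infty$, to a zero $\rho$ of $\Delta_3$ with $\operatorname{Re}\rho=1/2$. -/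

import Mathlib

open Set Filter Topology

namespace AngularLattice

/-- The meromorphic continuation to `ℂ` of a function `g` given on a nonempty open set `D`. It is
normalized (`MeromorphicNFOn`: removable singularities are filled in, the value at a pole is `0`),
which makes it unique by the identity theorem. (If `g` had no meromorphic continuation, the value
would be the zero function; the angular lattice sums below do have one.) -/
noncomputable def meromorphicContinuation (D : Set ℂ) (g : ℂ → ℂ) : ℂ → ℂ :=
  open Classical in
  if h : ∃ G : ℂ → ℂ, MeromorphicNFOn G univ ∧ EqOn G g D then h.choose else 0

/-- The lattice series `∑' cos^n (k θ_p) / (p₁² + p₂²)^s` over `p ∈ ℤ² \ {0}`,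
`θ_p = arg (p₁ + i p₂)`, which converges absolutely for `Re s > 1`. -/
noncomputable def cosLatticeSeries (n k : ℕ) (s : ℂ) : ℂ :=
  ∑' p : {p : ℤ × ℤ // p ≠ 0},
    ((Real.cos (k * Complex.arg ((p.1.1 : ℂ) + (p.1.2 : ℂ) * Complex.I)) ^ n : ℝ) : ℂ) /
      ((((p.1.1 : ℝ) ^ 2 + (p.1.2 : ℝ) ^ 2 : ℝ) : ℂ) ^ s)

/-- The angular lattice sum `C(n,k;s)`, as a meromorphic function on `ℂ`. -/
noncomputable def cosLatticeSum (n k : ℕ) : ℂ → ℂ :=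
  meromorphicContinuation {s : ℂ | 1 < s.re} (cosLatticeSeries n k)

/-- `F_{2m}(s) = Γ(1-s+2m) Γ(s) / (Γ(1-s) Γ(s+2m))`. -/
noncomputable def phaseFactor (m : ℕ) (s : ℂ) : ℂ :=
  (Complex.Gamma (1 - s + 2 * m) * Complex.Gamma s) /
    (Complex.Gamma (1 - s) * Complex.Gamma (s + 2 * m))

/-- `Δ₃(2,2m;s) = Γ(s)² / (π^{2s} F_{2m}(s)) * C(0,1;s) * C(1,4m;s)`, as a meromorphic function on
`ℂ` in normal form (the product formula is an identity of meromorphic functions: its removable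
singularities, such as those at the negative integers, are filled in). -/
noncomputable def delta3 (m : ℕ) : ℂ → ℂ :=
  toMeromorphicNFOn
    (fun s : ℂ => Complex.Gamma s ^ 2 / ((Real.pi : ℂ) ^ (2 * s) * phaseFactor m s) *
      cosLatticeSum 0 1 s * cosLatticeSum 1 (4 * m) s) univ

/-- `p` is a zero of `f` (and not a pole, where the normalized value is `0` as well). -/
def IsZeroOf (f : ℂ → ℂ) (p : ℂ) : Prop :=
  AnalyticAt ℂ f p ∧ f p = 0

/-- The Riemann hypothesis for `f`: all zeros of `f` lie on the critical line. -/
def RiemannHypothesisFor (f : ℂ → ℂ) : Prop :=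
  ∀ p : ℂ, IsZeroOf f p → p.re = 1 / 2

/-- The partial derivative `∂ arg f (σ + it) / ∂σ` at `p`, where `f p ≠ 0`. Near `p` the function
`arg (f z / f p)` (principal argument) is a smooth branch of `arg f`, up to an additive constant. -/
noncomputable def dargdsigma (f : ℂ → ℂ) (p : ℂ) : ℝ :=
  deriv (fun σ : ℝ => Complex.arg (f ((σ : ℂ) + (p.im : ℂ) * Complex.I) / f p)) p.re

/-- A line of constant phase of `f`: a curve on which `f` is finite and nonzero, the phase
`f / |f|` is constant, and `|f|` is strictly monotone. Away from the zeros of `f'` the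
last condition holds for every simple curve of constant phase. At a zero of `f'`, where two or more
curves of constant phase cross, it says that the line turns into one of the branches
along which `|f|` goes on rising (or falling). -/
structure IsConstantPhaseLine (f : ℂ → ℂ) (γ : ℝ → ℂ) : Prop where
  continuous : Continuous γ
  analyticAt : ∀ τ, AnalyticAt ℂ f (γ τ)
  ne_zero : ∀ τ, f (γ τ) ≠ 0
  phase_const : ∀ τ τ', f (γ τ) / (‖f (γ τ)‖ : ℂ) = f (γ τ') / (‖f (γ τ')‖ : ℂ)
  monotone_norm : StrictMono (fun τ => ‖f (γ τ)‖) ∨ StrictAnti (fun τ => ‖f (γ τ)‖)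

/-- The curve `γ` is followed as far as possible in the forward direction: it does not end
at a point at which `f` is finite and nonzero, so that its phase is still defined. -/
def IsForwardComplete (f : ℂ → ℂ) (γ : ℝ → ℂ) : Prop :=
  ¬ ∃ q : ℂ, AnalyticAt ℂ f q ∧ f q ≠ 0 ∧ Tendsto γ atTop (𝓝 q)

end AngularLattice

/-!
Write `A(s) = π^{-s} Γ(s) C(0,1;s)` and `B(s) = π^{-s} Γ(s+2m) C(1,4m;s)`. The Gamma factors in the
definition combine to `Δ₃(s) = A(s) B(s) / ∏_{j=1}^{2m} (s - j)`. The theta series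
`∑ (p₁ + i p₂)^{4k} exp (-π |p|² x)` is a modular form of weight `1 + 4k`
(`latticeTheta_one_div`; its inversion formula is read off from the generating function
`θ(w) θ(iw)`, in which the Gaussian factors of the two Jacobi theta functions cancel). Its Mellin
transform shows that `A` and `B` are invariant under `s ↦ 1 - s`. Hence, under the Riemann
hypothesis, `Δ₃ = X / P` (`exists_delta3_eq`), where `X` is entire, invariant under `s ↦ 1 - s`,
real on the real axis and free of zeros off the critical line, and where `P` is a product of factors
`s - a` with `a ∈ {1, …, 2m}`, and possibly `a ∈ {0, 1}` when the poles of `C(0,1;s)` survive.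

The class of such functions `X`, with mild growth conditions, is `IsXiLike`. The main facts about it
are the following.

* `|X(s + h)| ≤ |X(s - h)|` for `Re s ≤ 1/2`, `h > 0` (`IsXiLike.norm_add_le_norm_sub`), by the
  Phragmén–Lindelöf principle for the quotient in a strip. The bound from below that it requires
  comes from the Borel–Carathéodory inequality. So `Re (X'/X) ≤ 0` on `Re s < 1/2`.
* The class is stable under division by `(s - ρ)(s - ρ̄)`, `ρ` a zero. Therefore each zero contributes
  its term of the partial fraction series to a quantitative bound for `Re (X'/X)`
  (`IsXiLike.re_logDeriv_le_sum`). This replaces the Hadamard product.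
* `X` has infinitely many zeros (`IsXiLike.infinite_zeros`); otherwise it would be a polynomial times
  the exponential of a linear function, for which `Re (X'/X)` is bounded far to the left.
* In `Re s < 1/2` the phase of `X` changes along vertical lines at the rate `Re (X'/X)`, and
  infinitely many zeros make that change outweigh the bounded phase of `P`. So no curve of constant
  phase of `X / P` escapes to infinity in the left half-plane while `|X / P|` stays bounded
  (`IsXiLike.not_tendsto_norm_atTop`).

Consequently `|Δ₃|` decreases along every line that comes from `σ = -∞`, and, by reflection, along
every line from `σ = +∞`. On the critical line `Re (X'/X) = 0`, while `Re (P'/P) < 0` because the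
roots `0` and `1` cancel and `1, …, 2m` lie to the right. Thus `Re (Δ₃'/Δ₃) > 0` there, and a
descending line of constant phase crosses the critical line only from right to left. A line from
`σ = -∞` therefore never crosses, and it can adhere to the critical line only at a zero. A line from
`σ = +∞` which crosses stays in `Re s < 1/2`, is not allowed to escape to infinity, and so has a
cluster point. Along the line `Δ₃` tends to its value at the cluster point, and preimages of that
value are isolated, so that the line converges; the limit is a zero, as lines do not end at regular
points of nonzero value.
-/

namespace AngularLattice

/-! ### Holomorphic logarithms -/

/-- A continuous logarithm of a holomorphic function is holomorphic. -/
lemma hasDerivAt_of_exp_eq {V X : ℂ → ℂ} {X' a : ℂ} (hc : ContinuousAt V a)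
    (hX : HasDerivAt X X' a) (he : ∀ᶠ s in 𝓝 a, Complex.exp (V s) = X s) :
    HasDerivAt V (X' / X a) a := by
  have hXa : X a ≠ 0 := by rw [← he.self_of_nhds]; exact Complex.exp_ne_zero _
  have h1 : HasDerivAt (fun s => V a + Complex.log (X s / X a)) (X' / X a) a := by
    have h := ((hX.div_const (X a)).clog (by simp [hXa])).const_add (V a)
    simpa [hXa] using h
  refine h1.congr_of_eventuallyEq ?_
  have hev : ∀ᶠ s in 𝓝 a, ‖V s - V a‖ < Real.pi := by
    have : Tendsto (fun s => ‖V s - V a‖) (𝓝 a) (𝓝 ‖V a - V a‖) :=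
      (hc.sub continuousAt_const).norm
    rw [sub_self, norm_zero] at this
    exact this.eventually_lt_const Real.pi_pos
  filter_upwards [he, hev] with s hs hs'
  have him := (Complex.abs_im_le_norm (V s - V a)).trans_lt hs'
  rw [← hs, ← he.self_of_nhds, ← Complex.exp_sub,
    Complex.log_exp (abs_lt.1 him).1 (abs_lt.1 him).2.le]
  ring

/-- An entire function without zeros on a convex open set has a holomorphic logarithm there. -/
lemma exists_log_of_convex {X : ℂ → ℂ} {U : Set ℂ} (hconv : Convex ℝ U) (hopen : IsOpen U)
    (hne : U.Nonempty) (hd : Differentiable ℂ X) (h0 : ∀ s ∈ U, X s ≠ 0) :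
    ∃ V : ℂ → ℂ, (∀ s ∈ U, Complex.exp (V s) = X s) ∧
      ∀ s ∈ U, HasDerivAt V (logDeriv X s) s := by
  have hsc : IsSimplyConnected U := by
    have := hconv.contractibleSpace hne
    unfold IsSimplyConnected
    infer_instance
  obtain ⟨V, hVc, hVe⟩ := Complex.exists_continuousOn_eqOn_exp_comp hsc hopen
    hd.continuous.continuousOn (by rintro ⟨s, hs, h⟩; exact h0 s hs h)
  refine ⟨V, fun s hs => hVe hs, fun s hs => ?_⟩
  exact hasDerivAt_of_exp_eq (hVc.continuousAt (hopen.mem_nhds hs)) (hd s).hasDerivAt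
    (eventually_of_mem (hopen.mem_nhds hs) fun z hz => hVe hz)

/-! ### Functions of the type of the Riemann xi function -/

/-- Entire functions that share with `ξ` the functional equation, the reality on the real axis, the
location of all zeros on the critical line, and the coarse growth: at most exponential in `|t|` on
vertical strips, at least `exp (-C |t|)` on vertical lines far to the left, and
`Re (X' / X) → -∞` as `σ → -∞`. The growth on strips is only asked for large `|t|`, so that the
class is stable under division by a quadratic factor. -/
structure IsXiLike (X : ℂ → ℂ) : Prop where
  differentiable : Differentiable ℂ X
  symm : ∀ s, X (1 - s) = X s
  conj : ∀ s, X (starRingEnd ℂ s) = starRingEnd ℂ (X s)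
  ne_zero : ∀ s : ℂ, s.re < 1 / 2 → X s ≠ 0
  upper : ∀ a b : ℝ, ∃ C T : ℝ, ∀ s : ℂ, a ≤ s.re → s.re ≤ b → T ≤ |s.im| →
    ‖X s‖ ≤ Real.exp (C * |s.im|)
  lower : ∃ a₀ : ℝ, ∀ a ≤ a₀, ∃ C T : ℝ, ∀ s : ℂ, s.re = a → T ≤ |s.im| →
    Real.exp (-(C * |s.im|)) ≤ ‖X s‖
  logDeriv_re : ∀ K : ℝ, ∃ a₁ : ℝ, ∀ s : ℂ, s.re ≤ a₁ → (logDeriv X s).re ≤ -K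

/-- If `‖f‖ ≤ e^M ‖f c‖` on a ball around `c` on which `f = e^V`, then `f` cannot be much smaller
than at the centre: the Borel–Carathéodory inequality for `V - V c`. -/
lemma norm_ge_of_log_on_ball {V : ℂ → ℂ} {c z : ℂ} {R M : ℝ} (hM : 0 < M)
    (hV : DifferentiableOn ℂ V (Metric.ball c R)) (hz : z ∈ Metric.ball c R)
    (hb : ∀ w ∈ Metric.ball c R, (V w).re ≤ (V c).re + M) :
    (V c).re - 2 * M * ‖z - c‖ / (R - ‖z - c‖) ≤ (V z).re := by
  have hR : 0 < R := Metric.pos_of_mem_ball hz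
  have hmaps : MapsTo (fun w => c + w) (Metric.ball 0 R) (Metric.ball c R) := by
    intro w hw; simpa using hw
  have h := Complex.borelCaratheodory_zero (f := fun w => V (c + w) - V c) (z := z - c) (R := R) hM
    ((hV.comp (by fun_prop) hmaps).sub_const _)
    (fun w hw => by
      have := hb _ (hmaps hw)
      simp only [mem_ofPred_eq, Complex.sub_re]; linarith) hR
    (by simpa [← dist_eq_norm] using hz) (by simp)
  simp only [add_sub_cancel] at h
  have h2 := (abs_le.1 ((Complex.abs_re_le_norm _).trans h)).1
  rw [Complex.sub_re] at h2
  linarith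

namespace IsXiLike

variable {X : ℂ → ℂ}

lemma norm_one_half (hX : IsXiLike X) (h t : ℝ) :
    ‖X (((1 / 2 + h : ℝ) : ℂ) + t * Complex.I)‖ = ‖X (((1 / 2 - h : ℝ) : ℂ) + t * Complex.I)‖ := by
  have h1 : (1 : ℂ) - (starRingEnd ℂ) (((1 / 2 - h : ℝ) : ℂ) + t * Complex.I) =
      ((1 / 2 + h : ℝ) : ℂ) + t * Complex.I := by
    apply Complex.ext <;> simp; norm_num
    ring
  rw [← h1, hX.symm, hX.conj, Complex.norm_conj]

lemma exists_log (hX : IsXiLike X) :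
    ∃ V : ℂ → ℂ, (∀ s : ℂ, s.re < 1 / 2 → Complex.exp (V s) = X s) ∧
      ∀ s : ℂ, s.re < 1 / 2 → HasDerivAt V (logDeriv X s) s :=
  exists_log_of_convex (U := {s : ℂ | s.re < 1 / 2}) (convex_halfSpace_re_lt _)
    (isOpen_lt Complex.continuous_re continuous_const) ⟨0, by simp⟩ hX.differentiable hX.ne_zero

/-- Lower bound on a strip at distance `h` from the critical line. -/
lemma lower_strip (hX : IsXiLike X) {a h : ℝ} (hh : 0 < h) :
    ∃ C T : ℝ, ∀ s : ℂ, a ≤ s.re → s.re ≤ 1 / 2 - h → T ≤ |s.im| →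
      Real.exp (-(C * |s.im|)) ≤ ‖X s‖ := by
  obtain ⟨V, hVe, hVd⟩ := hX.exists_log
  have hVn : ∀ s : ℂ, s.re < 1 / 2 → ‖X s‖ = Real.exp (V s).re := fun s hs => by
    rw [← hVe s hs, Complex.norm_exp]
  obtain ⟨a₀, ha₀⟩ := hX.lower
  -- centres of the discs: on a line to the left of everything, where the lower bound is known
  set b := min (min a₀ a) (-h) with hb
  have hb1 : b ≤ a₀ := (min_le_left _ _).trans (min_le_left _ _)
  have hb2 : b ≤ a := (min_le_left _ _).trans (min_le_right _ _)
  have hb3 : b ≤ -h := min_le_right _ _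
  obtain ⟨C₁, T₁, h1⟩ := ha₀ b hb1
  set R := 1 / 2 - h / 2 - b with hR
  have hRpos : 0 < R := by rw [hR]; linarith
  obtain ⟨C₂, T₂, h2⟩ := hX.upper (b - R) (1 / 2)
  set r := 1 / 2 - h - b with hr
  have hr0 : 0 < r := by rw [hr]; linarith
  set D := |C₁| + 2 * |C₂| + 1 with hD
  have hDpos : 0 < D := by rw [hD]; positivity
  refine ⟨|C₁| + 2 * D * r / (h / 2), max T₁ (|T₂| + R + 1), fun s hs1 hs2 hs3 => ?_⟩
  have ht1 : T₁ ≤ |s.im| := (le_max_left _ _).trans hs3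
  have ht2 : |T₂| + R + 1 ≤ |s.im| := (le_max_right _ _).trans hs3
  have htpos : 0 < |s.im| := by have := abs_nonneg T₂; linarith
  set c : ℂ := (b : ℂ) + s.im * Complex.I with hc
  have hcre : c.re = b := by simp [hc]
  have hcim : c.im = s.im := by simp [hc]
  have hcb : c.re < 1 / 2 := by rw [hcre]; linarith
  have hball : ∀ w ∈ Metric.ball c R, b - R ≤ w.re ∧ w.re < 1 / 2 ∧ |w.im - s.im| ≤ R := by
    intro w hw
    have hw' : ‖w - c‖ < R := by simpa [dist_eq_norm] using hw
    have h3 := abs_lt.1 ((Complex.abs_re_le_norm (w - c)).trans_lt hw')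
    have h4 := (Complex.abs_im_le_norm (w - c)).trans_lt hw'
    rw [Complex.sub_re, hcre] at h3
    rw [Complex.sub_im, hcim] at h4
    exact ⟨by linarith [h3.1], by rw [hR] at h3; linarith [h3.2], h4.le⟩
  have hlow : -(|C₁| * |s.im|) ≤ (V c).re := by
    have := h1 c hcre (by rwa [hcim])
    rw [hVn c hcb, Real.exp_le_exp, hcim] at this
    have h5 : C₁ * |s.im| ≤ |C₁| * |s.im| := by gcongr; exact le_abs_self _
    linarith
  have hup : ∀ w ∈ Metric.ball c R, (V w).re ≤ (V c).re + D * |s.im| := by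
    intro w hw
    obtain ⟨w1, w2, w3⟩ := hball w hw
    have habs := abs_le.1 (abs_abs_sub_abs_le_abs_sub w.im s.im |>.trans w3)
    have := h2 w w1 w2.le (by linarith [le_abs_self T₂, habs.1])
    rw [hVn w w2, Real.exp_le_exp] at this
    have h5 : C₂ * |w.im| ≤ |C₂| * (2 * |s.im|) := by
      have : |w.im| ≤ 2 * |s.im| := by linarith [habs.2, abs_nonneg T₂]
      calc C₂ * |w.im| ≤ |C₂| * |w.im| := by gcongr; exact le_abs_self _
        _ ≤ _ := by gcongr
    rw [hD]; nlinarith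
  have hsc : ‖s - c‖ ≤ r := by
    have : s - c = ((s.re - b : ℝ) : ℂ) := by
      apply Complex.ext <;> simp [hcre, hcim]
    rw [this, Complex.norm_real, Real.norm_eq_abs, abs_of_nonneg (by linarith)]
    rw [hr]; linarith
  have hrR : R - r = h / 2 := by rw [hr, hR]; ring
  have hsball : s ∈ Metric.ball c R := by
    rw [Metric.mem_ball, dist_eq_norm]; linarith
  have key := norm_ge_of_log_on_ball (V := V) (mul_pos hDpos htpos)
    (fun w hw => (hVd w (hball w hw).2.1).differentiableAt.differentiableWithinAt) hsball hup
  rw [hVn s (by linarith), Real.exp_le_exp]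
  have h6 : 2 * (D * |s.im|) * ‖s - c‖ / (R - ‖s - c‖) ≤ 2 * (D * |s.im|) * r / (h / 2) := by
    have : h / 2 ≤ R - ‖s - c‖ := by linarith
    gcongr
  have h7 : (|C₁| + 2 * D * r / (h / 2)) * |s.im| =
      |C₁| * |s.im| + 2 * (D * |s.im|) * r / (h / 2) := by ring
  rw [h7]; linarith

/-- The horizontal derivative of `Re V` for a logarithm `V` of `X` is `Re (X' / X)`. -/
lemma hasDerivAt_re_log {V : ℂ → ℂ}
    (hVd : ∀ s : ℂ, s.re < 1 / 2 → HasDerivAt V (logDeriv X s) s) {σ : ℝ} (hσ : σ < 1 / 2) (t : ℝ) :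
    HasDerivAt (fun x : ℝ => (V (x + t * Complex.I)).re) (logDeriv X (σ + t * Complex.I)).re σ := by
  have h1 : HasDerivAt (fun z : ℂ => V (z + t * Complex.I)) (logDeriv X (σ + t * Complex.I))
      (σ : ℂ) := by
    have := (hVd (σ + t * Complex.I) (by simpa using hσ)).comp (σ : ℂ)
      ((hasDerivAt_id (σ : ℂ)).add_const (t * Complex.I))
    simpa [Function.comp_def] using this
  exact h1.real_of_complex

/-- The vertical derivative of `Im V` for a logarithm `V` of `X` is `Re (X' / X)`. -/
lemma hasDerivAt_im_log {V : ℂ → ℂ}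
    (hVd : ∀ s : ℂ, s.re < 1 / 2 → HasDerivAt V (logDeriv X s) s) {σ : ℝ} (hσ : σ < 1 / 2) (t : ℝ) :
    HasDerivAt (fun y : ℝ => (V (σ + y * Complex.I)).im) (logDeriv X (σ + t * Complex.I)).re t := by
  have h0 : HasDerivAt (fun z : ℂ => (σ : ℂ) + z * Complex.I) Complex.I (t : ℂ) := by
    simpa using ((hasDerivAt_id (t : ℂ)).mul_const Complex.I).const_add (σ : ℂ)
  have h1 := ((hVd (σ + t * Complex.I) (by simpa using hσ)).comp (t : ℂ) h0).const_mul (-Complex.I)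
  have h2 : -Complex.I * (logDeriv X (σ + t * Complex.I) * Complex.I) =
      logDeriv X (σ + t * Complex.I) := by
    linear_combination (-logDeriv X (σ + t * Complex.I)) * Complex.I_mul_I
  rw [h2] at h1
  simpa using h1.real_of_complex

/-- Where `Re (X' / X) ≤ -K`, the function `log ‖X‖` decreases in `σ` at least at the rate `K`. -/
lemma re_log_add_le {V : ℂ → ℂ}
    (hVd : ∀ s : ℂ, s.re < 1 / 2 → HasDerivAt V (logDeriv X s) s) {K a : ℝ} (ha : a < 1 / 2)
    (hK : ∀ s : ℂ, s.re ≤ a → (logDeriv X s).re ≤ -K) {x y : ℝ} (hxy : x ≤ y) (hy : y ≤ a) (t : ℝ) :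
    (V (y + t * Complex.I)).re + K * (y - x) ≤ (V (x + t * Complex.I)).re := by
  have hd : ∀ u ∈ Iic a, HasDerivAt (fun x : ℝ => (V (x + t * Complex.I)).re)
      (logDeriv X (u + t * Complex.I)).re u := fun u hu =>
    hasDerivAt_re_log hVd (lt_of_le_of_lt hu ha) t
  have := (convex_Iic a).image_sub_le_mul_sub_of_deriv_le (C := -K)
    (fun u hu => (hd u hu).continuousAt.continuousWithinAt)
    (fun u hu => (hd u (interior_subset hu)).differentiableAt.differentiableWithinAt)
    (fun u hu => by
      rw [(hd u (interior_subset hu)).deriv]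
      exact hK _ (by simpa using interior_subset hu)) x (hxy.trans hy) y hy hxy
  linarith

/-- To the left of the critical line, `‖X‖` decreases in `σ`. The quotient `X (s + h) / X (s - h)`
has modulus `1` on the critical line by the functional equation, and modulus at most `1` far to
the left; the Phragmén–Lindelöf principle covers the strip in between. -/
lemma norm_add_le_norm_sub (hX : IsXiLike X) {h : ℝ} (hh : 0 < h) {s : ℂ} (hs : s.re ≤ 1 / 2) :
    ‖X (s + h)‖ ≤ ‖X (s - h)‖ := by
  obtain ⟨V, hVe, hVd⟩ := hX.exists_log
  obtain ⟨a₁, ha₁⟩ := hX.logDeriv_re 0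
  set b := min a₁ 0 with hb
  have hb1 : b ≤ a₁ := min_le_left _ _
  have hb0 : b ≤ 0 := min_le_right _ _
  have hfar : ∀ z : ℂ, z.re + h ≤ b → ‖X (z + h)‖ ≤ ‖X (z - h)‖ := by
    intro z hz
    have := re_log_add_le hVd (K := 0) (a := b) (by linarith)
      (fun w hw => ha₁ w (hw.trans hb1)) (x := z.re - h) (y := z.re + h) (by linarith) hz z.im
    have e1 : ((z.re - h : ℝ) : ℂ) + z.im * Complex.I = z - h := by apply Complex.ext <;> simp
    have e2 : ((z.re + h : ℝ) : ℂ) + z.im * Complex.I = z + h := by apply Complex.ext <;> simp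
    rw [e1, e2] at this
    rw [← hVe (z + h) (by simp; linarith), ← hVe (z - h) (by simp; linarith), Complex.norm_exp,
      Complex.norm_exp, Real.exp_le_exp]
    linarith
  have hne : ∀ z : ℂ, z.re ≤ 1 / 2 → X (z - h) ≠ 0 := fun z hz =>
    hX.ne_zero _ (by simp; linarith)
  set a := b - h with ha
  rcases le_total s.re a with hsa | hsa
  · exact hfar s (by linarith)
  have key : ‖X (s + h) / X (s - h)‖ ≤ 1 := by
    refine PhragmenLindelof.vertical_strip (f := fun z : ℂ => X (z + h) / X (z - h)) (a := a)
      (b := 1 / 2) ?_ ?_ ?_ ?_ hsa hs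
    · apply DifferentiableOn.diffContOnCl
      intro z hz
      have hz' : z.re ≤ 1 / 2 := by
        have hcl : IsClosed {w : ℂ | w.re ≤ 1 / 2} :=
          isClosed_le Complex.continuous_re continuous_const
        exact closure_minimal (s := Complex.re ⁻¹' Ioo a (1 / 2)) (fun w hw => hw.2.le) hcl hz
      have hd := hX.differentiable
      exact ((by fun_prop : DifferentiableAt ℂ (fun z : ℂ => X (z + h)) z).div
        (by fun_prop) (hne z hz')).differentiableWithinAt
    · obtain ⟨C₁, T₁, h1⟩ := hX.upper (a + h) (1 / 2 + h)
      obtain ⟨C₂, T₂, h2⟩ := hX.lower_strip (a := a - h) hh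
      have hpos : 0 < 1 / 2 - a := by linarith
      set c := Real.pi / (1 / 2 - a) / 2 with hc
      have hcpos : 0 < c := by have := Real.pi_pos; positivity
      refine ⟨c, half_lt_self (by have := Real.pi_pos; positivity), |C₁ + C₂| / c, ?_⟩
      refine Asymptotics.IsBigO.of_bound 1 ?_
      have hev : ∀ᶠ z : ℂ in comap (_root_.abs ∘ Complex.im) atTop, max T₁ T₂ ≤ |z.im| :=
        tendsto_comap.eventually (eventually_ge_atTop (max T₁ T₂))
      filter_upwards [mem_inf_of_left hev, mem_inf_of_right (mem_principal_self _)] with z hz1 hz2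
      have hz1' : max T₁ T₂ ≤ |z.im| := hz1
      have k1 := h1 (z + h) (by simp; linarith [hz2.1]) (by simp; linarith [hz2.2])
        (by simpa using (le_max_left _ _).trans hz1')
      have k2 := h2 (z - h) (by simp; linarith [hz2.1]) (by simp; linarith [hz2.2])
        (by simpa using (le_max_right _ _).trans hz1')
      simp only [Complex.add_im, Complex.sub_im, Complex.ofReal_im, add_zero, sub_zero] at k1 k2
      rw [one_mul, norm_div, Real.norm_eq_abs, Real.abs_exp, div_le_iff₀ ((Real.exp_pos _).trans_le k2)]
      calc ‖X (z + h)‖ ≤ Real.exp (C₁ * |z.im|) := k1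
        _ = Real.exp ((C₁ + C₂) * |z.im|) * Real.exp (-(C₂ * |z.im|)) := by
          rw [← Real.exp_add]; ring_nf
        _ ≤ Real.exp (|C₁ + C₂| / c * Real.exp (c * |z.im|)) * ‖X (z - h)‖ := by
          refine mul_le_mul (Real.exp_le_exp.2 ?_) k2 (Real.exp_pos _).le (Real.exp_pos _).le
          calc (C₁ + C₂) * |z.im| ≤ |C₁ + C₂| * |z.im| := by gcongr; exact le_abs_self _
            _ = |C₁ + C₂| / c * (c * |z.im|) := by field_simp
            _ ≤ _ := by
              gcongr
              linarith [Real.add_one_le_exp (c * |z.im|)]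
    · intro z hz
      rw [norm_div]
      exact div_le_one_of_le₀ (hfar z (by rw [hz]; linarith)) (norm_nonneg _)
    · intro z hz
      have e1 : z + h = ((1 / 2 + h : ℝ) : ℂ) + z.im * Complex.I := by
        apply Complex.ext <;> simp [hz]
      have e2 : z - h = ((1 / 2 - h : ℝ) : ℂ) + z.im * Complex.I := by
        apply Complex.ext <;> simp [hz]
      rw [norm_div, e1, e2, hX.norm_one_half]
      exact div_self_le_one _
  rw [norm_div, div_le_one (norm_pos_iff.2 (hne s hs))] at key
  exact key

lemma re_logDeriv_nonpos (hX : IsXiLike X) {s : ℂ} (hs : s.re < 1 / 2) :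
    (logDeriv X s).re ≤ 0 := by
  obtain ⟨V, hVe, hVd⟩ := hX.exists_log
  have hd := hasDerivAt_re_log hVd hs s.im
  rw [Complex.re_add_im] at hd
  have hanti : AntitoneOn (fun x : ℝ => (V (x + s.im * Complex.I)).re) (Iio (1 / 2)) := by
    intro x hx y hy hxy
    rcases hxy.eq_or_lt with rfl | hlt
    · exact le_rfl
    have := hX.norm_add_le_norm_sub (h := (y - x) / 2) (by linarith)
      (s := (((x + y) / 2 : ℝ) : ℂ) + s.im * Complex.I)
      (by simp only [mem_Iio] at hx hy; simp; linarith)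
    have e1 : (((x + y) / 2 : ℝ) : ℂ) + s.im * Complex.I + ((y - x) / 2 : ℝ) =
      y + s.im * Complex.I := by push_cast; ring
    have e2 : (((x + y) / 2 : ℝ) : ℂ) + s.im * Complex.I - ((y - x) / 2 : ℝ) =
      x + s.im * Complex.I := by push_cast; ring
    rw [e1, e2, ← hVe _ (by simpa using hy), ← hVe _ (by simpa using hx), Complex.norm_exp,
      Complex.norm_exp, Real.exp_le_exp] at this
    exact this
  have := hanti.derivWithin_nonpos (x := s.re)
  rwa [derivWithin_of_mem_nhds (Iio_mem_nhds hs), hd.deriv] at this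

end IsXiLike

/-! ### Splitting off zeros -/

namespace IsXiLike

variable {X : ℂ → ℂ}

lemma re_eq_half (hX : IsXiLike X) {ρ : ℂ} (h0 : X ρ = 0) : ρ.re = 1 / 2 := by
  rcases lt_trichotomy ρ.re (1 / 2) with h | h | h
  · exact absurd h0 (hX.ne_zero ρ h)
  · exact h
  · refine absurd ?_ (hX.ne_zero (1 - ρ) (by simp; linarith))
    rw [hX.symm, h0]

/-- A conjugate pair of zeros of a xi-like function can be divided out. -/
lemma exists_div (hX : IsXiLike X) {ρ : ℂ} (h0 : X ρ = 0) (him : ρ.im ≠ 0) :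
    ∃ Y : ℂ → ℂ, IsXiLike Y ∧ ∀ s, X s = (s - ρ) * (s - starRingEnd ℂ ρ) * Y s := by
  have hre := hX.re_eq_half h0
  have hne : starRingEnd ℂ ρ ≠ ρ := fun h => him (Complex.conj_eq_iff_im.1 h)
  have h1 : 1 - ρ = starRingEnd ℂ ρ := by
    apply Complex.ext <;> simp [hre]; norm_num
  set W := dslope X ρ with hW
  set Y := dslope W (starRingEnd ℂ ρ) with hY
  have hWd : Differentiable ℂ W := by
    rw [← differentiableOn_univ, hW, Complex.differentiableOn_dslope univ_mem,
      differentiableOn_univ]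
    exact hX.differentiable
  have hYd : Differentiable ℂ Y := by
    rw [← differentiableOn_univ, hY, Complex.differentiableOn_dslope univ_mem,
      differentiableOn_univ]
    exact hWd
  have hXW : ∀ s, X s = (s - ρ) * W s := fun s => by
    have := sub_smul_dslope X ρ s
    rw [h0, sub_zero, smul_eq_mul] at this
    exact this.symm
  have hWρ : W (starRingEnd ℂ ρ) = 0 := by
    have h2 := hXW (starRingEnd ℂ ρ)
    rw [hX.conj, h0, map_zero] at h2
    exact (mul_eq_zero.1 h2.symm).resolve_left (sub_ne_zero.2 hne)
  have hXY : ∀ s, X s = (s - ρ) * (s - starRingEnd ℂ ρ) * Y s := fun s => by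
    have := sub_smul_dslope W (starRingEnd ℂ ρ) s
    rw [hWρ, sub_zero, smul_eq_mul] at this
    rw [hXW, ← this, mul_assoc]
  have hdense : Dense ({ρ, starRingEnd ℂ ρ}ᶜ : Set ℂ) :=
    (toFinite ({ρ, starRingEnd ℂ ρ} : Set ℂ)).countable.dense_compl ℂ
  have hDne : ∀ s ∈ ({ρ, starRingEnd ℂ ρ}ᶜ : Set ℂ), (s - ρ) * (s - starRingEnd ℂ ρ) ≠ 0 := by
    intro s hs
    simp only [mem_compl_iff, mem_insert_iff, mem_singleton_iff, not_or] at hs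
    exact mul_ne_zero (sub_ne_zero.2 hs.1) (sub_ne_zero.2 hs.2)
  refine ⟨Y, ⟨hYd, ?_, ?_, ?_, ?_, ?_, ?_⟩, hXY⟩
  · have hc : Continuous fun s => Y (1 - s) := hYd.continuous.comp (by fun_prop)
    refine congrFun (hc.ext_on hdense hYd.continuous fun s hs => ?_)
    have h2 := hX.symm s
    rw [hXY, hXY s] at h2
    refine mul_left_cancel₀ (hDne s hs) ?_
    rw [← h2, ← h1]; ring
  · have hc : Continuous fun s => Y (starRingEnd ℂ s) := hYd.continuous.comp (by fun_prop)
    have hc' : Continuous fun s => starRingEnd ℂ (Y s) :=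
      Complex.continuous_conj.comp hYd.continuous
    refine congrFun (hc.ext_on hdense hc' fun s hs => ?_)
    have h2 := hX.conj s
    rw [hXY, hXY s, map_mul, map_mul, map_sub, map_sub, Complex.conj_conj] at h2
    have h3 : (starRingEnd ℂ s - starRingEnd ℂ ρ) * (starRingEnd ℂ s - ρ) ≠ 0 := by
      have := (map_ne_zero (starRingEnd ℂ)).2 (hDne s hs)
      simpa using this
    refine mul_left_cancel₀ h3 ?_
    rw [← h2]; ring
  · intro s hs hs0
    exact hX.ne_zero s hs (by rw [hXY, hs0, mul_zero])
  · intro a b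
    obtain ⟨C, T, h⟩ := hX.upper a b
    refine ⟨C, max T (|ρ.im| + 1), fun s h1 h2 h3 => ?_⟩
    have h4 := h s h1 h2 ((le_max_left _ _).trans h3)
    have h5 : |ρ.im| + 1 ≤ |s.im| := (le_max_right _ _).trans h3
    have k1 : 1 ≤ ‖s - ρ‖ := by
      refine le_trans ?_ (Complex.abs_im_le_norm _)
      rw [Complex.sub_im]
      linarith [abs_sub_abs_le_abs_sub s.im ρ.im]
    have k2 : 1 ≤ ‖s - starRingEnd ℂ ρ‖ := by
      refine le_trans ?_ (Complex.abs_im_le_norm _)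
      rw [Complex.sub_im, Complex.conj_im]
      have := abs_sub_abs_le_abs_sub s.im (-ρ.im)
      rw [abs_neg] at this
      linarith
    rw [hXY, norm_mul, norm_mul] at h4
    have k3 : 1 ≤ ‖s - ρ‖ * ‖s - starRingEnd ℂ ρ‖ := by nlinarith
    nlinarith [norm_nonneg (Y s)]
  · obtain ⟨a₀, ha₀⟩ := hX.lower
    refine ⟨a₀, fun a ha => ?_⟩
    obtain ⟨C, T, h⟩ := ha₀ a ha
    refine ⟨C + 4, max T (|a| + 1 + |ρ.im|), fun s h1 h2 => ?_⟩
    have h3 := h s h1 ((le_max_left _ _).trans h2)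
    have h4 : |a| + 1 + |ρ.im| ≤ |s.im| := (le_max_right _ _).trans h2
    have hb : ∀ z : ℂ, z.re = 1 / 2 → |z.im| = |ρ.im| → ‖s - z‖ ≤ Real.exp (2 * |s.im|) := by
      intro z hz1 hz2
      have k1 := Complex.norm_le_abs_re_add_abs_im (s - z)
      rw [Complex.sub_re, Complex.sub_im, h1, hz1] at k1
      have k2 := abs_sub a (1 / 2)
      have k3 := abs_sub s.im z.im
      rw [abs_of_pos (by norm_num : (0 : ℝ) < 1 / 2)] at k2
      have k4 := Real.add_one_le_exp (2 * |s.im|)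
      linarith
    have hb1 := hb ρ hre rfl
    have hb2 := hb (starRingEnd ℂ ρ) (by simpa using hre) (by simp)
    rw [hXY, norm_mul, norm_mul] at h3
    have h5 : ‖s - ρ‖ * ‖s - starRingEnd ℂ ρ‖ ≤ Real.exp (4 * |s.im|) := by
      calc _ ≤ Real.exp (2 * |s.im|) * Real.exp (2 * |s.im|) := by gcongr
        _ = _ := by rw [← Real.exp_add]; ring_nf
    have h6 : Real.exp (-((C + 4) * |s.im|)) * Real.exp (4 * |s.im|) = Real.exp (-(C * |s.im|)) := by
      rw [← Real.exp_add]; ring_nf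
    have h7 : Real.exp (-((C + 4) * |s.im|)) * Real.exp (4 * |s.im|) ≤
        ‖Y s‖ * Real.exp (4 * |s.im|) := by
      rw [h6]; refine h3.trans ?_
      rw [mul_comm]; gcongr
    exact le_of_mul_le_mul_right h7 (Real.exp_pos _)
  · intro K
    obtain ⟨a₁, h⟩ := hX.logDeriv_re (K + 2)
    refine ⟨min a₁ (-1 / 2), fun s hs => ?_⟩
    have h2 := h s (hs.trans (min_le_left _ _))
    have h3 : s.re ≤ -1 / 2 := hs.trans (min_le_right _ _)
    have hb : ∀ z : ℂ, z.re = 1 / 2 → s - z ≠ 0 ∧ -1 ≤ (logDeriv (fun w => w - z) s).re := by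
      intro z hz
      have k1 : 1 ≤ ‖s - z‖ := by
        refine le_trans ?_ (Complex.abs_re_le_norm _)
        rw [Complex.sub_re, hz, abs_of_neg (by linarith)]; linarith
      refine ⟨fun h => by rw [h, norm_zero] at k1; linarith, ?_⟩
      have : logDeriv (fun w => w - z) s = (s - z)⁻¹ := by
        simp [logDeriv_apply]
      rw [this]
      have k2 := (abs_le.1 (Complex.abs_re_le_norm (s - z)⁻¹)).1
      have k3 : ‖(s - z)⁻¹‖ ≤ 1 := by rw [norm_inv]; exact inv_le_one_of_one_le₀ k1
      linarith
    obtain ⟨n1, b1⟩ := hb ρ hre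
    obtain ⟨n2, b2⟩ := hb (starRingEnd ℂ ρ) (by simpa using hre)
    have hYs : Y s ≠ 0 := fun h => hX.ne_zero s (by linarith) (by rw [hXY, h, mul_zero])
    have e : X = fun s => (s - ρ) * (s - starRingEnd ℂ ρ) * Y s := funext hXY
    rw [e, logDeriv_mul (f := fun s => (s - ρ) * (s - starRingEnd ℂ ρ)) s (mul_ne_zero n1 n2) hYs
      (by fun_prop) (hYd s), logDeriv_mul (f := fun s => s - ρ) s n1 n2 (by fun_prop) (by fun_prop),
      Complex.add_re, Complex.add_re] at h2
    linarith

/-- Every zero `ρ` contributes at most `Re (s - ρ)⁻¹` to `Re (X' / X)` left of the critical line: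
a finite, inequality form of the Hadamard product. -/
lemma re_logDeriv_le_sum (Z : Finset ℂ) : ∀ {X : ℂ → ℂ}, IsXiLike X →
    (∀ ρ ∈ Z, X ρ = 0 ∧ 0 < ρ.im) → ∀ {s : ℂ}, s.re < 1 / 2 →
    (logDeriv X s).re ≤ ∑ ρ ∈ Z, ((s - ρ)⁻¹ + (s - starRingEnd ℂ ρ)⁻¹).re := by
  classical
  induction Z using Finset.induction_on with
  | empty => intro X hX _ s hs; simpa using hX.re_logDeriv_nonpos hs
  | insert ρ Z hρ ih =>
    intro X hX hZ s hs
    obtain ⟨h0, him⟩ := hZ ρ (Finset.mem_insert_self _ _)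
    obtain ⟨Y, hY, hXY⟩ := hX.exists_div h0 him.ne'
    have hre := hX.re_eq_half h0
    have hYZ : ∀ ρ' ∈ Z, Y ρ' = 0 ∧ 0 < ρ'.im := by
      intro ρ' h'
      obtain ⟨k1, k2⟩ := hZ ρ' (Finset.mem_insert_of_mem h')
      refine ⟨?_, k2⟩
      rw [hXY] at k1
      refine (mul_eq_zero.1 k1).resolve_left (mul_ne_zero ?_ ?_)
      · exact sub_ne_zero.2 fun h => hρ (h ▸ h')
      · refine sub_ne_zero.2 fun h => ?_
        rw [h, Complex.conj_im] at k2
        linarith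
    have n1 : s - ρ ≠ 0 := fun h => by
      have := congrArg Complex.re h; simp [hre] at this; linarith
    have n2 : s - starRingEnd ℂ ρ ≠ 0 := fun h => by
      have := congrArg Complex.re h; simp [hre] at this; linarith
    have e : X = fun s => (s - ρ) * (s - starRingEnd ℂ ρ) * Y s := funext hXY
    rw [Finset.sum_insert hρ, e,
      logDeriv_mul (f := fun s => (s - ρ) * (s - starRingEnd ℂ ρ)) s (mul_ne_zero n1 n2)
      (hY.ne_zero s hs) (by fun_prop) (hY.differentiable s),
      logDeriv_mul (f := fun s => s - ρ) s n1 n2 (by fun_prop) (by fun_prop), Complex.add_re,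
      Complex.add_re]
    have e1 : ∀ z : ℂ, logDeriv (fun w => w - z) s = (s - z)⁻¹ := fun z => by simp [logDeriv_apply]
    rw [e1, e1, Complex.add_re]
    linarith [ih hY hYZ hs]

end IsXiLike

/-! ### Infinitely many zeros -/

/-- An entire function with finitely many zeros is a polynomial times a zero-free function. -/
lemma exists_factorization_of_finite_zeros {X : ℂ → ℂ} (hd : Differentiable ℂ X) {z₀ : ℂ}
    (hz₀ : X z₀ ≠ 0) (hfin : {s | X s = 0}.Finite) :
    ∃ (Z : Finset ℂ) (n : ℂ → ℕ) (g : ℂ → ℂ), Differentiable ℂ g ∧ (∀ s, g s ≠ 0) ∧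
      ∀ s, X s = (∏ u ∈ Z, (s - u) ^ n u) * g s := by
  have hA : AnalyticOnNhd ℂ X univ := (Complex.analyticOnNhd_univ_iff_differentiable).2 hd
  have hNF : MeromorphicNFOn X univ := hA.meromorphicNFOn
  have hM : MeromorphicOn X univ := hNF.meromorphicOn
  have hord : ∀ u : (univ : Set ℂ), meromorphicOrderAt X u ≠ ⊤ := by
    refine (hM.exists_meromorphicOrderAt_ne_top_iff_forall isConnected_univ).1
      ⟨⟨z₀, mem_univ _⟩, ?_⟩
    rw [((hNF (mem_univ z₀)).meromorphicOrderAt_eq_zero_iff).2 hz₀]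
    simp
  have hsupp : (MeromorphicOn.divisor X univ).support = {s | X s = 0} := by
    have h := hNF.zero_set_eq_divisor_support hord
    rw [univ_inter] at h
    exact h.symm
  obtain ⟨g, hgA, hg0, hXg⟩ := hM.extract_zeros_poles hord (by rw [hsupp]; exact hfin)
  have hgd : Differentiable ℂ g := (Complex.analyticOnNhd_univ_iff_differentiable).1 hgA
  set d := MeromorphicOn.divisor X univ with hdef
  have hdnn : ∀ u, 0 ≤ d u := fun u => (hA.meromorphicNFOn.divisor_nonneg_iff_analyticOnNhd.2 hA) u
  refine ⟨hfin.toFinset, fun u => (d u).toNat, g, hgd, fun s => hg0 ⟨s, mem_univ s⟩, fun s => ?_⟩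
  have hprod : ∀ s, (∏ᶠ u, (· - u) ^ d u : ℂ → ℂ) s =
      ∏ u ∈ hfin.toFinset, (s - u) ^ (d u).toNat := by
    intro s
    rw [finprod_eq_prod_of_mulSupport_subset (s := hfin.toFinset), Finset.prod_apply]
    · refine Finset.prod_congr rfl fun u _ => ?_
      rw [Pi.pow_apply, ← zpow_natCast, Int.toNat_of_nonneg (hdnn u)]
    · rw [Function.FactorizedRational.mulSupport]
      intro u hu
      have : u ∈ d.support := hu
      rw [hsupp] at this
      simpa using this
  have hev : ∀ᶠ z in 𝓝[≠] s, X z = (∏ u ∈ hfin.toFinset, (z - u) ^ (d u).toNat) * g z := by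
    have h1 : ∀ᶠ z in codiscreteWithin univ, X z =
        (∏ u ∈ hfin.toFinset, (z - u) ^ (d u).toNat) * g z := by
      filter_upwards [hXg] with z hz
      rw [hz, Pi.smul_apply', hprod, smul_eq_mul]
    have h2 := mem_codiscreteWithin.1 h1 s (mem_univ s)
    rw [disjoint_principal_right] at h2
    filter_upwards [h2] with z hz
    simpa using hz
  have hc : Continuous fun z => (∏ u ∈ hfin.toFinset, (z - u) ^ (d u).toNat) * g z :=
    (continuous_finsetProd _ fun u _ => by fun_prop).mul hgd.continuous
  exact ((hd.continuous.continuousAt.eventuallyEq_nhds_iff_eventuallyEq_nhdsNE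
    hc.continuousAt).1 hev).self_of_nhds

/-- A zero-free entire function of order at most `3 / 2` has exponential type: its logarithm is a
polynomial of degree less than `2`. -/
lemma exists_norm_le_exp_of_ne_zero {g : ℂ → ℂ} (hd : Differentiable ℂ g) (h0 : ∀ s, g s ≠ 0)
    {C R₀ : ℝ} (hg : ∀ s, R₀ ≤ ‖s‖ → ‖g s‖ ≤ Real.exp (C * (1 + ‖s‖) ^ (3 / 2 : ℝ))) :
    ∃ C' : ℝ, 0 ≤ C' ∧ ∀ s, ‖g s‖ ≤ Real.exp (C' * (1 + ‖s‖)) := by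
  obtain ⟨h, he, hh⟩ := exists_log_of_convex convex_univ isOpen_univ univ_nonempty hd
    fun s _ => h0 s
  have hhd : Differentiable ℂ h := fun s => (hh s (mem_univ s)).differentiableAt
  have hgn : ∀ s, ‖g s‖ = Real.exp (h s).re := fun s => by
    rw [← he s (mem_univ s), Complex.norm_exp]
  set D := |C| + 1 with hD
  have hDpos : 0 < D := by positivity
  have hre : ∀ R, max R₀ 1 ≤ R → ∀ z, ‖z‖ ≤ R → (h z).re ≤ D * (1 + R) ^ (3 / 2 : ℝ) := by
    intro R hR z hz
    have hR1 : 1 ≤ R := (le_max_right _ _).trans hR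
    have := Complex.norm_le_of_forall_mem_frontier_norm_le (U := Metric.ball (0 : ℂ) R) (f := g)
      Metric.isBounded_ball hd.diffContOnCl (C := Real.exp (D * (1 + R) ^ (3 / 2 : ℝ)))
      (fun w hw => by
        rw [frontier_ball _ (by linarith), mem_sphere_zero_iff_norm] at hw
        refine (hg w (by rw [hw]; exact (le_max_left _ _).trans hR)).trans ?_
        rw [hw, Real.exp_le_exp]
        gcongr
        rw [hD]; linarith [le_abs_self C])
      (z := z) (by rw [closure_ball _ (by linarith)]; simpa using hz)
    rwa [hgn, Real.exp_le_exp] at this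
  have hbd : ∀ R, max R₀ 1 ≤ R → ∀ z, ‖z‖ ≤ R / 2 →
      ‖h z‖ ≤ 2 * (D * (1 + R) ^ (3 / 2 : ℝ)) + 3 * ‖h 0‖ := by
    intro R hR z hz
    have hR1 : 1 ≤ R := (le_max_right _ _).trans hR
    have hpos : 0 < R - ‖z‖ := by linarith
    refine (Complex.borelCaratheodory (M := D * (1 + R) ^ (3 / 2 : ℝ)) (R := R) (by positivity)
      hhd.differentiableOn (fun w hw => hre R hR w (by simpa using (mem_ball_zero_iff.1 hw).le))
      (by linarith) (by rw [mem_ball_zero_iff]; linarith)).trans ?_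
    gcongr
    · rw [div_le_iff₀ hpos]
      have : 0 ≤ D * (1 + R) ^ (3 / 2 : ℝ) := by positivity
      nlinarith
    · rw [div_le_iff₀ hpos]
      nlinarith [norm_nonneg (h 0)]
  have hdd : ∀ c, iteratedDeriv 2 h c = 0 := by
    intro c
    have hle : ∀ᶠ r : ℝ in atTop, ‖iteratedDeriv 2 h c‖ ≤
        2 * (2 * (D * (1 + 2 * (r + ‖c‖)) ^ (3 / 2 : ℝ)) + 3 * ‖h 0‖) / r ^ 2 := by
      filter_upwards [eventually_ge_atTop (max R₀ 1)] with r hr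
      have hr1 : 1 ≤ r := (le_max_right _ _).trans hr
      have := Complex.norm_iteratedDeriv_le_of_forall_mem_sphere_norm_le (f := h) (c := c) 2
        (by linarith : 0 < r) hhd.diffContOnCl (C := 2 * (D * (1 + 2 * (r + ‖c‖)) ^ (3 / 2 : ℝ)) + 3 * ‖h 0‖)
        (fun z hz => hbd (2 * (r + ‖c‖)) (by linarith [norm_nonneg c]) z (by
          have hz' : ‖z - c‖ = r := by simpa [dist_eq_norm] using hz
          have := norm_add_le (z - c) c
          rw [sub_add_cancel, hz'] at this
          linarith))
      simpa using this
    have hlim : Tendsto (fun r : ℝ =>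
        4 * D * 3 ^ (3 / 2 : ℝ) * r ^ (-(1 / 2) : ℝ) + 6 * ‖h 0‖ * r ^ (-2 : ℝ)) atTop (𝓝 0) := by
      have h1 := (tendsto_rpow_neg_atTop (by norm_num : (0 : ℝ) < 1 / 2)).const_mul
        (4 * D * 3 ^ (3 / 2 : ℝ))
      have h2 := (tendsto_rpow_neg_atTop (by norm_num : (0 : ℝ) < 2)).const_mul (6 * ‖h 0‖)
      simpa using h1.add h2
    have : ‖iteratedDeriv 2 h c‖ ≤ 0 := by
      refine ge_of_tendsto hlim ?_
      filter_upwards [hle, eventually_ge_atTop (1 + 2 * ‖c‖)] with r hr hr2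
      have hr0 : 0 < r := by linarith [norm_nonneg c]
      refine hr.trans ?_
      have h3 : (1 + 2 * (r + ‖c‖)) ^ (3 / 2 : ℝ) ≤ 3 ^ (3 / 2 : ℝ) * r ^ (3 / 2 : ℝ) := by
        rw [← Real.mul_rpow (by norm_num) hr0.le]
        gcongr
        linarith
      have h4 : r ^ (3 / 2 : ℝ) = r ^ (-(1 / 2) : ℝ) * r ^ 2 := by
        rw [← Real.rpow_natCast r 2, ← Real.rpow_add hr0]; norm_num
      have h5 : r ^ (-2 : ℝ) * r ^ 2 = 1 := by
        rw [← Real.rpow_natCast r 2, ← Real.rpow_add hr0]; norm_num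
      rw [div_le_iff₀ (by positivity)]
      calc 2 * (2 * (D * (1 + 2 * (r + ‖c‖)) ^ (3 / 2 : ℝ)) + 3 * ‖h 0‖)
          ≤ 2 * (2 * (D * (3 ^ (3 / 2 : ℝ) * r ^ (3 / 2 : ℝ))) + 3 * ‖h 0‖) := by gcongr
        _ = _ := by rw [h4]; linear_combination (-6 * ‖h 0‖) * h5
    exact norm_le_zero_iff.1 this
  have hd1 : Differentiable ℂ (deriv h) := by
    have := (Complex.analyticOnNhd_univ_iff_differentiable.2 hhd).deriv
    exact Complex.analyticOnNhd_univ_iff_differentiable.1 this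
  have hconst : ∀ s, deriv h s = deriv h 0 := fun s =>
    is_const_of_deriv_eq_zero hd1 (fun c => by
      have := hdd c
      rwa [iteratedDeriv_succ, iteratedDeriv_one] at this) s 0
  have hlin : ∀ s, h s = h 0 + deriv h 0 * s := by
    intro s
    have hd2 : Differentiable ℂ fun s => h s - deriv h 0 * s := hhd.sub (by fun_prop)
    have := is_const_of_deriv_eq_zero hd2 (fun c => by
      rw [deriv_fun_sub (hhd c) (by fun_prop), deriv_const_mul _ (by fun_prop), hconst c]
      simp) s 0
    simp only [mul_zero, sub_zero] at this
    linear_combination this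
  refine ⟨‖h 0‖ + ‖deriv h 0‖, by positivity, fun s => ?_⟩
  rw [hgn, Real.exp_le_exp]
  calc (h s).re ≤ ‖h s‖ := Complex.re_le_norm _
    _ ≤ ‖h 0‖ + ‖deriv h 0‖ * ‖s‖ := by
      rw [hlin s]; exact (norm_add_le _ _).trans (by rw [norm_mul])
    _ ≤ _ := by nlinarith [norm_nonneg (h 0), norm_nonneg (deriv h 0), norm_nonneg s]

/-- A xi-like function of order at most `3 / 2` has infinitely many zeros: otherwise it would be of
exponential type, but it grows faster than every exponential as `σ → -∞`. -/
lemma IsXiLike.infinite_zeros {X : ℂ → ℂ} (hX : IsXiLike X)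
    (hg : ∃ C : ℝ, ∀ s, ‖X s‖ ≤ Real.exp (C * (1 + ‖s‖) ^ (3 / 2 : ℝ))) :
    {s | X s = 0}.Infinite := by
  intro hfin
  obtain ⟨C, hC⟩ := hg
  obtain ⟨Z, n, g, hgd, hg0, hXg⟩ := exists_factorization_of_finite_zeros hX.differentiable
    (hX.ne_zero 0 (by simp)) hfin
  obtain ⟨R₀, hR₀⟩ : ∃ R₀ : ℝ, ∀ u ∈ Z, ‖u‖ ≤ R₀ := by
    obtain ⟨R, hR⟩ := Z.finite_toSet.isBounded.exists_norm_le
    exact ⟨R, fun u hu => hR u hu⟩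
  obtain ⟨C', hC'0, hC'⟩ := exists_norm_le_exp_of_ne_zero hgd hg0 (C := C) (R₀ := R₀ + 1) (by
    intro s hs
    refine le_trans ?_ (hC s)
    rw [hXg, norm_mul]
    refine le_mul_of_one_le_left (norm_nonneg _) ?_
    rw [norm_prod]
    refine Finset.prod_induction _ (fun r : ℝ => 1 ≤ r) (fun _ _ => one_le_mul_of_one_le_of_one_le)
      le_rfl fun u hu => ?_
    rw [norm_pow]
    refine one_le_pow₀ ?_
    have := norm_sub_norm_le s u
    linarith [hR₀ u hu])
  have hprod : ∀ s, ‖∏ u ∈ Z, (s - u) ^ n u‖ ≤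
      Real.exp ((∑ u ∈ Z, n u * (1 + ‖u‖)) * (1 + ‖s‖)) := by
    intro s
    rw [norm_prod, Finset.sum_mul, Real.exp_sum]
    refine Finset.prod_le_prod (fun _ _ => norm_nonneg _) fun u _ => ?_
    rw [norm_pow, mul_assoc, Real.exp_nat_mul]
    gcongr
    refine (norm_sub_le s u).trans ?_
    have := Real.add_one_le_exp ((1 + ‖u‖) * (1 + ‖s‖))
    nlinarith [norm_nonneg u, norm_nonneg s]
  set K₀ := (∑ u ∈ Z, n u * (1 + ‖u‖)) + C' with hK₀
  have hK₀0 : 0 ≤ K₀ := by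
    have : 0 ≤ ∑ u ∈ Z, n u * (1 + ‖u‖) := Finset.sum_nonneg fun u _ => by positivity
    linarith
  have hup : ∀ s, ‖X s‖ ≤ Real.exp (K₀ * (1 + ‖s‖)) := by
    intro s
    rw [hXg, norm_mul, hK₀, add_mul, Real.exp_add]
    exact mul_le_mul (hprod s) (hC' s) (norm_nonneg _) (Real.exp_pos _).le
  obtain ⟨V, hVe, hVd⟩ := hX.exists_log
  obtain ⟨a₁, ha₁⟩ := hX.logDeriv_re (K₀ + 1)
  set a := min a₁ 0 with ha
  have ha0 : a ≤ 0 := min_le_right _ _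
  set x := -|K₀ - (V a).re - (K₀ + 1) * a| - 1 + a with hx
  have hxa : x ≤ a := by
    rw [hx]; linarith [abs_nonneg (K₀ - (V a).re - (K₀ + 1) * a)]
  have h1 := IsXiLike.re_log_add_le hVd (by linarith : a < 1 / 2)
    (fun s hs => ha₁ s (hs.trans (min_le_left _ _))) hxa le_rfl 0
  have h2 := hup x
  rw [← hVe x (by rw [Complex.ofReal_re]; linarith), Complex.norm_exp, Real.exp_le_exp,
    Complex.norm_real, Real.norm_eq_abs, abs_of_nonpos (by linarith)] at h2
  simp only [Complex.ofReal_zero, zero_mul, add_zero] at h1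
  have h3 := le_abs_self (K₀ - (V a).re - (K₀ + 1) * a)
  nlinarith

/-! ### Products of real linear factors -/

/-- The monic polynomial with the real roots `S`, listed with multiplicity. -/
noncomputable def rootProd (S : Multiset ℝ) (s : ℂ) : ℂ :=
  (S.map fun a : ℝ => s - (a : ℂ)).prod

/-- The logarithm of `rootProd S` off the real axis, formed from the principal branches. -/
noncomputable def rootLog (S : Multiset ℝ) (s : ℂ) : ℂ :=
  (S.map fun a : ℝ => Complex.log (s - (a : ℂ))).sum

@[simp] lemma rootProd_zero (s : ℂ) : rootProd 0 s = 1 := by simp [rootProd]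

@[simp] lemma rootProd_cons (a : ℝ) (S : Multiset ℝ) (s : ℂ) :
    rootProd (a ::ₘ S) s = (s - a) * rootProd S s := by simp [rootProd]

@[simp] lemma rootLog_zero (s : ℂ) : rootLog 0 s = 0 := by simp [rootLog]

@[simp] lemma rootLog_cons (a : ℝ) (S : Multiset ℝ) (s : ℂ) :
    rootLog (a ::ₘ S) s = Complex.log (s - a) + rootLog S s := by simp [rootLog]

lemma differentiable_rootProd (S : Multiset ℝ) : Differentiable ℂ (rootProd S) := by
  induction S using Multiset.induction_on with
  | empty =>
    rw [funext rootProd_zero]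
    exact differentiable_const 1
  | cons a S ih =>
    rw [funext (rootProd_cons a S)]
    exact (differentiable_id.sub_const (a : ℂ)).mul ih

lemma rootProd_eq_zero_iff {S : Multiset ℝ} {s : ℂ} : rootProd S s = 0 ↔ ∃ a ∈ S, s = (a : ℂ) := by
  simp [rootProd, Multiset.prod_eq_zero_iff, sub_eq_zero]

lemma rootProd_map_one_sub (S : Multiset ℝ) (s : ℂ) :
    rootProd (S.map fun a => 1 - a) s = (-1) ^ Multiset.card S * rootProd S (1 - s) := by
  induction S using Multiset.induction_on with
  | empty => simp
  | cons a S ih =>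
    rw [Multiset.map_cons, rootProd_cons, rootProd_cons, ih, Multiset.card_cons, pow_succ]
    push_cast
    ring

lemma exp_rootLog (S : Multiset ℝ) {s : ℂ} (hs : s.im ≠ 0) :
    Complex.exp (rootLog S s) = rootProd S s := by
  induction S using Multiset.induction_on with
  | empty => simp
  | cons a S ih =>
    rw [rootLog_cons, rootProd_cons, Complex.exp_add, ih, Complex.exp_log]
    intro h
    have := congrArg Complex.im h
    simp at this
    exact hs this

lemma abs_im_rootLog_le (S : Multiset ℝ) (s : ℂ) :
    |(rootLog S s).im| ≤ Multiset.card S * Real.pi := by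
  induction S using Multiset.induction_on with
  | empty => simp
  | cons a S ih =>
    rw [rootLog_cons, Complex.add_im, Multiset.card_cons]
    refine (abs_add_le _ _).trans ?_
    have := Complex.abs_arg_le_pi (s - a)
    rw [← Complex.log_im] at this
    push_cast
    linarith

lemma continuousAt_rootLog (S : Multiset ℝ) {s : ℂ} (hs : s.im ≠ 0) :
    ContinuousAt (rootLog S) s := by
  induction S using Multiset.induction_on with
  | empty => exact (continuousAt_const (y := (0 : ℂ))).congr (Eventually.of_forall fun s => by simp)
  | cons a S ih =>
    have h : ContinuousAt (fun z : ℂ => Complex.log (z - a)) s :=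
      ContinuousAt.clog (by fun_prop) (Or.inr (by simpa using hs))
    exact (h.add ih).congr (Eventually.of_forall fun s => by simp)

/-- Moving left by `d` multiplies each factor at most by `1 + d ≤ e^d`, once the distance to all
roots is at least `1`. -/
lemma norm_rootProd_sub_le (S : Multiset ℝ) {s : ℂ} {d : ℝ} (hd : 0 ≤ d)
    (hs : ∀ a ∈ S, s.re ≤ a - 1) :
    ‖rootProd S (s - d)‖ ≤ ‖rootProd S s‖ * Real.exp (Multiset.card S * d) := by
  induction S using Multiset.induction_on with
  | empty => simp
  | cons a S ih =>
    rw [rootProd_cons, rootProd_cons, norm_mul, norm_mul, Multiset.card_cons]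
    have h1 := ih fun b hb => hs b (Multiset.mem_cons_of_mem hb)
    have h2 : 1 ≤ ‖s - a‖ := by
      refine le_trans ?_ (Complex.abs_re_le_norm _)
      have := hs a (Multiset.mem_cons_self _ _)
      rw [Complex.sub_re, Complex.ofReal_re, abs_of_nonpos (by linarith)]
      linarith
    have h3 : ‖s - d - a‖ ≤ ‖s - a‖ * Real.exp d := by
      have e : s - d - a = (s - a) - (d : ℂ) := by ring
      have k1 := norm_sub_le (s - a) (d : ℂ)
      rw [Complex.norm_real, Real.norm_of_nonneg hd] at k1
      rw [e]
      have := Real.add_one_le_exp d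
      nlinarith
    calc ‖s - d - a‖ * ‖rootProd S (s - d)‖
        ≤ (‖s - a‖ * Real.exp d) * (‖rootProd S s‖ * Real.exp (Multiset.card S * d)) := by gcongr
      _ = _ := by
        have : ((Multiset.card S + 1 : ℕ) : ℝ) * d = d + Multiset.card S * d := by push_cast; ring
        rw [this, Real.exp_add]; ring

/-! ### The argument of a xi-like function to the left of the critical line -/

namespace IsXiLike

variable {X V : ℂ → ℂ}

lemma logDeriv_conj (hX : IsXiLike X) (s : ℂ) :
    logDeriv X (starRingEnd ℂ s) = starRingEnd ℂ (logDeriv X s) := by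
  have h := (hX.differentiable s).hasDerivAt.conj_conj
  have e : (starRingEnd ℂ) ∘ X ∘ (starRingEnd ℂ) = X := by
    funext z; simp [hX.conj]
  rw [e] at h
  rw [logDeriv_apply, logDeriv_apply, h.deriv, hX.conj, map_div₀]

lemma im_log_ofReal (hX : IsXiLike X)
    (hVd : ∀ s : ℂ, s.re < 1 / 2 → HasDerivAt V (logDeriv X s) s) {x : ℝ} (hx : x < 1 / 2) :
    (V x).im = (V 0).im := by
  have hd : ∀ y ∈ Iio (1 / 2 : ℝ), HasDerivAt (fun x : ℝ => (V x).im) 0 y := by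
    intro y hy
    have h1 := ((hVd y (by simpa using hy)).const_mul (-Complex.I)).real_of_complex
    have h2 : (logDeriv X y).im = 0 := by
      have := hX.logDeriv_conj y
      rw [Complex.conj_ofReal] at this
      exact Complex.conj_eq_iff_im.1 this.symm
    simpa [h2] using h1
  have := isOpen_Iio.is_const_of_deriv_eq_zero isPreconnected_Iio
    (fun y hy => (hd y hy).differentiableAt.differentiableWithinAt)
    (fun y hy => (hd y hy).deriv) (x := x) (y := 0) hx (by simp)
  simpa using this

/-- Far to the left the argument is strictly monotone in `t`, hence large for large `|t|`. -/
lemma abs_le_abs_im_log (hX : IsXiLike X)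
    (hVd : ∀ s : ℂ, s.re < 1 / 2 → HasDerivAt V (logDeriv X s) s) {a : ℝ} (ha : a < 1 / 2)
    (hK : ∀ s : ℂ, s.re ≤ a → (logDeriv X s).re ≤ -1) {s : ℂ} (hs : s.re ≤ a) :
    |s.im| ≤ |(V s).im - (V 0).im| := by
  have hσ : s.re < 1 / 2 := hs.trans_lt ha
  have hd := fun t => hasDerivAt_im_log hVd hσ t
  have key : ∀ x y : ℝ, x ≤ y → (V (s.re + y * Complex.I)).im - (V (s.re + x * Complex.I)).im ≤
      -1 * (y - x) := fun x y hxy =>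
    image_sub_le_mul_sub_of_deriv_le (f := fun y : ℝ => (V (s.re + y * Complex.I)).im)
      (fun t => (hd t).differentiableAt)
      (fun t => by rw [(hd t).deriv]; exact hK _ (by simpa using hs)) hxy
  have h0 : (V (s.re + (0 : ℝ) * Complex.I)).im = (V 0).im := by
    simpa using hX.im_log_ofReal hVd hσ
  rcases le_total 0 s.im with h | h
  · have := key 0 s.im h
    rw [h0, Complex.re_add_im] at this
    rw [abs_of_nonneg h, abs_of_nonpos (by linarith)]
    linarith
  · have := key s.im 0 h
    rw [h0, Complex.re_add_im] at this
    rw [abs_of_nonpos h, abs_of_nonneg (by linarith)]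
    linarith

lemma infinite_zeros_im_pos (hX : IsXiLike X) (hinf : {s | X s = 0}.Infinite) :
    {s | X s = 0 ∧ 0 < s.im}.Infinite := by
  intro hfin
  refine hinf (((hfin.union (hfin.image (starRingEnd ℂ))).union (finite_singleton (1 / 2 : ℂ))).subset
    fun s hs => ?_)
  have hs0 : X s = 0 := hs
  rcases lt_trichotomy s.im 0 with h | h | h
  · refine Or.inl (Or.inr ⟨starRingEnd ℂ s, ⟨by rw [hX.conj, hs0, map_zero], by simpa using h⟩, ?_⟩)
    simp
  · refine Or.inr ?_
    apply Complex.ext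
    · rw [hX.re_eq_half hs0]; simp
    · rw [h]; simp
  · exact Or.inl (Or.inl ⟨hs0, h⟩)

lemma hasDerivAt_arctan_div {d : ℝ} (hd : 0 < d) (c t : ℝ) :
    HasDerivAt (fun y : ℝ => Real.arctan ((y - c) / d)) (d / (d ^ 2 + (t - c) ^ 2)) t := by
  have h := (((hasDerivAt_id t).sub_const c).div_const d).arctan
  refine h.congr_deriv ?_
  simp only [id]
  field_simp

lemma inv_sub_re {ρ : ℂ} (hρ : ρ.re = 1 / 2) (σ t : ℝ) :
    (((σ : ℂ) + t * Complex.I - ρ)⁻¹).re =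
      -((1 / 2 - σ) / ((1 / 2 - σ) ^ 2 + (t - ρ.im) ^ 2)) := by
  rw [Complex.inv_re, Complex.normSq_apply]
  simp only [Complex.sub_re, Complex.add_re, Complex.ofReal_re, Complex.mul_re, Complex.I_re,
    mul_zero, Complex.ofReal_im, Complex.I_im, mul_one, sub_self, add_zero, hρ, Complex.sub_im,
    Complex.add_im, Complex.mul_im, zero_add]
  rw [← neg_div]
  congr 1 <;> ring

/-- The argument decreases in `t` at least as fast as the sum of the arguments contributed by
finitely many pairs of zeros. -/
lemma antitone_im_log_add_sum (hX : IsXiLike X)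
    (hVd : ∀ s : ℂ, s.re < 1 / 2 → HasDerivAt V (logDeriv X s) s) (Z : Finset ℂ)
    (hZ : ∀ ρ ∈ Z, X ρ = 0 ∧ 0 < ρ.im) {σ : ℝ} (hσ : σ < 1 / 2) :
    Antitone fun t : ℝ => (V (σ + t * Complex.I)).im +
      ∑ ρ ∈ Z, (Real.arctan ((t - ρ.im) / (1 / 2 - σ)) + Real.arctan ((t + ρ.im) / (1 / 2 - σ))) := by
  have hd : ∀ t : ℝ, HasDerivAt (fun t : ℝ => (V (σ + t * Complex.I)).im +
      ∑ ρ ∈ Z, (Real.arctan ((t - ρ.im) / (1 / 2 - σ)) + Real.arctan ((t + ρ.im) / (1 / 2 - σ))))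
      ((logDeriv X (σ + t * Complex.I)).re + ∑ ρ ∈ Z,
        ((1 / 2 - σ) / ((1 / 2 - σ) ^ 2 + (t - ρ.im) ^ 2) +
        (1 / 2 - σ) / ((1 / 2 - σ) ^ 2 + (t + ρ.im) ^ 2))) t := by
    intro t
    refine (hasDerivAt_im_log hVd hσ t).add (HasDerivAt.fun_sum fun ρ _ => ?_)
    have h1 := hasDerivAt_arctan_div (by linarith : 0 < 1 / 2 - σ) ρ.im t
    have h2 := hasDerivAt_arctan_div (by linarith : 0 < 1 / 2 - σ) (-ρ.im) t
    simp only [sub_neg_eq_add] at h2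
    exact h1.add h2
  refine antitone_of_deriv_nonpos (fun t => (hd t).differentiableAt) fun t => ?_
  rw [(hd t).deriv]
  have h := re_logDeriv_le_sum Z hX hZ (s := σ + t * Complex.I) (by simpa using hσ)
  refine (add_le_add_left h _).trans_eq ?_
  rw [← Finset.sum_add_distrib]
  refine Finset.sum_eq_zero fun ρ hρ => ?_
  have hre := hX.re_eq_half (hZ ρ hρ).1
  rw [Complex.add_re, inv_sub_re hre, inv_sub_re (by simpa using hre), Complex.conj_im]
  simp only [sub_neg_eq_add]
  ring

lemma pi_div_four_le_arctan {x d : ℝ} (hd : 0 < d) (h : d ≤ x) : Real.pi / 4 ≤ Real.arctan (x / d) := by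
  rw [← Real.arctan_one]
  exact Real.arctan_strictMono.monotone ((one_le_div hd).2 h)

/-- On a bounded strip to the left of the critical line the argument tends to infinity with `|t|`,
uniformly up to the critical line. -/
lemma exists_lt_abs_im_log (hX : IsXiLike X) (hinf : {s | X s = 0}.Infinite)
    (hVd : ∀ s : ℂ, s.re < 1 / 2 → HasDerivAt V (logDeriv X s) s) (a K : ℝ) :
    ∃ T : ℝ, ∀ s : ℂ, a ≤ s.re → s.re < 1 / 2 → T ≤ |s.im| → K < |(V s).im - (V 0).im| := by
  obtain ⟨n, hn⟩ := exists_nat_gt (K / (Real.pi / 2))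
  rw [div_lt_iff₀ (by have := Real.pi_pos; positivity)] at hn
  obtain ⟨Z, hZs, hZc⟩ := (hX.infinite_zeros_im_pos hinf).exists_subset_card_eq n
  have hZ : ∀ ρ ∈ Z, X ρ = 0 ∧ 0 < ρ.im := fun ρ hρ => hZs hρ
  obtain ⟨G, hG⟩ : ∃ G : ℝ, ∀ ρ ∈ Z, ‖ρ‖ ≤ G := by
    obtain ⟨G, h⟩ := Z.finite_toSet.isBounded.exists_norm_le
    exact ⟨G, fun u hu => h u hu⟩
  refine ⟨|G| + |1 / 2 - a|, fun s h1 h2 h3 => ?_⟩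
  have hd : 0 < 1 / 2 - s.re := by linarith
  have hda : 1 / 2 - s.re ≤ |1 / 2 - a| := by linarith [le_abs_self (1 / 2 - a)]
  have hρ : ∀ ρ ∈ Z, 0 < ρ.im ∧ ρ.im ≤ |G| := fun ρ hρ =>
    ⟨(hZ ρ hρ).2, (le_abs_self _).trans ((Complex.abs_im_le_norm ρ).trans
      ((hG ρ hρ).trans (le_abs_self _)))⟩
  have hanti := hX.antitone_im_log_add_sum hVd Z hZ h2
  have h0 : (V (s.re + (0 : ℝ) * Complex.I)).im + ∑ ρ ∈ Z,
      (Real.arctan ((0 - ρ.im) / (1 / 2 - s.re)) + Real.arctan ((0 + ρ.im) / (1 / 2 - s.re))) =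
      (V 0).im := by
    have e : (V (s.re + (0 : ℝ) * Complex.I)).im = (V 0).im := by
      simpa using hX.im_log_ofReal hVd h2
    rw [e, add_eq_left]
    refine Finset.sum_eq_zero fun ρ _ => ?_
    rw [zero_sub, zero_add, neg_div, Real.arctan_neg]
    ring
  rcases le_total 0 s.im with h | h
  · have h4 := hanti h
    simp only at h4
    rw [h0, Complex.re_add_im] at h4
    rw [abs_of_nonneg h] at h3
    have h5 : (n : ℝ) * (Real.pi / 2) ≤ ∑ ρ ∈ Z, (Real.arctan ((s.im - ρ.im) / (1 / 2 - s.re)) +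
        Real.arctan ((s.im + ρ.im) / (1 / 2 - s.re))) := by
      rw [← hZc, ← nsmul_eq_mul]
      refine Finset.card_nsmul_le_sum _ _ _ fun ρ hρZ => ?_
      obtain ⟨k1, k2⟩ := hρ ρ hρZ
      have := pi_div_four_le_arctan hd (by linarith : 1 / 2 - s.re ≤ s.im - ρ.im)
      have := pi_div_four_le_arctan hd (by linarith : 1 / 2 - s.re ≤ s.im + ρ.im)
      linarith
    rw [abs_sub_comm]
    refine lt_of_lt_of_le ?_ (le_abs_self _)
    linarith
  · have h4 := hanti h
    simp only at h4
    rw [h0, Complex.re_add_im] at h4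
    rw [abs_of_nonpos h] at h3
    have h5 : ∑ ρ ∈ Z, (Real.arctan ((s.im - ρ.im) / (1 / 2 - s.re)) +
        Real.arctan ((s.im + ρ.im) / (1 / 2 - s.re))) ≤ n * (-(Real.pi / 2)) := by
      rw [← hZc, ← nsmul_eq_mul]
      refine Finset.sum_le_card_nsmul _ _ _ fun ρ hρZ => ?_
      obtain ⟨k1, k2⟩ := hρ ρ hρZ
      have r1 := pi_div_four_le_arctan hd (by linarith : 1 / 2 - s.re ≤ -(s.im - ρ.im))
      have r2 := pi_div_four_le_arctan hd (by linarith : 1 / 2 - s.re ≤ -(s.im + ρ.im))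
      rw [neg_div, Real.arctan_neg] at r1 r2
      linarith
    refine lt_of_lt_of_le ?_ (le_abs_self _)
    linarith

/-- To the left of the critical line, a bound for the argument of `X` together with a bound for
`X / P` confines a point to a bounded set. -/
lemma exists_norm_le_of_abs_im_log_le (hX : IsXiLike X) (hinf : {s | X s = 0}.Infinite)
    (hVe : ∀ s : ℂ, s.re < 1 / 2 → Complex.exp (V s) = X s)
    (hVd : ∀ s : ℂ, s.re < 1 / 2 → HasDerivAt V (logDeriv X s) s) (S : Multiset ℝ) (K B : ℝ) :
    ∃ R : ℝ, ∀ s : ℂ, s.re < 1 / 2 → |(V s).im - (V 0).im| ≤ K → ‖X s‖ ≤ B * ‖rootProd S s‖ →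
      ‖s‖ ≤ R := by
  set N := Multiset.card S with hN
  obtain ⟨a₁, ha₁⟩ := hX.logDeriv_re (N + 1)
  obtain ⟨A, hA⟩ : ∃ A : ℝ, ∀ a ∈ S, ‖a‖ ≤ A := by
    obtain ⟨A, h⟩ := S.toFinset.finite_toSet.isBounded.exists_norm_le
    exact ⟨A, fun u hu => h u (by simpa using hu)⟩
  set a := min a₁ (-|A| - 1) with ha
  have ha1 : a ≤ a₁ := min_le_left _ _
  have ha2 : a ≤ -|A| - 1 := min_le_right _ _
  have ha0 : a < 0 := by linarith [abs_nonneg A]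
  have haS : ∀ b ∈ S, a ≤ b - 1 := fun b hb => by
    have := (abs_le.1 (hA b hb)).1
    linarith [le_abs_self A]
  have hKa : ∀ s : ℂ, s.re ≤ a → (logDeriv X s).re ≤ -(N + 1) := fun s hs => ha₁ s (hs.trans ha1)
  have hXn : ∀ s : ℂ, s.re < 1 / 2 → ‖X s‖ = Real.exp (V s).re := fun s hs => by
    rw [← hVe s hs, Complex.norm_exp]
  -- the quotient is bounded on the compact piece `|t| ≤ K` of the line `Re s = a`
  obtain ⟨Q, hQ⟩ := (isCompact_Icc (a := -K) (b := K)).exists_bound_of_continuousOn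
    (f := fun t : ℝ => rootProd S (a + t * Complex.I) / X (a + t * Complex.I)) (by
      refine ContinuousOn.div ?_ ?_ fun t _ => hX.ne_zero _ (by simp; linarith)
      · exact ((differentiable_rootProd S).continuous.comp (by fun_prop)).continuousOn
      · exact (hX.differentiable.continuous.comp (by fun_prop)).continuousOn)
  obtain ⟨T, hT⟩ := hX.exists_lt_abs_im_log hinf hVd a K
  refine ⟨|a| + 1 + |B| * |Q| + |K| + |T|, fun s hs1 hs2 hs3 => ?_⟩
  refine (Complex.norm_le_abs_re_add_abs_im s).trans ?_
  have hBQ : 0 ≤ |B| * |Q| := by positivity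
  rcases le_total s.re a with hsa | hsa
  · have him : |s.im| ≤ K := (hX.abs_le_abs_im_log hVd (by linarith : a < 1 / 2)
      (fun z hz => (hKa z hz).trans (by have : (0 : ℝ) ≤ N := N.cast_nonneg; linarith)) hsa).trans hs2
    set d := a - s.re with hd
    have hd0 : 0 ≤ d := by linarith
    set s₁ : ℂ := a + s.im * Complex.I with hs₁
    have hs₁re : s₁.re = a := by simp [hs₁]
    have e : s = s₁ - d := by
      apply Complex.ext <;> simp [hs₁, hd]
    have h1 : Real.exp ((N + 1) * d) * ‖X s₁‖ ≤ ‖X s‖ := by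
      have := re_log_add_le hVd (by linarith : a < 1 / 2) hKa hsa le_rfl s.im
      rw [Complex.re_add_im] at this
      rw [hXn s hs1, hXn s₁ (by rw [hs₁re]; linarith), ← Real.exp_add, Real.exp_le_exp]
      linarith
    have h2 : ‖rootProd S s‖ ≤ ‖rootProd S s₁‖ * Real.exp (N * d) := by
      rw [e]; exact norm_rootProd_sub_le S hd0 fun b hb => by rw [hs₁re]; exact haS b hb
    have hX1 : 0 < ‖X s₁‖ := norm_pos_iff.2 (hX.ne_zero _ (by rw [hs₁re]; linarith))
    have h3 : ‖rootProd S s₁‖ ≤ |Q| * ‖X s₁‖ := by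
      have := hQ s.im (abs_le.1 him)
      rw [norm_div, div_le_iff₀ hX1] at this
      refine this.trans ?_
      gcongr
      exact le_abs_self Q
    have h4 : Real.exp d * (Real.exp (N * d) * ‖X s₁‖) ≤
        (|B| * |Q|) * (Real.exp (N * d) * ‖X s₁‖) := by
      calc Real.exp d * (Real.exp (N * d) * ‖X s₁‖) = Real.exp ((N + 1) * d) * ‖X s₁‖ := by
            rw [← mul_assoc, ← Real.exp_add]; ring_nf
        _ ≤ ‖X s‖ := h1
        _ ≤ |B| * ‖rootProd S s‖ := hs3.trans (by gcongr; exact le_abs_self B)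
        _ ≤ |B| * ((|Q| * ‖X s₁‖) * Real.exp (N * d)) := by
            gcongr; exact h2.trans (by gcongr)
        _ = _ := by ring
    have h5 := le_of_mul_le_mul_right h4 (by positivity)
    have h6 := Real.add_one_le_exp d
    have h7 : |s.re| ≤ |a| + d := by
      have : s.re = a - d := by rw [hd]; ring
      rw [this]
      refine (abs_sub _ _).trans ?_
      rw [abs_of_nonneg hd0]
    linarith [le_abs_self K, abs_nonneg T]
  · have him : |s.im| < T := by
      by_contra h
      exact absurd (hT s hsa hs1 (not_lt.1 h)) (not_lt.2 hs2)
    have : |s.re| ≤ |a| + 1 := by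
      rw [abs_le]
      constructor <;> linarith [neg_abs_le a, abs_nonneg a]
    linarith [le_abs_self T, abs_nonneg K]

/-- No curve to the left of the critical line tends to `∞` with `X / P` of constant phase and
bounded modulus. -/
lemma not_tendsto_norm_atTop (hX : IsXiLike X) (hinf : {s | X s = 0}.Infinite) (S : Multiset ℝ)
    {δ : ℝ → ℂ} (hδ : Continuous δ) {T B : ℝ} {e : ℂ} (hre : ∀ τ ≥ T, (δ τ).re < 1 / 2)
    (hph : ∀ τ ≥ T, ∃ r : ℝ, 0 < r ∧ r ≤ B ∧ X (δ τ) = r * e * rootProd S (δ τ)) :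
    ¬ Tendsto (fun τ => ‖δ τ‖) atTop atTop := by
  intro hlim
  obtain ⟨V, hVe, hVd⟩ := hX.exists_log
  have hbd : ∀ τ ≥ T, ‖X (δ τ)‖ ≤ (B * ‖e‖) * ‖rootProd S (δ τ)‖ := by
    intro τ hτ
    obtain ⟨r, hr0, hrB, hr⟩ := hph τ hτ
    rw [hr, norm_mul, norm_mul, Complex.norm_real, Real.norm_of_nonneg hr0.le]
    gcongr
  obtain ⟨R₀, hR₀⟩ := hX.exists_norm_le_of_abs_im_log_le hinf hVe hVd S 0 (B * ‖e‖)
  obtain ⟨T₁, hT₁⟩ := eventually_atTop.1 ((hlim.eventually_gt_atTop R₀).and (eventually_ge_atTop T))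
  -- from `T₁` on the curve stays off the real axis
  have him : ∀ τ ≥ T₁, (δ τ).im ≠ 0 := by
    intro τ hτ h0
    have hre' := hre τ (hT₁ τ hτ).2
    have h1 : δ τ = ((δ τ).re : ℂ) := by apply Complex.ext <;> simp [h0]
    have h2 := hR₀ (δ τ) hre' (by
      rw [h1, hX.im_log_ofReal hVd hre']; simp) (hbd τ (hT₁ τ hτ).2)
    exact absurd (hT₁ τ hτ).1 (not_lt.2 h2)
  have hne : ∀ τ ≥ T₁, X (δ τ) ≠ 0 := fun τ hτ => hX.ne_zero _ (hre τ (hT₁ τ hτ).2)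
  set ψ : ℝ → ℂ := fun τ => V (δ τ) - rootLog S (δ τ) with hψ
  have hψc : ContinuousOn ψ (Ici T₁) := by
    intro τ hτ
    refine ContinuousAt.continuousWithinAt (ContinuousAt.sub ?_ ?_)
    · exact (hVd _ (hre τ (hT₁ τ hτ).2)).continuousAt.comp hδ.continuousAt
    · exact (continuousAt_rootLog S (him τ hτ)).comp hδ.continuousAt
  have he0 : e ≠ 0 := by
    intro h
    obtain ⟨r, -, -, hr⟩ := hph T₁ (hT₁ T₁ le_rfl).2
    exact hne T₁ le_rfl (by rw [hr, h]; simp)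
  have hint : ∀ τ ≥ T₁, ∃ n : ℤ, (n : ℝ) = ((ψ τ).im - e.arg) / (2 * Real.pi) := by
    intro τ hτ
    obtain ⟨r, hr0, -, hr⟩ := hph τ (hT₁ τ hτ).2
    have hP : rootProd S (δ τ) ≠ 0 := fun h => hne τ hτ (by rw [hr, h, mul_zero])
    have h1 : Complex.exp (ψ τ) = Complex.exp (Real.log r + Complex.log e) := by
      rw [hψ, Complex.exp_sub, hVe _ (hre τ (hT₁ τ hτ).2), exp_rootLog S (him τ hτ), hr,
        Complex.exp_add, Complex.exp_log he0, ← Complex.ofReal_exp, Real.exp_log hr0]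
      field_simp
    obtain ⟨n, hn⟩ := Complex.exp_eq_exp_iff_exists_int.1 h1
    refine ⟨n, ?_⟩
    rw [hn, eq_div_iff (by have := Real.pi_pos; positivity)]
    simp [Complex.log_im]
  have hconst : ∀ τ ≥ T₁, (ψ τ).im = (ψ T₁).im := by
    intro τ hτ
    have h1 : ContinuousOn (fun τ => ((ψ τ).im - e.arg) / (2 * Real.pi)) (Ici T₁) :=
      ((Complex.continuous_im.comp_continuousOn hψc).sub continuousOn_const).div_const _
    have h2 := isPreconnected_Ici.constant_of_mapsTo
      Int.isClosedEmbedding_coe_real.isInducing.isDiscrete_range h1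
      (fun τ hτ => hint τ hτ) (mem_Ici.2 hτ) self_mem_Ici
    have hpi : (2 * Real.pi) ≠ 0 := by have := Real.pi_pos; positivity
    rw [div_left_inj' hpi] at h2
    linarith
  obtain ⟨R, hR⟩ := hX.exists_norm_le_of_abs_im_log_le hinf hVe hVd S
    (|(ψ T₁).im| + Multiset.card S * Real.pi + |(V 0).im|) (B * ‖e‖)
  obtain ⟨τ, h1, h2⟩ := ((hlim.eventually_gt_atTop R).and (eventually_ge_atTop T₁)).exists
  refine absurd h1 (not_lt.2 (hR (δ τ) (hre τ (hT₁ τ h2).2) ?_ (hbd τ (hT₁ τ h2).2)))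
  have e1 : (V (δ τ)).im = (ψ T₁).im + (rootLog S (δ τ)).im := by
    rw [← hconst τ h2, hψ, Complex.sub_im]; ring
  rw [e1]
  refine (abs_sub _ _).trans ?_
  gcongr
  exact (abs_add_le _ _).trans (by gcongr; exact abs_im_rootLog_le S _)

end IsXiLike

/-! ### Lines of constant phase -/

/-- Where `Re (f' / f) > 0`, a value of the same phase as `f p` and of smaller (larger) modulus is
taken, near `p`, only to the left (right) of `p`. -/
lemma eventually_re_lt_of_logDeriv_re_pos {f : ℂ → ℂ} {p : ℂ} (hf : DifferentiableAt ℂ f p)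
    (h0 : f p ≠ 0) (hL : 0 < (logDeriv f p).re) :
    ∀ᶠ z in 𝓝 p, ∀ r : ℝ, f z = r * f p → (r < 1 → z.re < p.re) ∧ (1 < r → p.re < z.re) := by
  set L := logDeriv f p with hLdef
  have hLre : L.re ≤ ‖L‖ := Complex.re_le_norm L
  have hd : HasDerivAt (fun z => f z / f p) L p := hf.hasDerivAt.div_const (f p)
  have ho := hd.isLittleO.def (c := L.re / 4) (by positivity)
  filter_upwards [ho] with z hz r hr
  have hq : f z / f p = r := by rw [hr, mul_div_cancel_right₀ _ h0]
  rw [hq, div_self h0, smul_eq_mul] at hz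
  set E : ℂ := (r : ℂ) - 1 - (z - p) * L with hE
  have h1 : ((r - 1 : ℝ) : ℂ) = L * (z - p) + E := by rw [hE]; push_cast; ring
  have h2 : ‖L‖ * ‖z - p‖ ≤ |r - 1| + ‖E‖ := by
    rw [← norm_mul]
    have e : L * (z - p) = ((r - 1 : ℝ) : ℂ) - E := by rw [h1]; ring
    rw [e]
    refine (norm_sub_le _ _).trans ?_
    rw [Complex.norm_real, Real.norm_eq_abs]
  have h3 : ‖L‖ * ‖z - p‖ ≤ 2 * |r - 1| := by
    nlinarith [norm_nonneg (z - p)]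
  have h4 : (r - 1) * L.re = ‖L‖ ^ 2 * (z - p).re + (starRingEnd ℂ L * E).re := by
    have h5 := congrArg (fun w => (starRingEnd ℂ L * w).re) h1
    simp only [mul_add, Complex.add_re] at h5
    rw [← mul_assoc, mul_comm (starRingEnd ℂ L) L, Complex.mul_conj, Complex.re_ofReal_mul,
      Complex.normSq_eq_norm_sq, mul_comm (starRingEnd ℂ L) ((r - 1 : ℝ) : ℂ),
      Complex.re_ofReal_mul, Complex.conj_re] at h5
    exact h5
  have h5 : |(starRingEnd ℂ L * E).re| ≤ |r - 1| * (L.re / 2) := by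
    refine (Complex.abs_re_le_norm _).trans ?_
    rw [norm_mul, Complex.norm_conj]
    calc ‖L‖ * ‖E‖ ≤ ‖L‖ * (L.re / 4 * ‖z - p‖) := by gcongr
      _ = (‖L‖ * ‖z - p‖) * (L.re / 4) := by ring
      _ ≤ (2 * |r - 1|) * (L.re / 4) := by gcongr
      _ = _ := by ring
  have hLpos : 0 < ‖L‖ ^ 2 := by have := hL.trans_le hLre; positivity
  have h6 := abs_le.1 h5
  rw [Complex.sub_re] at h4
  constructor
  · intro hr1
    rw [abs_of_neg (by linarith)] at h6
    have : ‖L‖ ^ 2 * (z.re - p.re) < 0 := by nlinarith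
    by_contra hcon
    nlinarith
  · intro hr1
    rw [abs_of_pos (by linarith)] at h6
    have : 0 < ‖L‖ ^ 2 * (z.re - p.re) := by nlinarith
    by_contra hcon
    nlinarith

/-- If `f ∘ γ` tends to `f q` for a cluster point `q` of `γ` that is isolated in its fibre, then
`γ` tends to `q`: it cannot cross small circles around `q` again and again. -/
lemma tendsto_of_mapClusterPt {f : ℂ → ℂ} {γ : ℝ → ℂ} {q : ℂ} (hγ : Continuous γ)
    (hf : AnalyticAt ℂ f q) (hcl : MapClusterPt q atTop γ)
    (hlim : Tendsto (fun τ => f (γ τ)) atTop (𝓝 (f q))) (hne : ∀ᶠ z in 𝓝[≠] q, f z ≠ f q) :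
    Tendsto γ atTop (𝓝 q) := by
  obtain ⟨r₀, hr₀, hball⟩ := Metric.eventually_nhds_iff_ball.1
    (hf.eventually_analyticAt.and (eventually_nhdsWithin_iff.1 hne))
  rw [Metric.tendsto_nhds]
  intro ε hε
  set r := min ε (r₀ / 2) with hr
  have hrpos : 0 < r := by positivity
  have hrr₀ : r < r₀ := (min_le_right _ _).trans_lt (half_lt_self hr₀)
  have hsub : Metric.sphere q r ⊆ Metric.ball q r₀ := fun z hz => by
    rw [Metric.mem_sphere] at hz
    rw [Metric.mem_ball, hz]; exact hrr₀
  obtain ⟨η, hη, hmin⟩ : ∃ η > 0, ∀ z ∈ Metric.sphere q r, η ≤ ‖f z - f q‖ := by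
    have hcont : ContinuousOn (fun z => ‖f z - f q‖) (Metric.sphere q r) := fun z hz =>
      (((hball z (hsub hz)).1.continuousAt.sub continuousAt_const).norm).continuousWithinAt
    obtain ⟨z, hz, hzmin⟩ := (isCompact_sphere q r).exists_isMinOn
      (NormedSpace.sphere_nonempty.2 hrpos.le) hcont
    refine ⟨_, ?_, fun w hw => hzmin hw⟩
    have hzq : z ≠ q := by
      rintro rfl
      rw [Metric.mem_sphere, dist_self] at hz
      linarith
    exact norm_pos_iff.2 (sub_ne_zero.2 ((hball z (hsub hz)).2 hzq))
  obtain ⟨T, hT⟩ := eventually_atTop.1 ((Metric.tendsto_nhds.1 hlim) η hη)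
  have hnot : ∀ τ ≥ T, dist (γ τ) q ≠ r := fun τ hτ h => by
    have h1 := hmin (γ τ) h
    have h2 := hT τ hτ
    rw [dist_eq_norm] at h2
    linarith
  obtain ⟨T₁, hT₁, hin⟩ := ((hcl.frequently (Metric.ball_mem_nhds q hrpos)).and_eventually
    (eventually_ge_atTop T)).exists
  have hin' : dist (γ T₁) q < r := hT₁
  filter_upwards [eventually_ge_atTop T₁] with τ hτ
  have hlt : dist (γ τ) q < r := by
    by_contra hcon
    have hcont : ContinuousOn (fun τ => dist (γ τ) q) (Icc T₁ τ) :=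
      (hγ.dist continuous_const).continuousOn
    obtain ⟨u, hu, hur⟩ := intermediate_value_Icc hτ hcont ⟨hin'.le, not_lt.1 hcon⟩
    exact hnot u (hin.trans hu.1) hur
  exact hlt.trans_le (min_le_left _ _)

namespace IsConstantPhaseLine

variable {f : ℂ → ℂ} {γ : ℝ → ℂ}

lemma norm_pos (h : IsConstantPhaseLine f γ) (τ : ℝ) : 0 < ‖f (γ τ)‖ :=
  norm_pos_iff.2 (h.ne_zero τ)

lemma eq_norm_mul (h : IsConstantPhaseLine f γ) (τ τ' : ℝ) :
    f (γ τ) = (‖f (γ τ)‖ : ℂ) * (f (γ τ') / (‖f (γ τ')‖ : ℂ)) := by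
  rw [← h.phase_const τ τ', mul_div_cancel₀]
  exact_mod_cast (h.norm_pos τ).ne'

lemma eq_div_mul (h : IsConstantPhaseLine f γ) (τ τ' : ℝ) :
    f (γ τ) = ((‖f (γ τ)‖ / ‖f (γ τ')‖ : ℝ) : ℂ) * f (γ τ') := by
  rw [h.eq_norm_mul τ τ']
  have := (h.norm_pos τ').ne'
  have h2 : (‖f (γ τ')‖ : ℂ) ≠ 0 := by exact_mod_cast this
  rw [norm_mul, norm_div, Complex.norm_real, Complex.norm_real, norm_norm, norm_norm, div_self this]
  push_cast
  field_simp

/-- A descending line cannot cross the critical line from left to right. -/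
lemma re_lt_of_le (h : IsConstantPhaseLine f γ) (hanti : StrictAnti fun τ => ‖f (γ τ)‖)
    (hcross : ∀ p, p.re = 1 / 2 → AnalyticAt ℂ f p → f p ≠ 0 → 0 < (logDeriv f p).re)
    {T : ℝ} (hT : (γ T).re < 1 / 2) {τ : ℝ} (hτ : T ≤ τ) : (γ τ).re < 1 / 2 := by
  by_contra hcon
  have hre : Continuous fun τ => (γ τ).re := Complex.continuous_re.comp h.continuous
  set A : Set ℝ := Icc T τ ∩ {u | 1 / 2 ≤ (γ u).re} with hA
  have hAc : IsClosed A := isClosed_Icc.inter (isClosed_le continuous_const hre)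
  have hAne : A.Nonempty := ⟨τ, ⟨hτ, le_rfl⟩, not_lt.1 hcon⟩
  have hAb : BddBelow A := ⟨T, fun u hu => hu.1.1⟩
  set u := sInf A with hu
  have huA : u ∈ A := hAc.csInf_mem hAne hAb
  have hTu : T < u := by
    refine lt_of_le_of_ne huA.1.1 fun hEq => ?_
    have := huA.2
    rw [mem_ofPred_eq, ← hEq] at this
    linarith
  have hbefore : ∀ v ∈ Ioo T u, (γ v).re < 1 / 2 := by
    intro v hv
    by_contra hc
    exact absurd (csInf_le hAb ⟨⟨hv.1.le, hv.2.le.trans huA.1.2⟩, not_lt.1 hc⟩) (not_le.2 hv.2)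
  have hIoo : Ioo T u ∈ 𝓝[<] u := Ioo_mem_nhdsLT hTu
  have hu_half : (γ u).re = 1 / 2 := by
    refine le_antisymm ?_ huA.2
    refine le_of_tendsto (hre.continuousAt.tendsto.mono_left nhdsWithin_le_nhds :
      Tendsto (fun τ => (γ τ).re) (𝓝[<] u) (𝓝 (γ u).re)) ?_
    filter_upwards [hIoo] with v hv using (hbefore v hv).le
  have hloc := eventually_re_lt_of_logDeriv_re_pos (h.analyticAt u).differentiableAt (h.ne_zero u)
    (hcross _ hu_half (h.analyticAt u) (h.ne_zero u))
  have hev : ∀ᶠ v in 𝓝[<] u, _ :=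
    (h.continuous.continuousAt.tendsto.mono_left nhdsWithin_le_nhds).eventually hloc
  obtain ⟨v, hv1, hv2⟩ := (hev.and hIoo).exists
  have h1 := (hv1 _ (h.eq_div_mul v u)).2 ((one_lt_div (h.norm_pos u)).2 (hanti hv2.2))
  linarith [hbefore v hv2]

/-- A descending line that meets the critical line is to the left of it ever after. -/
lemma re_lt_of_lt (h : IsConstantPhaseLine f γ) (hanti : StrictAnti fun τ => ‖f (γ τ)‖)
    (hcross : ∀ p, p.re = 1 / 2 → AnalyticAt ℂ f p → f p ≠ 0 → 0 < (logDeriv f p).re)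
    {τ₀ : ℝ} (hτ₀ : (γ τ₀).re = 1 / 2) {τ : ℝ} (hτ : τ₀ < τ) : (γ τ).re < 1 / 2 := by
  have hloc := eventually_re_lt_of_logDeriv_re_pos (h.analyticAt τ₀).differentiableAt
    (h.ne_zero τ₀) (hcross _ hτ₀ (h.analyticAt τ₀) (h.ne_zero τ₀))
  have hev : ∀ᶠ v in 𝓝[>] τ₀, _ :=
    (h.continuous.continuousAt.tendsto.mono_left nhdsWithin_le_nhds).eventually hloc
  obtain ⟨v, hv1, hv2⟩ := (hev.and (Ioo_mem_nhdsGT hτ)).exists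
  have h1 := (hv1 _ (h.eq_div_mul v τ₀)).1 ((div_lt_one (h.norm_pos τ₀)).2 (hanti hv2.1))
  exact h.re_lt_of_le hanti hcross (by rwa [hτ₀] at h1) hv2.2.le

/-- Along a descending line, `f` tends to its value at any forward cluster point, which is smaller
in modulus than all values on the line. -/
lemma tendsto_of_cluster (h : IsConstantPhaseLine f γ) (hanti : StrictAnti fun τ => ‖f (γ τ)‖)
    {q : ℂ} (hq : ContinuousAt f q) (hcl : MapClusterPt q atTop γ) :
    (∀ τ, ‖f q‖ < ‖f (γ τ)‖) ∧ Tendsto (fun τ => f (γ τ)) atTop (𝓝 (f q)) := by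
  have hclf : MapClusterPt (f q) atTop (fun τ => f (γ τ)) := hcl.continuousAt_comp hq
  have hbdd : BddBelow (range fun τ => ‖f (γ τ)‖) := ⟨0, by rintro _ ⟨τ, rfl⟩; exact norm_nonneg _⟩
  have hlim := tendsto_atTop_ciInf hanti.antitone hbdd
  set ℓ := ⨅ τ, ‖f (γ τ)‖ with hℓ
  set e := f (γ 0) / (‖f (γ 0)‖ : ℂ) with he
  have hlim2 : Tendsto (fun τ => f (γ τ)) atTop (𝓝 ((ℓ : ℂ) * e)) := by
    have h1 : Tendsto (fun τ => ((‖f (γ τ)‖ : ℝ) : ℂ) * e) atTop (𝓝 ((ℓ : ℂ) * e)) :=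
      ((Complex.continuous_ofReal.tendsto ℓ).comp hlim).mul_const e
    exact h1.congr fun τ => (h.eq_norm_mul τ 0).symm
  have heq : f q = (ℓ : ℂ) * e := by
    have hc : ClusterPt (f q) (map (fun τ => f (γ τ)) atTop) := hclf
    have := hc.mono hlim2
    exact eq_of_nhds_neBot this
  have hnorm : ‖f q‖ = ℓ := by
    refine tendsto_nhds_unique (f := fun τ => ‖f (γ τ)‖) (l := atTop) ?_ hlim
    rw [heq]
    exact hlim2.norm
  refine ⟨fun τ => ?_, by rw [heq]; exact hlim2⟩
  rw [hnorm]
  exact (ciInf_le hbdd (τ + 1)).trans_lt (hanti (by linarith))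

end IsConstantPhaseLine

/-! ### Lines of constant phase of a quotient `X / P` -/

namespace IsXiLike

variable {X : ℂ → ℂ} {S : Multiset ℝ} {γ : ℝ → ℂ}

/-- The quotient of a xi-like function by a product of real linear factors. -/
noncomputable def _root_.AngularLattice.rootQuotient (X : ℂ → ℂ) (S : Multiset ℝ) (s : ℂ) : ℂ :=
  X s / rootProd S s

lemma analyticAt_rootQuotient (hX : IsXiLike X) {s : ℂ} (hs : rootProd S s ≠ 0) :
    AnalyticAt ℂ (rootQuotient X S) s :=
  ((Complex.analyticOnNhd_univ_iff_differentiable.2 hX.differentiable) s (mem_univ s)).div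
    ((Complex.analyticOnNhd_univ_iff_differentiable.2 (differentiable_rootProd S)) s (mem_univ s)) hs

lemma eq_rootQuotient_mul {s : ℂ} (h : rootQuotient X S s ≠ 0) :
    X s = rootQuotient X S s * rootProd S s := by
  have : rootProd S s ≠ 0 := fun h0 => h (by rw [rootQuotient, h0, div_zero])
  rw [rootQuotient, div_mul_cancel₀ _ this]

/-- On the critical line `X` is real up to the direction of differentiation: `X' / X` is
purely imaginary. -/
lemma re_logDeriv_eq_zero (hX : IsXiLike X) {s : ℂ} (hs : s.re = 1 / 2) :
    (logDeriv X s).re = 0 := by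
  have h1 : 1 - s = starRingEnd ℂ s := by
    apply Complex.ext <;> simp [hs]; norm_num
  have h2 : logDeriv X (1 - s) = -logDeriv X s := by
    have hd : HasDerivAt (fun z => X (1 - z)) (-deriv X (1 - s)) s := by
      have := (hX.differentiable (1 - s)).hasDerivAt.comp s ((hasDerivAt_id s).const_sub 1)
      simpa [Function.comp_def] using this
    rw [funext hX.symm] at hd
    rw [logDeriv_apply, logDeriv_apply, hX.symm, hd.deriv]
    ring
  rw [h1, hX.logDeriv_conj] at h2
  have := congrArg Complex.re h2
  rw [Complex.conj_re, Complex.neg_re] at this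
  linarith

lemma logDeriv_rootQuotient_re_pos (hX : IsXiLike X)
    (hS : ∀ s : ℂ, s.re = 1 / 2 → (logDeriv (rootProd S) s).re < 0) {p : ℂ} (hp : p.re = 1 / 2)
    (h0 : rootQuotient X S p ≠ 0) : 0 < (logDeriv (rootQuotient X S) p).re := by
  have hP : rootProd S p ≠ 0 := fun h => h0 (by rw [rootQuotient, h, div_zero])
  have hXp : X p ≠ 0 := fun h => h0 (by rw [rootQuotient, h, zero_div])
  have : logDeriv (rootQuotient X S) p = logDeriv X p - logDeriv (rootProd S) p :=
    logDeriv_div p hXp hP (hX.differentiable p) (differentiable_rootProd S p)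
  rw [this, Complex.sub_re, hX.re_logDeriv_eq_zero hp]
  linarith [hS p hp]

lemma isZeroOf_rootQuotient (hX : IsXiLike X) {p : ℂ} (hp : rootProd S p ≠ 0) (h0 : X p = 0) :
    IsZeroOf (rootQuotient X S) p :=
  ⟨hX.analyticAt_rootQuotient hp, by rw [rootQuotient, h0, zero_div]⟩

lemma rootProd_ne_zero_of_re (hS' : ∀ a ∈ S, a ≠ 1 / 2) {p : ℂ} (hp : p.re = 1 / 2) :
    rootProd S p ≠ 0 := by
  intro h
  obtain ⟨a, ha, rfl⟩ := rootProd_eq_zero_iff.1 h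
  exact hS' a ha (by simpa using hp)

/-- A line of constant phase that comes from `σ = -∞` descends. -/
lemma strictAnti_of_tendsto_atBot (hX : IsXiLike X) (hinf : {s | X s = 0}.Infinite)
    (hγ : IsConstantPhaseLine (rootQuotient X S) γ)
    (hlim : Tendsto (fun τ => (γ τ).re) atBot atBot) :
    StrictAnti fun τ => ‖rootQuotient X S (γ τ)‖ := by
  refine hγ.monotone_norm.resolve_left fun hmono => ?_
  have hlim' : Tendsto (fun τ => (γ (-τ)).re) atTop atBot := hlim.comp tendsto_neg_atTop_atBot
  obtain ⟨T, hT⟩ := eventually_atTop.1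
    ((hlim'.eventually_lt_atBot (1 / 2)).and (eventually_ge_atTop 0))
  refine hX.not_tendsto_norm_atTop hinf S (hγ.continuous.comp continuous_neg) (T := T)
    (B := ‖rootQuotient X S (γ 0)‖)
    (e := rootQuotient X S (γ 0) / (‖rootQuotient X S (γ 0)‖ : ℂ))
    (fun τ hτ => (hT τ hτ).1) (fun τ hτ => ⟨‖rootQuotient X S (γ (-τ))‖, hγ.norm_pos _,
      hmono.monotone (by linarith [(hT τ hτ).2]), ?_⟩) ?_
  · rw [← hγ.eq_norm_mul]
    exact eq_rootQuotient_mul (hγ.ne_zero _)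
  · exact tendsto_atTop_mono (fun τ => Complex.abs_re_le_norm _)
      (tendsto_abs_atBot_atTop.comp hlim')

/-- A line of constant phase that comes from `σ = +∞` descends. The reflection `s ↦ 1 - s` fixes
`X` and reflects the roots. -/
lemma strictAnti_of_tendsto_atTop (hX : IsXiLike X) (hinf : {s | X s = 0}.Infinite)
    (hγ : IsConstantPhaseLine (rootQuotient X S) γ)
    (hlim : Tendsto (fun τ => (γ τ).re) atBot atTop) :
    StrictAnti fun τ => ‖rootQuotient X S (γ τ)‖ := by
  refine hγ.monotone_norm.resolve_left fun hmono => ?_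
  have hlim' : Tendsto (fun τ => (1 - γ (-τ)).re) atTop atBot := by
    have h1 : Tendsto (fun τ => (γ (-τ)).re) atTop atTop := hlim.comp tendsto_neg_atTop_atBot
    have h2 := tendsto_neg_atTop_atBot.comp h1
    refine (tendsto_atBot_add_const_left atTop 1 h2).congr fun τ => ?_
    simp only [Function.comp_apply, Complex.sub_re, Complex.one_re]
    ring
  obtain ⟨T, hT⟩ := eventually_atTop.1
    ((hlim'.eventually_lt_atBot (1 / 2)).and (eventually_ge_atTop 0))
  refine hX.not_tendsto_norm_atTop hinf (S.map fun a => 1 - a)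
    (δ := fun τ => 1 - γ (-τ)) (continuous_const.sub (hγ.continuous.comp continuous_neg)) (T := T)
    (B := ‖rootQuotient X S (γ 0)‖)
    (e := (-1) ^ Multiset.card S * (rootQuotient X S (γ 0) / (‖rootQuotient X S (γ 0)‖ : ℂ)))
    (fun τ hτ => (hT τ hτ).1) (fun τ hτ => ⟨‖rootQuotient X S (γ (-τ))‖, hγ.norm_pos _,
      hmono.monotone (by linarith [(hT τ hτ).2]), ?_⟩) ?_
  · have h1 := eq_rootQuotient_mul (hγ.ne_zero (-τ))
    rw [hX.symm, h1, hγ.eq_norm_mul (-τ) 0, rootProd_map_one_sub, sub_sub_cancel]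
    have h2 : ((-1 : ℂ) ^ Multiset.card S) * (-1) ^ Multiset.card S = 1 := by
      rw [← mul_pow]; norm_num
    rw [← hγ.eq_norm_mul (-τ) 0]
    linear_combination (-(‖rootQuotient X S (γ (-τ))‖ * (rootQuotient X S (γ 0) /
      (‖rootQuotient X S (γ 0)‖ : ℂ))) * rootProd S (γ (-τ))) * h2 +
      rootProd S (γ (-τ)) * hγ.eq_norm_mul (-τ) 0
  · exact tendsto_atTop_mono (fun τ => Complex.abs_re_le_norm _)
      (tendsto_abs_atBot_atTop.comp hlim')

/-- Lines from `σ = -∞` stay to the left of the critical line and adhere to it only at zeros. -/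
theorem eq_zero_of_mem_closure (hX : IsXiLike X) (hinf : {s | X s = 0}.Infinite)
    (hS : ∀ s : ℂ, s.re = 1 / 2 → (logDeriv (rootProd S) s).re < 0) (hS' : ∀ a ∈ S, a ≠ 1 / 2)
    (hγ : IsConstantPhaseLine (rootQuotient X S) γ)
    (hlim : Tendsto (fun τ => (γ τ).re) atBot atBot) {p : ℂ} (hp : p ∈ closure (range γ))
    (hre : p.re = 1 / 2) : IsZeroOf (rootQuotient X S) p := by
  have hPp := rootProd_ne_zero_of_re hS' hre
  refine hX.isZeroOf_rootQuotient hPp ?_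
  by_contra hXp
  have hanti := hX.strictAnti_of_tendsto_atBot hinf hγ hlim
  have hcross : ∀ p, p.re = 1 / 2 → AnalyticAt ℂ (rootQuotient X S) p → rootQuotient X S p ≠ 0 →
      0 < (logDeriv (rootQuotient X S) p).re :=
    fun p hp _ h0 => hX.logDeriv_rootQuotient_re_pos hS hp h0
  have hleft : ∀ τ, (γ τ).re < 1 / 2 := by
    intro τ
    obtain ⟨T, hT1, hT2⟩ := ((hlim.eventually_lt_atBot (1 / 2)).and (eventually_le_atBot τ)).exists
    exact hγ.re_lt_of_le hanti hcross hT1 hT2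
  -- `p` is adherent neither to the initial part of the line nor to a compact part of it
  have hcl : MapClusterPt p atTop γ := by
    rw [mapClusterPt_iff_frequently]
    intro U hU
    rw [frequently_atTop]
    intro T
    obtain ⟨T₀, hT₀⟩ := eventually_atBot.1 (hlim.eventually_le_atBot 0)
    have h1 : IsClosed {s : ℂ | s.re ≤ 0} := isClosed_le Complex.continuous_re continuous_const
    have h2 : IsClosed (γ '' Icc T₀ T) := (isCompact_Icc.image hγ.continuous).isClosed
    have hpn : p ∉ {s : ℂ | s.re ≤ 0} ∪ γ '' Icc T₀ T := by
      rintro (h | ⟨τ, -, h⟩)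
      · have : p.re ≤ 0 := h
        linarith
      · have := hleft τ
        rw [h] at this
        linarith
    obtain ⟨_, ⟨hz1, hz2⟩, ⟨τ, rfl⟩⟩ := mem_closure_iff_nhds.1 hp _
      (inter_mem hU ((h1.union h2).isOpen_compl.mem_nhds hpn))
    refine ⟨τ, ?_, hz1⟩
    by_contra hτ
    rcases le_total τ T₀ with h | h
    · exact hz2 (Or.inl (hT₀ τ h))
    · exact hz2 (Or.inr ⟨τ, ⟨h, (not_le.1 hτ).le⟩, rfl⟩)
  have hfA := hX.analyticAt_rootQuotient hPp
  have hf0 : rootQuotient X S p ≠ 0 := div_ne_zero hXp hPp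
  obtain ⟨hlt, htend⟩ := hγ.tendsto_of_cluster hanti hfA.continuousAt hcl
  have hfp : 0 < ‖rootQuotient X S p‖ := norm_pos_iff.2 hf0
  have hphase : ∀ τ, rootQuotient X S (γ τ) =
      ((‖rootQuotient X S (γ τ)‖ / ‖rootQuotient X S p‖ : ℝ) : ℂ) * rootQuotient X S p := by
    intro τ
    have h1 : Tendsto (fun τ' => ((‖rootQuotient X S (γ τ)‖ / ‖rootQuotient X S (γ τ')‖ : ℝ) : ℂ) *
        rootQuotient X S (γ τ')) atTop
        (𝓝 (((‖rootQuotient X S (γ τ)‖ / ‖rootQuotient X S p‖ : ℝ) : ℂ) * rootQuotient X S p)) :=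
      ((Complex.continuous_ofReal.tendsto _).comp
        (tendsto_const_nhds.div htend.norm hfp.ne')).mul htend
    refine tendsto_nhds_unique (tendsto_const_nhds.congr fun τ' => ?_) h1
    exact hγ.eq_div_mul τ τ'
  have hloc := eventually_re_lt_of_logDeriv_re_pos hfA.differentiableAt hf0
    (hX.logDeriv_rootQuotient_re_pos hS hre hf0)
  obtain ⟨τ, hτ⟩ := (hcl.frequently hloc).exists
  have := (hτ _ (hphase τ)).2 ((one_lt_div hfp).2 (hlt τ))
  linarith [hleft τ]

/-- A descending line that has entered `Re s < 1/2` ends at a zero on the critical line, unless it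
ends at a regular point. -/
theorem exists_tendsto_zero (hX : IsXiLike X) (hinf : {s | X s = 0}.Infinite)
    (hSX : ∀ a ∈ S, X (a : ℂ) ≠ 0)
    (hγ : IsConstantPhaseLine (rootQuotient X S) γ)
    (hanti : StrictAnti fun τ => ‖rootQuotient X S (γ τ)‖)
    (hcomp : IsForwardComplete (rootQuotient X S) γ) {τ₀ : ℝ}
    (hleft : ∀ τ, τ₀ < τ → (γ τ).re < 1 / 2) :
    ∃ ρ : ℂ, IsZeroOf (rootQuotient X S) ρ ∧ ρ.re = 1 / 2 ∧ Tendsto γ atTop (𝓝 ρ) := by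
  have hbd : ∀ τ ≥ τ₀ + 1, ‖X (γ τ)‖ ≤ ‖rootQuotient X S (γ τ₀)‖ * ‖rootProd S (γ τ)‖ := by
    intro τ hτ
    rw [eq_rootQuotient_mul (hγ.ne_zero τ), norm_mul]
    gcongr
    exact hanti.antitone (by linarith)
  have hnt : ¬ Tendsto (fun τ => ‖γ τ‖) atTop atTop := by
    refine hX.not_tendsto_norm_atTop hinf S hγ.continuous (T := τ₀ + 1)
      (B := ‖rootQuotient X S (γ τ₀)‖)
      (e := rootQuotient X S (γ 0) / (‖rootQuotient X S (γ 0)‖ : ℂ))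
      (fun τ hτ => hleft τ (by linarith)) fun τ hτ => ⟨‖rootQuotient X S (γ τ)‖, hγ.norm_pos _,
        hanti.antitone (by linarith), ?_⟩
    rw [← hγ.eq_norm_mul]
    exact eq_rootQuotient_mul (hγ.ne_zero _)
  obtain ⟨q, hcl⟩ : ∃ q, MapClusterPt q atTop γ := by
    rw [tendsto_atTop] at hnt
    push Not at hnt
    obtain ⟨R, hR⟩ := hnt
    obtain ⟨q, -, hq⟩ := (isCompact_closedBall (0 : ℂ) R).exists_mapClusterPt_of_frequently
      (f := γ) (l := atTop) (hR.mono fun τ hτ => by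
        rw [mem_closedBall_zero_iff]; exact hτ.le)
    exact ⟨q, hq⟩
  -- a pole is excluded, since the modulus is bounded along the line
  have hPq : rootProd S q ≠ 0 := by
    intro h0
    have hclosed : IsClosed {z : ℂ | ‖X z‖ ≤ ‖rootQuotient X S (γ τ₀)‖ * ‖rootProd S z‖} :=
      isClosed_le hX.differentiable.continuous.norm
        (continuous_const.mul (differentiable_rootProd S).continuous.norm)
    have hmem : q ∈ {z : ℂ | ‖X z‖ ≤ ‖rootQuotient X S (γ τ₀)‖ * ‖rootProd S z‖} := by
      by_contra hn
      obtain ⟨τ, h1, h2⟩ := ((hcl.frequently (hclosed.isOpen_compl.mem_nhds hn)).and_eventually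
        (eventually_ge_atTop (τ₀ + 1))).exists
      exact h1 (hbd τ h2)
    rw [mem_ofPred_eq, h0, norm_zero, mul_zero, norm_le_zero_iff] at hmem
    obtain ⟨a, ha, rfl⟩ := rootProd_eq_zero_iff.1 h0
    exact hSX a ha hmem
  have hfA := hX.analyticAt_rootQuotient hPq
  obtain ⟨hlt, htend⟩ := hγ.tendsto_of_cluster hanti hfA.continuousAt hcl
  have hne : ∀ᶠ z in 𝓝[≠] q, rootQuotient X S z ≠ rootQuotient X S q := by
    rcases hfA.eventually_eq_or_eventually_ne analyticAt_const with h | h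
    · obtain ⟨τ, hτ⟩ := (hcl.frequently h).exists
      have := hlt τ
      rw [hτ] at this
      exact absurd this (lt_irrefl _)
    · exact h
  have hconv := tendsto_of_mapClusterPt hγ.continuous hfA hcl htend hne
  have hXq : X q = 0 := by
    by_contra h
    exact hcomp ⟨q, hfA, div_ne_zero h hPq, hconv⟩
  exact ⟨q, hX.isZeroOf_rootQuotient hPq hXq, hX.re_eq_half hXq, hconv⟩

end IsXiLike

/-! ### Theta series of the square lattice with harmonic coefficients -/

/-- The Gaussian integer `p₁ + i p₂`, as a complex number. -/
noncomputable def latticePoint (p : ℤ × ℤ) : ℂ := (p.1 : ℂ) + (p.2 : ℂ) * Complex.I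

/-- The norm `p₁² + p₂²` of a Gaussian integer. -/
def latticeNorm (p : ℤ × ℤ) : ℝ := (p.1 : ℝ) ^ 2 + (p.2 : ℝ) ^ 2

/-- The theta series `∑ (p₁ + i p₂)^n exp (-π (p₁² + p₂²) x)` over `ℤ²`. -/
noncomputable def latticeTheta (n : ℕ) (x : ℝ) : ℂ :=
  ∑' p : ℤ × ℤ, latticePoint p ^ n * Real.exp (-Real.pi * latticeNorm p * x)

@[simp] lemma latticePoint_zero : latticePoint 0 = 0 := by simp [latticePoint]

@[simp] lemma latticeNorm_zero : latticeNorm 0 = 0 := by simp [latticeNorm]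

lemma latticeNorm_nonneg (p : ℤ × ℤ) : 0 ≤ latticeNorm p := by unfold latticeNorm; positivity

lemma one_le_latticeNorm {p : ℤ × ℤ} (hp : p ≠ 0) : 1 ≤ latticeNorm p := by
  have h : 0 < p.1 ^ 2 + p.2 ^ 2 := by
    rcases not_and_or.1 (fun h => hp (Prod.ext h.1 h.2) : ¬ (p.1 = 0 ∧ p.2 = 0)) with h | h
    · positivity
    · positivity
  have h2 : (1 : ℤ) ≤ p.1 ^ 2 + p.2 ^ 2 := h
  unfold latticeNorm
  exact_mod_cast h2

lemma normSq_latticePoint (p : ℤ × ℤ) : Complex.normSq (latticePoint p) = latticeNorm p := by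
  simp [Complex.normSq_apply, latticePoint, latticeNorm]; ring

lemma norm_latticePoint_le (p : ℤ × ℤ) : ‖latticePoint p‖ ≤ |(p.1 : ℝ)| + |(p.2 : ℝ)| := by
  refine (Complex.norm_le_abs_re_add_abs_im _).trans_eq ?_
  simp [latticePoint]

/-- Gaussian decay beats exponential growth on the lattice. -/
lemma summable_exp_mul_exp (M : ℝ) (hM : 0 ≤ M) {x : ℝ} (hx : 0 < x) :
    Summable fun p : ℤ × ℤ =>
      Real.exp (M * ‖latticePoint p‖) * Real.exp (-Real.pi * latticeNorm p * x) := by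
  have h1 := summable_pow_mul_jacobiTheta₂_term_bound (M / (2 * Real.pi)) hx 0
  simp only [pow_zero, one_mul] at h1
  have h2 := h1.mul_of_nonneg h1 (fun _ => (Real.exp_pos _).le) (fun _ => (Real.exp_pos _).le)
  refine h2.of_nonneg_of_le (fun p => by positivity) fun p => ?_
  rw [← Real.exp_add, ← Real.exp_add, Real.exp_le_exp]
  have h3 := mul_le_mul_of_nonneg_left (norm_latticePoint_le p) hM
  have hpi := Real.pi_ne_zero
  have e : -Real.pi * (x * (p.1 : ℝ) ^ 2 - 2 * (M / (2 * Real.pi)) * ((|p.1| : ℤ) : ℝ)) +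
      -Real.pi * (x * (p.2 : ℝ) ^ 2 - 2 * (M / (2 * Real.pi)) * ((|p.2| : ℤ) : ℝ)) =
      M * (|(p.1 : ℝ)| + |(p.2 : ℝ)|) + -Real.pi * latticeNorm p * x := by
    unfold latticeNorm
    push_cast
    field_simp
    ring
  rw [e]
  linarith

lemma norm_theta_term (n : ℕ) (p : ℤ × ℤ) (x : ℝ) :
    ‖latticePoint p ^ n * (Real.exp (-Real.pi * latticeNorm p * x) : ℂ)‖ =
      ‖latticePoint p‖ ^ n * Real.exp (-Real.pi * latticeNorm p * x) := by
  rw [norm_mul, norm_pow, Complex.norm_real, Real.norm_eq_abs, Real.abs_exp]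

lemma summable_norm_pow_mul_exp (n : ℕ) {x : ℝ} (hx : 0 < x) :
    Summable fun p : ℤ × ℤ =>
      ‖latticePoint p‖ ^ n * Real.exp (-Real.pi * latticeNorm p * x) := by
  refine ((summable_exp_mul_exp 1 zero_le_one hx).mul_left (n.factorial : ℝ)).of_nonneg_of_le
    (fun p => by positivity) fun p => ?_
  rw [one_mul, ← mul_assoc]
  gcongr
  have := Real.pow_div_factorial_le_exp ‖latticePoint p‖ (norm_nonneg _) n
  rwa [div_le_iff₀' (by positivity)] at this

lemma hasSum_latticeTheta (n : ℕ) {x : ℝ} (hx : 0 < x) :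
    HasSum (fun p : ℤ × ℤ => latticePoint p ^ n * (Real.exp (-Real.pi * latticeNorm p * x) : ℂ))
      (latticeTheta n x) :=
  (Summable.of_norm (by simpa only [norm_theta_term] using summable_norm_pow_mul_exp n hx)).hasSum

lemma hasSum_mul_int {f g : ℤ → ℂ} {a b : ℂ} (hf : HasSum f a) (hg : HasSum g b) :
    HasSum (fun p : ℤ × ℤ => f p.1 * g p.2) (a * b) := by
  have h : Summable fun p : ℤ × ℤ => f p.1 * g p.2 :=
    summable_mul_of_summable_norm hf.summable.norm hg.summable.norm
  exact hf.mul hg h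

/-- The product `θ(w) θ(iw)` of two Jacobi theta functions, which generates the theta series with
harmonic coefficients. -/
lemma hasSum_theta_mul_theta (w : ℂ) {x : ℝ} (hx : 0 < x) :
    HasSum (fun p : ℤ × ℤ => Complex.exp (2 * Real.pi * Complex.I * w * latticePoint p) *
      (Real.exp (-Real.pi * latticeNorm p * x) : ℂ))
      (jacobiTheta₂ w (Complex.I * x) * jacobiTheta₂ (Complex.I * w) (Complex.I * x)) := by
  have hτ : 0 < (Complex.I * x).im := by simpa using hx
  have h3 := hasSum_mul_int (hasSum_jacobiTheta₂_term w hτ)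
    (hasSum_jacobiTheta₂_term (Complex.I * w) hτ)
  have e : (fun p : ℤ × ℤ => Complex.exp (2 * Real.pi * Complex.I * w * latticePoint p) *
      (Real.exp (-Real.pi * latticeNorm p * x) : ℂ)) = fun p =>
      jacobiTheta₂_term p.1 w (Complex.I * x) *
        jacobiTheta₂_term p.2 (Complex.I * w) (Complex.I * x) := by
    funext p
    rw [jacobiTheta₂_term, jacobiTheta₂_term, ← Complex.exp_add, Complex.ofReal_exp,
      ← Complex.exp_add]
    congr 1
    simp only [latticePoint, latticeNorm]
    push_cast
    have hI : Complex.I * Complex.I = -1 := Complex.I_mul_I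
    generalize (Real.pi : ℂ) = c
    linear_combination (-c * ((p.1 : ℂ) ^ 2 + (p.2 : ℂ) ^ 2) * x) * hI
  rw [e]
  exact h3

/-- The expansion of the generating function in powers of `w`. -/
lemma hasSum_theta_powerSeries (w : ℂ) {x : ℝ} (hx : 0 < x) :
    HasSum (fun n : ℕ => w ^ n * ((2 * Real.pi * Complex.I) ^ n / n.factorial * latticeTheta n x))
      (jacobiTheta₂ w (Complex.I * x) * jacobiTheta₂ (Complex.I * w) (Complex.I * x)) := by
  set c : ℂ := 2 * Real.pi * Complex.I * w with hc
  set F : (ℤ × ℤ) × ℕ → ℂ := fun a => (c * latticePoint a.1) ^ a.2 / a.2.factorial *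
    (Real.exp (-Real.pi * latticeNorm a.1 * x) : ℂ) with hF
  have hexp : ∀ p, HasSum (fun n => F (p, n)) (Complex.exp (c * latticePoint p) *
      (Real.exp (-Real.pi * latticeNorm p * x) : ℂ)) := fun p => by
    have := NormedSpace.expSeries_div_hasSum_exp (c * latticePoint p)
    rw [← Complex.exp_eq_exp_ℂ] at this
    exact this.mul_right _
  have hexpn : ∀ p, HasSum (fun n => ‖F (p, n)‖) (Real.exp (‖c‖ * ‖latticePoint p‖) *
      Real.exp (-Real.pi * latticeNorm p * x)) := fun p => by
    have := NormedSpace.expSeries_div_hasSum_exp (‖c‖ * ‖latticePoint p‖)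
    rw [← Real.exp_eq_exp_ℝ] at this
    refine (this.mul_right (Real.exp (-Real.pi * latticeNorm p * x))).congr_fun fun n => ?_
    rw [hF, norm_mul, norm_div, norm_pow, norm_mul, Complex.norm_real, Real.norm_eq_abs,
      Real.abs_exp, Complex.norm_natCast]
  have hsum : Summable F := by
    refine Summable.of_norm ((summable_prod_of_nonneg fun _ => norm_nonneg _).2
      ⟨fun p => (hexpn p).summable, ?_⟩)
    simp only [fun p => (hexpn p).tsum_eq]
    exact summable_exp_mul_exp ‖c‖ (norm_nonneg _) hx
  have htot : HasSum F (jacobiTheta₂ w (Complex.I * x) *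
      jacobiTheta₂ (Complex.I * w) (Complex.I * x)) := by
    have h1 := hsum.hasSum.prod_fiberwise hexp
    rw [(hasSum_theta_mul_theta w hx).unique h1]
    exact hsum.hasSum
  refine ((Equiv.prodComm ℕ (ℤ × ℤ)).hasSum_iff.2 htot).prod_fiberwise fun n => ?_
  have := (hasSum_latticeTheta n hx).mul_left (c ^ n / n.factorial)
  have e : w ^ n * ((2 * Real.pi * Complex.I) ^ n / n.factorial * latticeTheta n x) =
      c ^ n / n.factorial * latticeTheta n x := by rw [hc, mul_pow]; ring
  rw [e]
  refine this.congr_fun fun p => ?_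
  simp only [Function.comp_apply, Equiv.prodComm_apply, Prod.swap_prod_mk, hF, mul_pow]
  ring

/-- The inversion formula for the generating function. In the product the Gaussian factors of the
two Jacobi theta functions cancel, since `w² + (iw)² = 0`. -/
lemma theta_mul_theta_functional_equation (w : ℂ) {x : ℝ} (hx : 0 < x) :
    jacobiTheta₂ w (Complex.I * x) * jacobiTheta₂ (Complex.I * w) (Complex.I * x) =
      (x : ℂ)⁻¹ * (jacobiTheta₂ (w / (Complex.I * x)) (Complex.I * (x⁻¹ : ℝ)) *
        jacobiTheta₂ (Complex.I * (w / (Complex.I * x))) (Complex.I * (x⁻¹ : ℝ))) := by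
  have hx0 : (x : ℂ) ≠ 0 := by exact_mod_cast hx.ne'
  have hI := Complex.I_ne_zero
  rw [jacobiTheta₂_functional_equation w, jacobiTheta₂_functional_equation (Complex.I * w)]
  have e1 : -Complex.I * (Complex.I * x) = x := by
    linear_combination (-(x : ℂ)) * Complex.I_mul_I
  have e2 : (-1 : ℂ) / (Complex.I * x) = Complex.I * (x⁻¹ : ℝ) := by
    rw [div_eq_iff (mul_ne_zero hI hx0)]
    push_cast
    field_simp
    rw [Complex.I_sq]
  have e3 : Complex.I * w / (Complex.I * x) = Complex.I * (w / (Complex.I * x)) := by ring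
  have e4 : Complex.exp (-Real.pi * Complex.I * w ^ 2 / (Complex.I * x)) *
      Complex.exp (-Real.pi * Complex.I * (Complex.I * w) ^ 2 / (Complex.I * x)) = 1 := by
    rw [← Complex.exp_add, mul_pow, Complex.I_sq, ← add_div]
    simp
  have e5 : (1 / (x : ℂ) ^ (1 / 2 : ℂ)) * (1 / (x : ℂ) ^ (1 / 2 : ℂ)) = (x : ℂ)⁻¹ := by
    rw [div_mul_div_comm, ← Complex.cpow_add _ _ hx0]
    norm_num
  rw [e1, e2, e3, ← e5]
  linear_combination ((1 / (x : ℂ) ^ (1 / 2 : ℂ)) * (1 / (x : ℂ) ^ (1 / 2 : ℂ)) *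
    (jacobiTheta₂ (w / (Complex.I * x)) (Complex.I * (x⁻¹ : ℝ)) *
    jacobiTheta₂ (Complex.I * (w / (Complex.I * x))) (Complex.I * (x⁻¹ : ℝ)))) * e4

/-- Inversion formula for the theta series: compare coefficients in the generating function. -/
lemma latticeTheta_eq_inv (n : ℕ) {x : ℝ} (hx : 0 < x) :
    latticeTheta n x = (x : ℂ)⁻¹ * ((Complex.I * x)⁻¹ ^ n * latticeTheta n x⁻¹) := by
  set f : ℂ → ℂ := fun w =>
    jacobiTheta₂ w (Complex.I * x) * jacobiTheta₂ (Complex.I * w) (Complex.I * x) with hf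
  set a : ℕ → ℂ := fun n => (2 * Real.pi * Complex.I) ^ n / n.factorial * latticeTheta n x with ha
  set b : ℕ → ℂ := fun n => (x : ℂ)⁻¹ * ((Complex.I * x)⁻¹ ^ n *
    ((2 * Real.pi * Complex.I) ^ n / n.factorial * latticeTheta n x⁻¹)) with hb
  have h1 : HasFPowerSeriesAt f (FormalMultilinearSeries.ofScalars ℂ a) 0 := by
    rw [hasFPowerSeriesAt_iff]
    refine Eventually.of_forall fun w => ?_
    simp only [FormalMultilinearSeries.coeff_ofScalars, zero_add, smul_eq_mul]
    exact hasSum_theta_powerSeries w hx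
  have h2 : HasFPowerSeriesAt f (FormalMultilinearSeries.ofScalars ℂ b) 0 := by
    rw [hasFPowerSeriesAt_iff]
    refine Eventually.of_forall fun w => ?_
    simp only [FormalMultilinearSeries.coeff_ofScalars, zero_add, smul_eq_mul]
    have := (hasSum_theta_powerSeries (w / (Complex.I * x)) (inv_pos.2 hx)).mul_left (x : ℂ)⁻¹
    rw [← theta_mul_theta_functional_equation w hx] at this
    refine this.congr_fun fun n => ?_
    rw [hb, div_eq_mul_inv w, mul_pow]
    ring
  have h3 := congrArg (fun p => FormalMultilinearSeries.coeff p n)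
    (h1.eq_formalMultilinearSeries h2)
  simp only [FormalMultilinearSeries.coeff_ofScalars, ha, hb] at h3
  have hne : (2 * Real.pi * Complex.I) ^ n / (n.factorial : ℂ) ≠ 0 := by
    refine div_ne_zero (pow_ne_zero _ ?_) (by exact_mod_cast n.factorial_ne_zero)
    exact mul_ne_zero (mul_ne_zero two_ne_zero (by exact_mod_cast Real.pi_ne_zero)) Complex.I_ne_zero
  refine mul_left_cancel₀ hne ?_
  rw [h3]; ring

/-- For exponents divisible by `4` the theta series is a modular form of weight `1 + 4k`. -/
lemma latticeTheta_one_div (k : ℕ) {x : ℝ} (hx : 0 < x) :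
    latticeTheta (4 * k) (1 / x) = ((x ^ (1 + 4 * k : ℝ) : ℝ) : ℂ) * latticeTheta (4 * k) x := by
  have hx0 : (x : ℂ) ≠ 0 := by exact_mod_cast hx.ne'
  have h := latticeTheta_eq_inv (4 * k) hx
  have hI : (Complex.I * x)⁻¹ ^ (4 * k) = ((x : ℂ) ^ (4 * k))⁻¹ := by
    rw [mul_inv, mul_pow, pow_mul, Complex.inv_I, neg_pow, Complex.I_pow_four, inv_pow]
    norm_num
  have e : ((x ^ (1 + 4 * k : ℝ) : ℝ) : ℂ) = x * (x : ℂ) ^ (4 * k) := by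
    have : (1 + 4 * k : ℝ) = ((1 + 4 * k : ℕ) : ℝ) := by push_cast; ring
    rw [this, Real.rpow_natCast]
    push_cast
    ring
  rw [e, h, hI, one_div]
  field_simp

lemma continuousOn_latticeTheta (n : ℕ) : ContinuousOn (latticeTheta n) (Ioi 0) := by
  intro x hx
  have hx' : 0 < x := hx
  have h : ContinuousOn (latticeTheta n) (Ici (x / 2)) := by
    refine continuousOn_tsum (u := fun p => ‖latticePoint p‖ ^ n *
      Real.exp (-Real.pi * latticeNorm p * (x / 2))) (fun p => by fun_prop)
      (summable_norm_pow_mul_exp n (by positivity)) fun p y hy => ?_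
    rw [norm_theta_term]
    have h1 := mul_nonneg Real.pi_pos.le (latticeNorm_nonneg p)
    have h2 : x / 2 ≤ y := hy
    gcongr ?_ * Real.exp ?_
    nlinarith
  exact (h.continuousAt (Ici_mem_nhds (by linarith))).continuousWithinAt

/-- The constant term of the theta series, as a sum over the nonzero lattice vectors. -/
lemma hasSum_latticeTheta_sub (n : ℕ) {x : ℝ} (hx : 0 < x) :
    HasSum (fun p : {p : ℤ × ℤ // p ≠ 0} =>
      latticePoint p ^ n * (Real.exp (-Real.pi * latticeNorm p * x) : ℂ))
      (latticeTheta n x - 0 ^ n) := by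
  have h := hasSum_ite_sub_hasSum (hasSum_latticeTheta n hx) (0 : ℤ × ℤ)
  simp only [latticePoint_zero, latticeNorm_zero, mul_zero, zero_mul, Real.exp_zero,
    Complex.ofReal_one, mul_one] at h
  have h2 : HasSum ({p : ℤ × ℤ | p ≠ 0}.indicator fun p =>
      latticePoint p ^ n * (Real.exp (-Real.pi * latticeNorm p * x) : ℂ))
      (latticeTheta n x - 0 ^ n) := by
    refine h.congr_fun fun p => ?_
    by_cases hp : p = 0
    · simp [hp]
    · rw [indicator_of_mem (by exact hp), if_neg hp]
  exact hasSum_subtype_iff_indicator.2 h2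

lemma latticeTheta_sub_isBigO (n : ℕ) (r : ℝ) :
    (fun x => latticeTheta n x - 0 ^ n) =O[atTop] fun x : ℝ => x ^ r := by
  refine Asymptotics.IsBigO.trans ?_ (isLittleO_exp_neg_mul_rpow_atTop Real.pi_pos r).isBigO
  have hs : Summable fun p : {p : ℤ × ℤ // p ≠ 0} =>
      ‖latticePoint p‖ ^ n * Real.exp (-Real.pi * latticeNorm p * 1) :=
    (summable_norm_pow_mul_exp n one_pos).subtype {p : ℤ × ℤ | p ≠ 0}
  refine Asymptotics.IsBigO.of_bound (Real.exp Real.pi * ∑' p : {p : ℤ × ℤ // p ≠ 0},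
    ‖latticePoint p‖ ^ n * Real.exp (-Real.pi * latticeNorm p * 1)) ?_
  filter_upwards [eventually_ge_atTop 1] with x hx
  have hx0 : 0 < x := by linarith
  rw [← (hasSum_latticeTheta_sub n hx0).tsum_eq, Real.norm_eq_abs, Real.abs_exp, mul_right_comm,
    ← Real.exp_add, ← tsum_mul_left]
  refine tsum_of_norm_bounded (hs.mul_left _).hasSum fun p => ?_
  rw [norm_theta_term, mul_left_comm, ← Real.exp_add]
  gcongr
  have h1 := one_le_latticeNorm p.2
  have h2 := Real.pi_pos
  have h3 : 0 ≤ Real.pi * ((latticeNorm p - 1) * (x - 1)) :=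
    mul_nonneg h2.le (mul_nonneg (by linarith) (by linarith))
  nlinarith

/-! ### Functional equation of the angular lattice sums -/

/-- The theta series with coefficients `(p₁ + i p₂)^(4k)`, as input for the Mellin transform. -/
noncomputable def latticeFEPair (k : ℕ) : WeakFEPair ℂ where
  f := latticeTheta (4 * k)
  g := latticeTheta (4 * k)
  k := 1 + 4 * k
  ε := 1
  f₀ := 0 ^ (4 * k)
  g₀ := 0 ^ (4 * k)
  hf_int := (continuousOn_latticeTheta _).locallyIntegrableOn measurableSet_Ioi
  hg_int := (continuousOn_latticeTheta _).locallyIntegrableOn measurableSet_Ioi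
  hk := by positivity
  hε := one_ne_zero
  h_feq x hx := by rw [one_mul, smul_eq_mul]; exact latticeTheta_one_div k hx
  hf_top := latticeTheta_sub_isBigO (4 * k)
  hg_top := latticeTheta_sub_isBigO (4 * k)

/-- The entire part of the completed lattice sum
`π^{-(s+2k)} Γ(s+2k) ∑ cos (4kθ_p) |p|^{-2s}`. Only for `k = 0` does it differ from it. -/
noncomputable def completedLattice (k : ℕ) (s : ℂ) : ℂ :=
  (latticeFEPair k).Λ₀ (s + 2 * k)

lemma differentiable_completedLattice (k : ℕ) : Differentiable ℂ (completedLattice k) :=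
  (latticeFEPair k).differentiable_Λ₀.comp (by fun_prop)

lemma completedLattice_one_sub (k : ℕ) (s : ℂ) :
    completedLattice k (1 - s) = completedLattice k s := by
  have hsymm : (latticeFEPair k).symm = latticeFEPair k := by
    unfold latticeFEPair WeakFEPair.symm
    congr 1
    exact inv_one
  have h := (latticeFEPair k).functional_equation₀ (s + 2 * k)
  have e : (((latticeFEPair k).k : ℝ) : ℂ) - (s + 2 * k) = 1 - s + 2 * k := by
    simp only [latticeFEPair]
    push_cast
    ring
  rw [hsymm, e] at h
  simpa [completedLattice, latticeFEPair] using h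

/-- A Mellin transform is bounded on vertical strips inside its domain of convergence. -/
lemma norm_mellin_le_of_re_mem {f : ℝ → ℂ} {a b : ℝ} (ha : MellinConvergent f a)
    (hb : MellinConvergent f b) : ∃ C : ℝ, ∀ s : ℂ, a ≤ s.re → s.re ≤ b → ‖mellin f s‖ ≤ C := by
  refine ⟨∫ x in Ioi (0 : ℝ), (‖(x : ℂ) ^ ((a : ℂ) - 1) • f x‖ + ‖(x : ℂ) ^ ((b : ℂ) - 1) • f x‖),
    fun s h1 h2 => ?_⟩
  refine MeasureTheory.norm_integral_le_of_norm_le (ha.norm.add hb.norm) ?_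
  filter_upwards [MeasureTheory.ae_restrict_mem measurableSet_Ioi] with x hx
  have hx' : 0 < x := hx
  rw [norm_smul, norm_smul, norm_smul, Complex.norm_cpow_eq_rpow_re_of_pos hx',
    Complex.norm_cpow_eq_rpow_re_of_pos hx', Complex.norm_cpow_eq_rpow_re_of_pos hx', ← add_mul]
  gcongr
  simp only [Complex.sub_re, Complex.ofReal_re, Complex.one_re]
  rcases le_total x 1 with h | h
  · have := Real.rpow_le_rpow_of_exponent_ge hx' h (by linarith : a - 1 ≤ s.re - 1)
    have h3 : 0 ≤ x ^ (b - 1) := by positivity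
    linarith
  · have := Real.rpow_le_rpow_of_exponent_le h (by linarith : s.re - 1 ≤ b - 1)
    have h3 : 0 ≤ x ^ (a - 1) := by positivity
    linarith

lemma exists_norm_completedLattice_le (k : ℕ) (a b : ℝ) :
    ∃ C : ℝ, ∀ s : ℂ, a ≤ s.re → s.re ≤ b → ‖completedLattice k s‖ ≤ C := by
  have hconv : ∀ s, MellinConvergent (latticeFEPair k).f_modif s := fun s =>
    ((latticeFEPair k).isStrongFEPair_toStrongFEPair.hasMellin s).1
  obtain ⟨C, hC⟩ := norm_mellin_le_of_re_mem (hconv ((a + 2 * k : ℝ) : ℂ))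
    (hconv ((b + 2 * k : ℝ) : ℂ))
  refine ⟨C, fun s h1 h2 => hC (s + 2 * k) ?_ ?_⟩
  · simp; linarith
  · simp; linarith

lemma summable_latticeNorm_rpow {σ : ℝ} (hσ : 1 < σ) :
    Summable fun p : {p : ℤ × ℤ // p ≠ 0} => latticeNorm p ^ (-σ) := by
  have h1 := EisensteinSeries.summable_one_div_norm_rpow (k := 2 * σ) (by linarith)
  rw [← (finTwoArrowEquiv ℤ).symm.summable_iff] at h1
  refine (h1.subtype {p : ℤ × ℤ | p ≠ 0}).of_nonneg_of_le
    (fun p => Real.rpow_nonneg (latticeNorm_nonneg p) _) fun p => ?_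
  simp only [Function.comp_apply]
  set v : Fin 2 → ℤ := (finTwoArrowEquiv ℤ).symm p with hv
  have hv0 : v 0 = (p : ℤ × ℤ).1 := by simp [hv]
  have hv1 : v 1 = (p : ℤ × ℤ).2 := by simp [hv]
  have hvne : v ≠ 0 := by
    intro h
    exact p.2 (Prod.ext (by rw [← hv0, h]; rfl) (by rw [← hv1, h]; rfl))
  have hpos : 0 < ‖v‖ := norm_pos_iff.2 hvne
  have hle : ‖v‖ ^ 2 ≤ latticeNorm p := by
    have h3 : ‖v‖ ≤ Real.sqrt (latticeNorm p) := by
      rw [pi_norm_le_iff_of_nonneg (Real.sqrt_nonneg _)]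
      intro i
      refine Real.le_sqrt_of_sq_le ?_
      unfold latticeNorm
      fin_cases i
      · simp only [Fin.zero_eta, hv0, Int.norm_eq_abs, sq_abs]
        nlinarith [sq_nonneg (((p : ℤ × ℤ).2 : ℤ) : ℝ)]
      · simp only [Fin.mk_one, hv1, Int.norm_eq_abs, sq_abs]
        nlinarith [sq_nonneg (((p : ℤ × ℤ).1 : ℤ) : ℝ)]
    calc ‖v‖ ^ 2 ≤ Real.sqrt (latticeNorm p) ^ 2 := by gcongr
      _ = _ := Real.sq_sqrt (latticeNorm_nonneg _)
  calc latticeNorm p ^ (-σ) ≤ (‖v‖ ^ 2) ^ (-σ) :=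
        Real.rpow_le_rpow_of_nonpos (by positivity) hle (by linarith)
    _ = ‖v‖ ^ (-(2 * σ)) := by
        rw [← Real.rpow_natCast, ← Real.rpow_mul hpos.le]
        congr 1
        push_cast
        ring

/-- `Re (z^n) = |z|^n cos (n arg z)`. -/
lemma re_pow_eq (z : ℂ) (n : ℕ) : (z ^ n).re = ‖z‖ ^ n * Real.cos (n * z.arg) := by
  conv_lhs => rw [← Complex.norm_mul_exp_arg_mul_I z, mul_pow, ← Complex.exp_nat_mul,
    ← Complex.ofReal_pow, Complex.re_ofReal_mul]
  congr 1
  have : (n : ℂ) * (z.arg * Complex.I) = ((n * z.arg : ℝ) : ℂ) * Complex.I := by push_cast; ring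
  rw [this, Complex.exp_ofReal_mul_I_re]

lemma hasSum_re_latticeTheta_sub (n : ℕ) {x : ℝ} (hx : 0 < x) :
    HasSum (fun p : {p : ℤ × ℤ // p ≠ 0} =>
      ((latticePoint p ^ n).re : ℂ) * (Real.exp (-Real.pi * latticeNorm p * x) : ℂ))
      (latticeTheta n x - 0 ^ n) := by
  have h1 := hasSum_latticeTheta_sub n hx
  -- the reflection `p₂ ↦ -p₂` conjugates the coefficients
  set e : {p : ℤ × ℤ // p ≠ 0} ≃ {p : ℤ × ℤ // p ≠ 0} :=
    ((Equiv.refl ℤ).prodCongr (Equiv.neg ℤ)).subtypeEquiv (fun p => by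
      simp [Prod.ext_iff]) with he
  have h2 := e.hasSum_iff.2 h1
  have h3 := (h1.add h2).div_const 2
  rw [add_self_div_two] at h3
  refine h3.congr_fun fun p => ?_
  have e1 : latticePoint (e p) = starRingEnd ℂ (latticePoint p) := by
    simp [he, latticePoint]
  have e2 : latticeNorm (e p) = latticeNorm p := by
    simp [he, latticeNorm]
  simp only [Function.comp_apply]
  rw [e1, e2, ← map_pow, Complex.re_eq_add_conj]
  ring

lemma cosLatticeSeries_term (k : ℕ) (p : ℤ × ℤ) (s : ℂ) :
    ((Real.cos (((4 * k : ℕ) : ℝ) * Complex.arg ((p.1 : ℂ) + (p.2 : ℂ) * Complex.I)) ^ 1 : ℝ) : ℂ) /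
      ((((p.1 : ℝ) ^ 2 + (p.2 : ℝ) ^ 2 : ℝ) : ℂ) ^ s) =
    (Real.cos (((4 * k : ℕ) : ℝ) * (latticePoint p).arg) : ℂ) / (latticeNorm p : ℂ) ^ s := by
  rw [pow_one]; rfl

lemma norm_cosLattice_term_le (k : ℕ) (p : {p : ℤ × ℤ // p ≠ 0}) (s : ℂ) :
    ‖(Real.cos (((4 * k : ℕ) : ℝ) * (latticePoint p).arg) : ℂ) / (latticeNorm p : ℂ) ^ s‖ ≤
      latticeNorm p ^ (-s.re) := by
  have hpos : 0 < latticeNorm p := by linarith [one_le_latticeNorm p.2]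
  rw [norm_div, Complex.norm_real, Complex.norm_cpow_eq_rpow_re_of_pos hpos, Real.rpow_neg hpos.le,
    div_eq_mul_inv]
  exact mul_le_of_le_one_left (by positivity) (Real.abs_cos_le_one _)

lemma hasSum_cosLatticeSeries (k : ℕ) {s : ℂ} (hs : 1 < s.re) :
    HasSum (fun p : {p : ℤ × ℤ // p ≠ 0} =>
      (Real.cos (((4 * k : ℕ) : ℝ) * (latticePoint p).arg) : ℂ) / (latticeNorm p : ℂ) ^ s)
      (cosLatticeSeries 1 (4 * k) s) := by
  have h : Summable fun p : {p : ℤ × ℤ // p ≠ 0} =>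
      (Real.cos (((4 * k : ℕ) : ℝ) * (latticePoint p).arg) : ℂ) / (latticeNorm p : ℂ) ^ s :=
    Summable.of_norm_bounded (summable_latticeNorm_rpow hs) fun p => norm_cosLattice_term_le k p s
  have e : cosLatticeSeries 1 (4 * k) s = ∑' p : {p : ℤ × ℤ // p ≠ 0},
      (Real.cos (((4 * k : ℕ) : ℝ) * (latticePoint p).arg) : ℂ) / (latticeNorm p : ℂ) ^ s :=
    tsum_congr fun p => cosLatticeSeries_term k p s
  rw [e]
  exact h.hasSum

lemma mellin_latticeTheta (k : ℕ) {s : ℂ} (hs : 1 < s.re) :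
    mellin (fun x => latticeTheta (4 * k) x - 0 ^ (4 * k)) (s + 2 * k) =
      (Real.pi : ℂ) ^ (-(s + 2 * k)) * Complex.Gamma (s + 2 * k) * cosLatticeSeries 1 (4 * k) s := by
  have hre : (s + 2 * (k : ℂ)).re = s.re + 2 * k := by simp
  have hterm : ∀ p : {p : ℤ × ℤ // p ≠ 0}, ((latticePoint p ^ (4 * k)).re : ℂ) /
      (latticeNorm p : ℂ) ^ (s + 2 * k) =
      (Real.cos (((4 * k : ℕ) : ℝ) * (latticePoint p).arg) : ℂ) / (latticeNorm p : ℂ) ^ s := by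
    intro p
    have hpos : 0 < latticeNorm p := by linarith [one_le_latticeNorm p.2]
    have hne : (latticeNorm p : ℂ) ≠ 0 := by exact_mod_cast hpos.ne'
    have h1 : ‖latticePoint p‖ ^ (4 * k) = latticeNorm p ^ (2 * k) := by
      rw [show 4 * k = 2 * (2 * k) by ring, pow_mul, ← Complex.normSq_eq_norm_sq,
        normSq_latticePoint]
    have h2 : (latticeNorm p : ℂ) ^ (s + 2 * k) = (latticeNorm p : ℂ) ^ s *
        (latticeNorm p : ℂ) ^ (2 * k) := by
      rw [Complex.cpow_add _ _ hne]
      congr 1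
      rw [← Complex.cpow_natCast]
      push_cast
      rfl
    have h3 : (latticeNorm p : ℂ) ^ (2 * k) ≠ 0 := pow_ne_zero _ hne
    have h4 : (latticeNorm p : ℂ) ^ s ≠ 0 := by
      rw [Ne, Complex.cpow_eq_zero_iff]; exact fun h => hne h.1
    rw [re_pow_eq, h1, h2]
    push_cast
    field_simp
  have h := hasSum_mellin_pi_mul (ι := {p : ℤ × ℤ // p ≠ 0})
    (a := fun p => ((latticePoint p ^ (4 * k)).re : ℂ)) (q := fun p => latticeNorm p)
    (F := fun x => latticeTheta (4 * k) x - 0 ^ (4 * k)) (s := s + 2 * k)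
    (fun p => Or.inr (by linarith [one_le_latticeNorm p.2])) (by rw [hre]; positivity)
    (fun t ht => hasSum_re_latticeTheta_sub (4 * k) ht) (by
      refine (summable_latticeNorm_rpow hs).of_nonneg_of_le
        (fun p => div_nonneg (norm_nonneg _) (Real.rpow_nonneg (latticeNorm_nonneg p) _))
        fun p => ?_
      have hpos : 0 < latticeNorm p := by linarith [one_le_latticeNorm p.2]
      have h1 := norm_cosLattice_term_le k p s
      rw [← hterm, norm_div, Complex.norm_cpow_eq_rpow_re_of_pos hpos] at h1
      exact h1)
  have h2 := (hasSum_cosLatticeSeries k hs).mul_left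
    ((Real.pi : ℂ) ^ (-(s + 2 * k)) * Complex.Gamma (s + 2 * k))
  refine h.unique (h2.congr_fun fun p => ?_)
  rw [← hterm p]
  ring

lemma completedLattice_eq_of_pos {k : ℕ} (hk : k ≠ 0) {s : ℂ} (hs : 1 < s.re) :
    completedLattice k s =
      (Real.pi : ℂ) ^ (-(s + 2 * k)) * Complex.Gamma (s + 2 * k) * cosLatticeSeries 1 (4 * k) s := by
  have h0 : (0 : ℂ) ^ (4 * k) = 0 := zero_pow (by omega)
  have hst : IsStrongFEPair (latticeFEPair k) := ⟨h0, h0⟩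
  have h1 : (latticeFEPair k).Λ₀ (s + 2 * k) = (latticeFEPair k).Λ (s + 2 * k) := by
    rw [WeakFEPair.Λ₀_eq, hst.hf₀, hst.hg₀]; simp
  rw [completedLattice, h1, hst.Λ_eq, ← mellin_latticeTheta k hs]
  simp only [h0, sub_zero]
  rfl

lemma completedLattice_zero_eq {s : ℂ} (hs : 1 < s.re) :
    completedLattice 0 s - 1 / s - 1 / (1 - s) =
      (Real.pi : ℂ) ^ (-s) * Complex.Gamma s * cosLatticeSeries 1 0 s := by
  have h := mellin_latticeTheta 0 hs
  have h1 := ((latticeFEPair 0).hasMellin (s := s) (by simpa [latticeFEPair] using hs)).2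
  have h2 : mellin (fun x => latticeTheta (4 * 0) x - 0 ^ (4 * 0)) (s + 2 * (0 : ℕ)) =
      (latticeFEPair 0).Λ s := by
    rw [← h1]; simp [latticeFEPair]
  rw [h2, WeakFEPair.Λ] at h
  simpa [completedLattice, latticeFEPair] using h

/-! ### Estimates for the Gamma function -/

lemma norm_Gamma_le {s : ℂ} (hs : 0 < s.re) : ‖Complex.Gamma s‖ ≤ Real.Gamma s.re := by
  rw [Complex.Gamma_eq_integral hs, Real.Gamma_eq_integral hs, Complex.GammaIntegral]
  refine MeasureTheory.norm_integral_le_of_norm_le (Real.GammaIntegral_convergent hs) ?_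
  filter_upwards [MeasureTheory.ae_restrict_mem measurableSet_Ioi] with x hx
  rw [norm_mul, Complex.norm_real, Real.norm_eq_abs, Real.abs_exp,
    Complex.norm_cpow_eq_rpow_re_of_pos hx, Complex.sub_re, Complex.one_re]

lemma norm_Gamma_le_add_nat {z : ℂ} (hz : 1 ≤ |z.im|) (n : ℕ) :
    ‖Complex.Gamma z‖ ≤ ‖Complex.Gamma (z + n)‖ := by
  induction n with
  | zero => simp
  | succ n ih =>
    have h1 : 1 ≤ ‖z + n‖ := by
      refine le_trans ?_ (Complex.abs_im_le_norm _)
      simpa using hz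
    have h0 : z + n ≠ 0 := norm_pos_iff.1 (by linarith)
    have h2 := Complex.Gamma_add_one (z + n) h0
    push_cast
    rw [← add_assoc, h2, norm_mul]
    nlinarith [norm_nonneg (Complex.Gamma (z + n))]

lemma norm_sin_le (z : ℂ) : ‖Complex.sin z‖ ≤ Real.exp |z.im| := by
  have h1 : ‖Complex.exp (-z * Complex.I)‖ ≤ Real.exp |z.im| := by
    rw [Complex.norm_exp, Real.exp_le_exp]
    simpa using le_abs_self z.im
  have h2 : ‖Complex.exp (z * Complex.I)‖ ≤ Real.exp |z.im| := by
    rw [Complex.norm_exp, Real.exp_le_exp]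
    simpa using neg_le_abs z.im
  rw [Complex.sin, norm_div, norm_mul, Complex.norm_I, mul_one]
  have h3 := norm_sub_le (Complex.exp (-z * Complex.I)) (Complex.exp (z * Complex.I))
  rw [Complex.norm_ofNat, div_le_iff₀ two_pos]
  linarith

/-- The decay of `Γ` on vertical lines is at most exponential: reflection formula. -/
lemma exists_le_norm_Gamma (a : ℝ) : ∃ c > 0, ∀ s : ℂ, s.re = a → 1 ≤ |s.im| →
    c * Real.exp (-(Real.pi * |s.im|)) ≤ ‖Complex.Gamma s‖ := by
  obtain ⟨n, hn⟩ := exists_nat_gt (a - 1)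
  have hM : 0 < Real.Gamma (1 - a + n) := Real.Gamma_pos_of_pos (by linarith)
  refine ⟨Real.pi / Real.Gamma (1 - a + n), by positivity, fun s hs ht => ?_⟩
  have h1 := norm_Gamma_le_add_nat (z := 1 - s) (by simpa using ht) n
  have hre : (1 - s + n).re = 1 - a + n := by simp [hs]
  have h2 := norm_Gamma_le (s := 1 - s + n) (by rw [hre]; linarith)
  rw [hre] at h2
  have h3 := norm_sin_le (Real.pi * s)
  rw [Complex.im_ofReal_mul, abs_mul, abs_of_pos Real.pi_pos] at h3
  have h4 := congrArg norm (Complex.Gamma_mul_Gamma_one_sub s)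
  rw [norm_mul, norm_div, Complex.norm_real, Real.norm_eq_abs, abs_of_pos Real.pi_pos] at h4
  have hsin : Complex.sin (Real.pi * s) ≠ 0 := by
    intro h
    rw [Complex.sin_eq_zero_iff] at h
    obtain ⟨k, hk⟩ := h
    have hpi : (Real.pi : ℂ) ≠ 0 := by exact_mod_cast Real.pi_ne_zero
    have : s = k := mul_left_cancel₀ hpi (hk.trans (mul_comm _ _))
    rw [this, Complex.intCast_im, abs_zero] at ht
    linarith
  have hsin' := norm_pos_iff.2 hsin
  rw [eq_div_iff hsin'.ne'] at h4
  rw [Real.exp_neg, div_mul_eq_mul_div, div_le_iff₀ hM, ← div_eq_mul_inv,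
    div_le_iff₀ (Real.exp_pos _)]
  refine h4.symm.trans_le ?_
  gcongr
  exact h1.trans h2

/-- `|Γ(σ+it)| / Γ(σ)` is nondecreasing in `σ > 0`: this holds for each factor of Euler's product. -/
lemma norm_Gamma_mul_le {x y t : ℝ} (hx : 0 < x) (hxy : x ≤ y) :
    ‖Complex.Gamma (x + t * Complex.I)‖ * Real.Gamma y ≤
      ‖Complex.Gamma (y + t * Complex.I)‖ * Real.Gamma x := by
  have hy : 0 < y := by linarith
  refine le_of_tendsto_of_tendsto
    ((Complex.GammaSeq_tendsto_Gamma _).norm.mul (Real.GammaSeq_tendsto_Gamma y))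
    ((Complex.GammaSeq_tendsto_Gamma _).norm.mul (Real.GammaSeq_tendsto_Gamma x)) ?_
  filter_upwards [eventually_gt_atTop 0] with n hn
  have hn' : (0 : ℝ) < n := by exact_mod_cast hn
  have key : ∀ {x : ℝ}, 0 < x → ‖Complex.GammaSeq (x + t * Complex.I) n‖ = (n : ℝ) ^ x *
      n.factorial / ∏ j ∈ Finset.range (n + 1), ‖(x : ℂ) + t * Complex.I + j‖ := by
    intro x hx
    rw [Complex.GammaSeq, norm_div, norm_mul, norm_prod, Complex.norm_natCast,
      Complex.norm_natCast_cpow_of_pos hn]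
    simp
  have hpos : ∀ {x : ℝ}, 0 < x → ∀ j : ℕ, 0 < ‖(x : ℂ) + t * Complex.I + j‖ := by
    intro x hx j
    refine norm_pos_iff.2 fun h => ?_
    have := congrArg Complex.re h
    simp at this
    have hj : (0 : ℝ) ≤ j := j.cast_nonneg
    linarith
  rw [key hx, key hy, Real.GammaSeq, Real.GammaSeq, div_mul_div_comm, div_mul_div_comm,
    ← Finset.prod_mul_distrib, ← Finset.prod_mul_distrib, mul_comm ((n : ℝ) ^ x * _)]
  refine div_le_div_of_nonneg_left (by positivity) (Finset.prod_pos fun j _ => ?_)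
    (Finset.prod_le_prod (fun j _ => ?_) fun j _ => ?_)
  · have := hpos hy j; positivity
  · have := hpos hy j; positivity
  · have e : ∀ z : ℝ, ‖(z : ℂ) + t * Complex.I + j‖ = Real.sqrt ((z + j) ^ 2 + t ^ 2) := by
      intro z
      have : (z : ℂ) + t * Complex.I + j = ((z + j : ℝ) : ℂ) + t * Complex.I := by push_cast; ring
      rw [this, Complex.norm_add_mul_I]
    have hj : (0 : ℝ) ≤ j := j.cast_nonneg
    have hxj : 0 < x + j := by positivity
    have hyj : 0 < y + j := by positivity
    rw [e, e, ← Real.sqrt_sq hxj.le, ← Real.sqrt_sq hyj.le, ← Real.sqrt_mul (by positivity),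
      ← Real.sqrt_mul (by positivity)]
    refine Real.sqrt_le_sqrt ?_
    rw [Real.sqrt_sq hxj.le, Real.sqrt_sq hyj.le]
    have h1 : (x + j) ^ 2 ≤ (y + j) ^ 2 := by gcongr
    nlinarith [mul_le_mul_of_nonneg_left h1 (sq_nonneg t)]

/-- The derivative of `log |f|` in the direction of the real axis is `Re (f' / f)`. -/
lemma hasDerivAt_log_norm {f : ℂ → ℂ} {s : ℂ} (hf : DifferentiableAt ℂ f s) (h0 : f s ≠ 0) :
    HasDerivAt (fun h : ℝ => Real.log ‖f (s + h)‖) (logDeriv f s).re 0 := by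
  have h1 : HasDerivAt (fun z : ℂ => f (s + z)) (deriv f s) ((0 : ℝ) : ℂ) := by
    have := hf.hasDerivAt
    rw [← add_zero s] at this
    simpa using this.comp_const_add s 0
  have h2 : HasDerivAt (fun z : ℂ => Complex.log (f (s + z) / f s)) (deriv f s / f s)
      ((0 : ℝ) : ℂ) := by
    have := (h1.div_const (f s)).clog (by simp [h0])
    simpa [h0] using this
  have h3 := h2.real_of_complex.add_const (Real.log ‖f s‖)
  refine h3.congr_of_eventuallyEq ?_
  have hc : Tendsto (fun h : ℝ => f (s + h)) (𝓝 0) (𝓝 (f s)) := by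
    have := (h1.continuousAt.tendsto).comp (Complex.continuous_ofReal.tendsto 0)
    simpa [Function.comp_def] using this
  filter_upwards [hc.eventually_ne h0] with h hh
  rw [Complex.log_re, norm_div, Real.log_div (norm_ne_zero_iff.2 hh) (norm_ne_zero_iff.2 h0)]
  ring

/-- `Re (Γ' / Γ)` tends to infinity with `Re s`, uniformly in `Im s`. -/
lemma log_le_re_logDeriv_Gamma {s : ℂ} (hs : 1 < s.re) :
    Real.log (s.re - 1) ≤ (logDeriv Complex.Gamma s).re := by
  have hne : ∀ m : ℕ, s ≠ -m := fun m h => by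
    have := congrArg Complex.re h
    simp at this
    have hm : (0 : ℝ) ≤ m := m.cast_nonneg
    linarith
  have hG := hasDerivAt_log_norm (Complex.differentiableAt_Gamma s hne) (Complex.Gamma_ne_zero hne)
  have hslope := hG.tendsto_slope_zero_right
  refine ge_of_tendsto hslope ?_
  filter_upwards [self_mem_nhdsWithin] with h hh
  have hh' : (0 : ℝ) < h := hh
  have hconv := Real.convexOn_log_Gamma.slope_mono_adjacent (x := s.re - 1) (y := s.re)
    (z := s.re + h) (by simpa using hs) (by simp only [mem_Ioi]; linarith) (by linarith)
    (by linarith)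
  have hσ : 0 < s.re := by linarith
  have hσ1 : 0 < s.re - 1 := by linarith
  have e1 : Real.Gamma s.re = (s.re - 1) * Real.Gamma (s.re - 1) := by
    rw [← Real.Gamma_add_one hσ1.ne']; ring_nf
  have hg1 := Real.Gamma_pos_of_pos hσ1
  have hg2 := Real.Gamma_pos_of_pos hσ
  have hg3 := Real.Gamma_pos_of_pos (by linarith : 0 < s.re + h)
  have e2 : Real.log (Real.Gamma s.re) - Real.log (Real.Gamma (s.re - 1)) =
      Real.log (s.re - 1) := by
    rw [e1, Real.log_mul hσ1.ne' hg1.ne']; ring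
  simp only [Function.comp_apply, sub_sub_cancel, div_one, add_sub_cancel_left, e2] at hconv
  have hmul := norm_Gamma_mul_le (t := s.im) hσ (by linarith : s.re ≤ s.re + h)
  have e3 : ((s.re + h : ℝ) : ℂ) + s.im * Complex.I = s + h := by
    conv_rhs => rw [← Complex.re_add_im s]
    push_cast; ring
  rw [Complex.re_add_im, e3] at hmul
  have hn1 : 0 < ‖Complex.Gamma s‖ := norm_pos_iff.2 (Complex.Gamma_ne_zero hne)
  have hn2 : 0 < ‖Complex.Gamma (s + h)‖ := by
    refine norm_pos_iff.2 (Complex.Gamma_ne_zero_of_re_pos ?_)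
    simp; linarith
  have hlog := Real.log_le_log (by positivity) hmul
  rw [Real.log_mul hn1.ne' hg3.ne', Real.log_mul hn2.ne' hg2.ne'] at hlog
  refine hconv.trans ?_
  simp only [zero_add, Complex.ofReal_zero, add_zero, smul_eq_mul]
  rw [div_le_iff₀ hh', mul_comm h⁻¹, mul_assoc, inv_mul_cancel₀ hh'.ne']
  linarith

lemma Gamma_le_exp {x : ℝ} (hx : 2 ≤ x) : Real.Gamma x ≤ Real.exp (8 * x ^ (3 / 2 : ℝ)) := by
  set n := ⌈x⌉₊ with hn
  have h1 : x ≤ n := Nat.le_ceil x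
  have h2 : (n : ℝ) ≤ 2 * x := by
    have := Nat.ceil_lt_add_one (by linarith : 0 ≤ x)
    linarith
  have hn0 : (0 : ℝ) < n := by linarith
  have h3 : Real.Gamma x ≤ n.factorial := by
    rw [← Real.Gamma_nat_eq_factorial]
    exact Real.Gamma_strictMonoOn_Ici.monotoneOn hx (by simp only [mem_Ici]; linarith) (by linarith)
  have h4 : ((n.factorial : ℕ) : ℝ) ≤ (n : ℝ) ^ n := by exact_mod_cast n.factorial_le_pow
  refine h3.trans (h4.trans ?_)
  rw [← Real.rpow_natCast, Real.rpow_def_of_pos hn0, Real.exp_le_exp]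
  have h5 : Real.log n ≤ 2 * (n : ℝ) ^ (1 / 2 : ℝ) := by
    have := Real.log_le_rpow_div hn0.le (by norm_num : (0 : ℝ) < 1 / 2)
    linarith
  calc Real.log n * n ≤ 2 * (n : ℝ) ^ (1 / 2 : ℝ) * n := by gcongr
    _ = 2 * (n : ℝ) ^ (3 / 2 : ℝ) := by
        rw [mul_assoc, ← Real.rpow_add_one hn0.ne']; norm_num
    _ ≤ 2 * (2 * x) ^ (3 / 2 : ℝ) := by gcongr
    _ ≤ 2 * (4 * x ^ (3 / 2 : ℝ)) := by
        rw [Real.mul_rpow (by norm_num) (by linarith)]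
        gcongr
        calc (2 : ℝ) ^ (3 / 2 : ℝ) ≤ 2 ^ (2 : ℝ) :=
              Real.rpow_le_rpow_of_exponent_le (by norm_num) (by norm_num)
          _ = 4 := by norm_num
    _ = _ := by ring

/-! ### The completed angular lattice sums -/

lemma two_le_latticeNorm {p : ℤ × ℤ} (hp : p ≠ 0) (h1 : p ≠ (1, 0)) (h2 : p ≠ (-1, 0))
    (h3 : p ≠ (0, 1)) (h4 : p ≠ (0, -1)) : 2 ≤ latticeNorm p := by
  by_contra h
  obtain ⟨a, b⟩ := p
  have h' : a ^ 2 + b ^ 2 < 2 := by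
    simp only [latticeNorm, not_le] at h
    exact_mod_cast h
  have ha1 : a ≤ 1 := by nlinarith
  have ha2 : -1 ≤ a := by nlinarith
  have hb1 : b ≤ 1 := by nlinarith
  have hb2 : -1 ≤ b := by nlinarith
  interval_cases a <;> interval_cases b <;> simp_all

/-- Far to the right the lattice sum is dominated by the four units. -/
lemma exists_norm_cosLatticeSeries_sub_le (k : ℕ) : ∃ a > 1, ∀ s : ℂ, a ≤ s.re →
    ‖cosLatticeSeries 1 (4 * k) s - 4‖ ≤ 1 := by
  set T := ∑' p : {p : ℤ × ℤ // p ≠ 0}, latticeNorm p ^ (-2 : ℝ) with hT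
  have hsT := summable_latticeNorm_rpow (σ := 2) one_lt_two
  have hT0 : 0 ≤ T := tsum_nonneg fun p => Real.rpow_nonneg (latticeNorm_nonneg p) _
  refine ⟨3 + T, by linarith, fun s hs => ?_⟩
  set U : Finset {p : ℤ × ℤ // p ≠ 0} :=
    {⟨(1, 0), by decide⟩, ⟨(-1, 0), by decide⟩, ⟨(0, 1), by decide⟩, ⟨(0, -1), by decide⟩} with hU
  set f : {p : ℤ × ℤ // p ≠ 0} → ℂ := fun p =>
    (Real.cos (((4 * k : ℕ) : ℝ) * (latticePoint p).arg) : ℂ) / (latticeNorm p : ℂ) ^ s with hf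
  have hf1 : ∀ p ∈ U, f p = 1 := by
    have hc : ∀ x : ℝ, ∀ n : ℤ, ((4 * k : ℕ) : ℝ) * x = n * (2 * Real.pi) →
        Real.cos (((4 * k : ℕ) : ℝ) * x) = 1 := fun x n h => by
      rw [h, Real.cos_int_mul_two_pi]
    intro p hp
    simp only [hU, Finset.mem_insert, Finset.mem_singleton] at hp
    have hnorm : latticeNorm p = 1 := by
      rcases hp with rfl | rfl | rfl | rfl <;> simp [latticeNorm]
    rw [hf]
    simp only
    rw [hnorm, Complex.ofReal_one, Complex.one_cpow, div_one, Complex.ofReal_eq_one]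
    rcases hp with rfl | rfl | rfl | rfl
    · refine hc _ 0 ?_; simp [latticePoint]
    · refine hc _ (2 * k) ?_
      simp only [latticePoint]
      push_cast
      simp only [zero_mul, add_zero, Complex.arg_neg_one]
      ring
    · refine hc _ k ?_
      simp only [latticePoint]
      push_cast
      simp only [one_mul, zero_add, Complex.arg_I]
      ring
    · refine hc _ (-k) ?_
      simp only [latticePoint]
      push_cast
      simp only [neg_mul, one_mul, zero_add, Complex.arg_neg_I]
      ring
  have hg : HasSum (fun p => if p ∈ U then f p else 0) 4 := by
    have h : HasSum (fun p => if p ∈ U then f p else 0) (∑ p ∈ U, (if p ∈ U then f p else 0)) :=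
      hasSum_sum_of_ne_finset_zero fun p hp => if_neg hp
    have e : ∑ p ∈ U, (if p ∈ U then f p else 0) = 4 := by
      rw [Finset.sum_eq_card_nsmul (b := 1) (fun p hp => by rw [if_pos hp, hf1 p hp])]
      have : U.card = 4 := by rw [hU]; rfl
      rw [this]; norm_num
    rwa [e] at h
  have hs2 : 2 ≤ s.re := by linarith
  have hd := (hasSum_cosLatticeSeries k (by linarith : 1 < s.re)).sub hg
  rw [← hd.tsum_eq]
  refine (tsum_of_norm_bounded (hsT.hasSum.mul_left ((2 : ℝ) ^ (-(s.re - 2)))) fun p => ?_).trans ?_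
  · by_cases hp : p ∈ U
    · rw [if_pos hp, sub_self, norm_zero]
      have := Real.rpow_nonneg (latticeNorm_nonneg p) (-2)
      positivity
    · rw [if_neg hp, sub_zero]
      have hne : ∀ q : {p : ℤ × ℤ // p ≠ 0}, q ∈ U → (p : ℤ × ℤ) ≠ q := fun q hq h =>
        hp (Subtype.ext h ▸ hq)
      have h2 : 2 ≤ latticeNorm p := two_le_latticeNorm p.2
        (hne ⟨(1, 0), by decide⟩ (by simp [hU])) (hne ⟨(-1, 0), by decide⟩ (by simp [hU]))
        (hne ⟨(0, 1), by decide⟩ (by simp [hU])) (hne ⟨(0, -1), by decide⟩ (by simp [hU]))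
      refine (norm_cosLattice_term_le k p s).trans ?_
      have e : -s.re = -(s.re - 2) + -2 := by ring
      rw [e, Real.rpow_add (by linarith)]
      refine mul_le_mul_of_nonneg_right ?_ (Real.rpow_nonneg (latticeNorm_nonneg p) _)
      exact Real.rpow_le_rpow_of_nonpos two_pos h2 (by linarith)
  · rw [← hT, Real.rpow_neg two_pos.le, inv_mul_le_iff₀ (by positivity), mul_one]
    have := one_add_mul_self_le_rpow_one_add (s := 1) (by norm_num) (p := s.re - 2) (by linarith)
    norm_num at this
    linarith

/-- The completed lattice sum `π^{-s} Γ(s+2k) ∑ cos (4kθ_p) |p|^{-2s}`, continued to `ℂ`. -/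
noncomputable def completedSum (k : ℕ) (s : ℂ) : ℂ :=
  (Real.pi : ℂ) ^ (2 * k) * completedLattice k s - if k = 0 then 1 / s + 1 / (1 - s) else 0

lemma completedSum_one_sub (k : ℕ) (s : ℂ) : completedSum k (1 - s) = completedSum k s := by
  rw [completedSum, completedSum, completedLattice_one_sub, sub_sub_cancel,
    add_comm (1 / (1 - s))]

lemma completedSum_eq (k : ℕ) {s : ℂ} (hs : 1 < s.re) :
    completedSum k s =
      (Real.pi : ℂ) ^ (-s) * Complex.Gamma (s + 2 * k) * cosLatticeSeries 1 (4 * k) s := by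
  have hpi : (Real.pi : ℂ) ≠ 0 := by exact_mod_cast Real.pi_ne_zero
  rcases eq_or_ne k 0 with rfl | hk
  · have h := completedLattice_zero_eq hs
    simp only [completedSum, if_pos, mul_zero, pow_zero, one_mul, Nat.cast_zero, add_zero]
    rw [← h]; ring
  · rw [completedSum, if_neg hk, sub_zero, completedLattice_eq_of_pos hk hs, neg_add,
      Complex.cpow_add _ _ hpi, Complex.cpow_neg _ (2 * (k : ℂ))]
    have e : (Real.pi : ℂ) ^ (2 * (k : ℂ)) = (Real.pi : ℂ) ^ (2 * k) := by
      rw [← Complex.cpow_natCast]; push_cast; rfl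
    rw [e]
    have : (Real.pi : ℂ) ^ (2 * k) ≠ 0 := pow_ne_zero _ hpi
    field_simp

lemma differentiableAt_completedSum (k : ℕ) {s : ℂ} (h0 : s ≠ 0) (h1 : s ≠ 1) :
    DifferentiableAt ℂ (completedSum k) s := by
  have h1' : 1 - s ≠ 0 := sub_ne_zero.2 h1.symm
  have hd := differentiable_completedLattice k s
  unfold completedSum
  split_ifs
  · exact (hd.const_mul _).sub (((differentiableAt_const _).div differentiableAt_id h0).add
      ((differentiableAt_const _).div (by fun_prop) h1'))
  · exact (hd.const_mul _).sub (differentiableAt_const _)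

lemma exists_norm_completedSum_le (k : ℕ) (a b : ℝ) :
    ∃ C : ℝ, ∀ s : ℂ, a ≤ s.re → s.re ≤ b → 1 ≤ ‖s‖ → 1 ≤ ‖1 - s‖ → ‖completedSum k s‖ ≤ C := by
  obtain ⟨C, hC⟩ := exists_norm_completedLattice_le k a b
  refine ⟨‖(Real.pi : ℂ) ^ (2 * k)‖ * C + 2, fun s h1 h2 h3 h4 => ?_⟩
  refine (norm_sub_le _ _).trans (add_le_add ?_ ?_)
  · rw [norm_mul]
    gcongr
    exact hC s h1 h2
  · split_ifs
    · refine (norm_add_le _ _).trans ?_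
      rw [norm_div, norm_div, norm_one]
      have h5 : 1 / ‖s‖ ≤ 1 := by rw [div_le_one (by linarith)]; exact h3
      have h6 : 1 / ‖1 - s‖ ≤ 1 := by rw [div_le_one (by linarith)]; exact h4
      linarith
    · simp

lemma re_add_two_mul (s : ℂ) (k : ℕ) : (s + 2 * (k : ℂ)).re = s.re + 2 * k := by simp

lemma im_add_two_mul (s : ℂ) (k : ℕ) : (s + 2 * (k : ℂ)).im = s.im := by simp

lemma norm_pi_cpow_neg (s : ℂ) : ‖(Real.pi : ℂ) ^ (-s)‖ = Real.pi ^ (-s.re) := by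
  rw [Complex.norm_cpow_eq_rpow_re_of_pos Real.pi_pos, Complex.neg_re]

lemma differentiableOn_cosLatticeSeries (k : ℕ) :
    DifferentiableOn ℂ (cosLatticeSeries 1 (4 * k)) {s | 1 < s.re} := by
  have hpi : (Real.pi : ℂ) ≠ 0 := by exact_mod_cast Real.pi_ne_zero
  have h : DifferentiableOn ℂ (fun s => completedSum k s * (Real.pi : ℂ) ^ s *
      (Complex.Gamma (s + 2 * k))⁻¹) {s | 1 < s.re} := by
    intro s hs
    have hs' : 1 < s.re := hs
    have h0 : s ≠ 0 := fun h => by rw [h, Complex.zero_re] at hs'; linarith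
    have h1 : s ≠ 1 := fun h => by rw [h, Complex.one_re] at hs'; linarith
    have e2 : DifferentiableAt ℂ (fun s : ℂ => (Real.pi : ℂ) ^ s) s :=
      differentiableAt_id.const_cpow (Or.inl hpi)
    have e3 : DifferentiableAt ℂ (fun s : ℂ => (Complex.Gamma (s + 2 * k))⁻¹) s :=
      (Complex.differentiable_one_div_Gamma.comp (by fun_prop :
        Differentiable ℂ fun s : ℂ => s + 2 * (k : ℂ))) s
    exact (((differentiableAt_completedSum k h0 h1).mul e2).mul e3).differentiableWithinAt
  refine h.congr fun s hs => ?_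
  have hs' : 1 < s.re := hs
  have hG : Complex.Gamma (s + 2 * k) ≠ 0 := Complex.Gamma_ne_zero_of_re_pos (by
    rw [re_add_two_mul]; positivity)
  have hp : (Real.pi : ℂ) ^ s ≠ 0 := by
    rw [Ne, Complex.cpow_eq_zero_iff]; exact fun h => hpi h.1
  rw [completedSum_eq k hs, Complex.cpow_neg]
  field_simp

lemma cosLatticeSeries_conj (k : ℕ) {s : ℂ} (hs : 1 < s.re) :
    cosLatticeSeries 1 (4 * k) (starRingEnd ℂ s) =
      starRingEnd ℂ (cosLatticeSeries 1 (4 * k) s) := by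
  have h1 := hasSum_cosLatticeSeries k (s := starRingEnd ℂ s) (by simpa using hs)
  have h2 := Complex.hasSum_conj'.2 (hasSum_cosLatticeSeries k hs)
  refine h1.unique (h2.congr_fun fun p => ?_)
  rw [map_div₀, Complex.conj_ofReal, Complex.cpow_conj _ _ (by
    rw [Complex.arg_ofReal_of_nonneg (latticeNorm_nonneg p)]; exact Real.pi_pos.ne),
    Complex.conj_ofReal]

lemma completedSum_conj (k : ℕ) {s : ℂ} (hs : 1 < s.re) :
    completedSum k (starRingEnd ℂ s) = starRingEnd ℂ (completedSum k s) := by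
  rw [completedSum_eq k hs, completedSum_eq k (by simpa using hs), cosLatticeSeries_conj k hs,
    map_mul, map_mul, ← Complex.Gamma_conj, ← map_neg, Complex.cpow_conj _ _ (by
    rw [Complex.arg_ofReal_of_nonneg Real.pi_pos.le]; exact Real.pi_pos.ne),
    map_add, map_mul, map_ofNat, map_natCast, Complex.conj_ofReal]

/-- The completed lattice sum decays at most exponentially on vertical lines far to the right. -/
lemma exists_le_norm_completedSum (k : ℕ) : ∃ a₀ : ℝ, ∀ a ≥ a₀, ∃ c > 0, ∀ s : ℂ,
    s.re = a → 1 ≤ |s.im| → c * Real.exp (-(Real.pi * |s.im|)) ≤ ‖completedSum k s‖ := by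
  obtain ⟨a₀, ha₀, hD⟩ := exists_norm_cosLatticeSeries_sub_le k
  refine ⟨a₀, fun a ha => ?_⟩
  obtain ⟨c, hc, h⟩ := exists_le_norm_Gamma (a + 2 * k)
  refine ⟨Real.pi ^ (-a) * c * 1, by positivity, fun s hs ht => ?_⟩
  have h1 := h (s + 2 * k) (by rw [re_add_two_mul, hs]) (by rwa [im_add_two_mul])
  rw [im_add_two_mul] at h1
  have h2 : 1 ≤ ‖cosLatticeSeries 1 (4 * k) s‖ := by
    have h3 := hD s (by linarith)
    have h4 := norm_sub_norm_le 4 (cosLatticeSeries 1 (4 * k) s)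
    rw [norm_sub_rev, Complex.norm_ofNat] at h4
    linarith
  rw [completedSum_eq k (by linarith), norm_mul, norm_mul, norm_pi_cpow_neg, hs]
  calc Real.pi ^ (-a) * c * 1 * Real.exp (-(Real.pi * |s.im|)) =
      Real.pi ^ (-a) * (c * Real.exp (-(Real.pi * |s.im|))) * 1 := by ring
    _ ≤ _ := by gcongr

/-- Growth of the completed lattice sum far to the right. -/
lemma exists_norm_completedSum_le_exp (k : ℕ) : ∃ a₀ C : ℝ, ∀ s : ℂ, a₀ ≤ s.re →
    ‖completedSum k s‖ ≤ Real.exp (C * (1 + ‖s‖) ^ (3 / 2 : ℝ)) := by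
  obtain ⟨a₀, ha₀, hD⟩ := exists_norm_cosLatticeSeries_sub_le k
  refine ⟨max a₀ 2, 8 * (2 * k + 1 : ℝ) ^ (3 / 2 : ℝ) + 5, fun s hs => ?_⟩
  have hs1 : a₀ ≤ s.re := (le_max_left _ _).trans hs
  have hs2 : 2 ≤ s.re := (le_max_right _ _).trans hs
  have h2 : ‖cosLatticeSeries 1 (4 * k) s‖ ≤ 5 := by
    have h3 := hD s hs1
    have h4 := norm_sub_norm_le (cosLatticeSeries 1 (4 * k) s) 4
    rw [Complex.norm_ofNat] at h4
    linarith
  have h5 : ‖(Real.pi : ℂ) ^ (-s)‖ ≤ 1 := by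
    rw [norm_pi_cpow_neg]
    exact Real.rpow_le_one_of_one_le_of_nonpos (by linarith [Real.pi_gt_three]) (by linarith)
  have hk : (0 : ℝ) ≤ 2 * k := by positivity
  have h6 : ‖Complex.Gamma (s + 2 * k)‖ ≤
      Real.exp (8 * ((2 * k + 1) * (1 + ‖s‖)) ^ (3 / 2 : ℝ)) := by
    refine (norm_Gamma_le (by rw [re_add_two_mul]; linarith)).trans
      ((Gamma_le_exp (by rw [re_add_two_mul]; linarith)).trans ?_)
    rw [re_add_two_mul]
    have : s.re + 2 * k ≤ (2 * k + 1) * (1 + ‖s‖) := by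
      nlinarith [Complex.re_le_norm s, norm_nonneg s]
    gcongr
  have h7 : (5 : ℝ) ≤ Real.exp (5 * (1 + ‖s‖) ^ (3 / 2 : ℝ)) := by
    have h8 : (1 : ℝ) ≤ (1 + ‖s‖) ^ (3 / 2 : ℝ) :=
      Real.one_le_rpow (by linarith [norm_nonneg s]) (by norm_num)
    have := Real.add_one_le_exp (5 * (1 + ‖s‖) ^ (3 / 2 : ℝ))
    linarith
  rw [completedSum_eq k (by linarith), norm_mul, norm_mul]
  calc ‖(Real.pi : ℂ) ^ (-s)‖ * ‖Complex.Gamma (s + 2 * k)‖ * ‖cosLatticeSeries 1 (4 * k) s‖ ≤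
      1 * Real.exp (8 * ((2 * k + 1) * (1 + ‖s‖)) ^ (3 / 2 : ℝ)) *
        Real.exp (5 * (1 + ‖s‖) ^ (3 / 2 : ℝ)) := by gcongr; exact h2.trans h7
    _ = _ := by
      rw [one_mul, ← Real.exp_add, Real.mul_rpow (by positivity) (by positivity)]
      congr 1
      ring

lemma exists_norm_logDeriv_cosLatticeSeries_le (k : ℕ) : ∃ a > 1, ∀ s : ℂ, a ≤ s.re →
    cosLatticeSeries 1 (4 * k) s ≠ 0 ∧ ‖logDeriv (cosLatticeSeries 1 (4 * k)) s‖ ≤ 5 := by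
  obtain ⟨a₀, ha₀, hD⟩ := exists_norm_cosLatticeSeries_sub_le k
  refine ⟨a₀ + 1, by linarith, fun s hs => ?_⟩
  have hlow : 1 ≤ ‖cosLatticeSeries 1 (4 * k) s‖ := by
    have h3 := hD s (by linarith)
    have h4 := norm_sub_norm_le 4 (cosLatticeSeries 1 (4 * k) s)
    rw [norm_sub_rev, Complex.norm_ofNat] at h4
    linarith
  refine ⟨norm_pos_iff.1 (by linarith), ?_⟩
  have hre : ∀ z ∈ Metric.closedBall s 1, a₀ ≤ z.re := by
    intro z hz
    rw [mem_closedBall_iff_norm] at hz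
    have := (abs_le.1 ((Complex.abs_re_le_norm _).trans hz)).1
    rw [Complex.sub_re] at this
    linarith
  have hd : DiffContOnCl ℂ (cosLatticeSeries 1 (4 * k)) (Metric.ball s 1) := by
    refine DifferentiableOn.diffContOnCl ?_
    rw [closure_ball _ one_ne_zero]
    exact (differentiableOn_cosLatticeSeries k).mono fun z hz => lt_of_lt_of_le ha₀ (hre z hz)
  have h := Complex.norm_deriv_le_of_forall_mem_sphere_norm_le one_pos hd (C := 5) fun z hz => by
    have h3 := hD z (hre z (Metric.sphere_subset_closedBall hz))
    have h4 := norm_sub_norm_le (cosLatticeSeries 1 (4 * k) z) 4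
    rw [Complex.norm_ofNat] at h4
    linarith
  rw [div_one] at h
  rw [logDeriv_apply, norm_div, div_le_iff₀ (by linarith)]
  linarith

/-- Far to the right the completed lattice sum does not vanish, and the real part of its logarithmic
derivative is large. -/
lemma exists_le_re_logDeriv_completedSum (k : ℕ) (K : ℝ) : ∃ a > 1, ∀ s : ℂ, a ≤ s.re →
    completedSum k s ≠ 0 ∧ K ≤ (logDeriv (completedSum k) s).re := by
  have hpi : (Real.pi : ℂ) ≠ 0 := by exact_mod_cast Real.pi_ne_zero
  obtain ⟨a₀, ha₀, hD⟩ := exists_norm_logDeriv_cosLatticeSeries_le k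
  refine ⟨max a₀ (1 + Real.exp (K + Real.log Real.pi + 5)),
    lt_of_lt_of_le ha₀ (le_max_left _ _), fun s hs => ?_⟩
  have hs1 : a₀ ≤ s.re := (le_max_left _ _).trans hs
  have hs2 : 1 + Real.exp (K + Real.log Real.pi + 5) ≤ s.re := (le_max_right _ _).trans hs
  have hs3 : 1 < s.re := by linarith
  obtain ⟨hD0, hDl⟩ := hD s hs1
  have hGre : 0 < (s + 2 * (k : ℂ)).re := by rw [re_add_two_mul]; positivity
  have hG0 : Complex.Gamma (s + 2 * k) ≠ 0 := Complex.Gamma_ne_zero_of_re_pos hGre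
  have hp0 : (Real.pi : ℂ) ^ (-s) ≠ 0 := by
    rw [Ne, Complex.cpow_eq_zero_iff]; exact fun h => hpi h.1
  have hopen : IsOpen {s : ℂ | 1 < s.re} := isOpen_lt continuous_const Complex.continuous_re
  have hev : completedSum k =ᶠ[𝓝 s] fun s => (Real.pi : ℂ) ^ (-s) * Complex.Gamma (s + 2 * k) *
      cosLatticeSeries 1 (4 * k) s :=
    eventually_of_mem (hopen.mem_nhds hs3) fun z hz => completedSum_eq k hz
  refine ⟨by rw [completedSum_eq k hs3]; exact mul_ne_zero (mul_ne_zero hp0 hG0) hD0, ?_⟩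
  have hp : HasDerivAt (fun s : ℂ => (Real.pi : ℂ) ^ (-s))
      ((Real.pi : ℂ) ^ (-s) * Complex.log Real.pi * (-1)) s :=
    (hasDerivAt_neg s).const_cpow (Or.inl hpi)
  have hGne : ∀ m : ℕ, s + 2 * k ≠ -m := fun m h => by
    rw [h, Complex.neg_re, Complex.natCast_re] at hGre
    have : (0 : ℝ) ≤ m := m.cast_nonneg
    linarith
  have hGd := Complex.differentiableAt_Gamma _ hGne
  have hGd' : HasDerivAt (fun s : ℂ => Complex.Gamma (s + 2 * k))
      (deriv Complex.Gamma (s + 2 * k)) s := hGd.hasDerivAt.comp_add_const s _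
  have hDd : DifferentiableAt ℂ (cosLatticeSeries 1 (4 * k)) s :=
    (differentiableOn_cosLatticeSeries k).differentiableAt (hopen.mem_nhds hs3)
  have hlog : logDeriv (completedSum k) s = -Complex.log Real.pi +
      logDeriv Complex.Gamma (s + 2 * k) + logDeriv (cosLatticeSeries 1 (4 * k)) s := by
    rw [logDeriv_apply, hev.deriv_eq, hev.self_of_nhds, ← logDeriv_apply,
      logDeriv_mul (f := fun s : ℂ => (Real.pi : ℂ) ^ (-s) * Complex.Gamma (s + 2 * k)) s
        (mul_ne_zero hp0 hG0) hD0 (hp.mul hGd').differentiableAt hDd,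
      logDeriv_mul (f := fun s : ℂ => (Real.pi : ℂ) ^ (-s)) s hp0 hG0 hp.differentiableAt
        hGd'.differentiableAt, logDeriv_apply, logDeriv_apply, hp.deriv, hGd'.deriv,
      logDeriv_apply Complex.Gamma]
    congr 2
    field_simp
  have h1 := log_le_re_logDeriv_Gamma (s := s + 2 * k)
    (by rw [re_add_two_mul]; linarith [(k.cast_nonneg : (0 : ℝ) ≤ k)])
  have h2 := (abs_le.1 ((Complex.abs_re_le_norm _).trans hDl)).1
  have h3 : (Complex.log Real.pi).re = Real.log Real.pi := Complex.log_ofReal_re _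
  have h4 : K + Real.log Real.pi + 5 ≤ Real.log ((s + 2 * (k : ℂ)).re - 1) := by
    rw [re_add_two_mul]
    refine (Real.le_log_iff_exp_le (by linarith [(k.cast_nonneg : (0 : ℝ) ≤ k)])).2 ?_
    linarith [(k.cast_nonneg : (0 : ℝ) ≤ k)]
  rw [hlog, Complex.add_re, Complex.add_re, Complex.neg_re, h3]
  linarith

/-! ### The numerator of `Δ₃` is of the type of the xi function -/

/-- `X` is an entire function equal to `(s(s-1))^e A(s) B(s)`, with `A` and `B` the completed lattice
sums for the angular frequencies `0` and `4m`. -/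
structure IsCompletedProduct (e m : ℕ) (X : ℂ → ℂ) : Prop where
  differentiable : Differentiable ℂ X
  eq : ∀ s, s ≠ 0 → s ≠ 1 → X s = (s * (s - 1)) ^ e * (completedSum 0 s * completedSum m s)

lemma exists_norm_completedSum_le_exp_of_half_le (k : ℕ) : ∃ C ≥ 0, ∀ s : ℂ, 1 / 2 ≤ s.re →
    2 ≤ ‖s‖ → ‖completedSum k s‖ ≤ Real.exp (C * (1 + ‖s‖) ^ (3 / 2 : ℝ)) := by
  obtain ⟨a₀, C₁, h1⟩ := exists_norm_completedSum_le_exp k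
  obtain ⟨C₂, h2⟩ := exists_norm_completedSum_le k (1 / 2) a₀
  refine ⟨max (max C₁ C₂) 0, le_max_right _ _, fun s hs hn => ?_⟩
  have hr : (1 : ℝ) ≤ (1 + ‖s‖) ^ (3 / 2 : ℝ) :=
    Real.one_le_rpow (by linarith [norm_nonneg s]) (by norm_num)
  rcases le_total a₀ s.re with h | h
  · refine (h1 s h).trans ?_
    gcongr
    exact (le_max_left _ _).trans (le_max_left _ _)
  · have h3 : 1 ≤ ‖1 - s‖ := by
      have := norm_sub_norm_le s 1
      rw [norm_one, norm_sub_rev] at this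
      linarith
    refine (h2 s hs h (by linarith) h3).trans ?_
    have h4 : C₂ ≤ max (max C₁ C₂) 0 := (le_max_right _ _).trans (le_max_left _ _)
    have h5 : (0 : ℝ) ≤ max (max C₁ C₂) 0 := le_max_right _ _
    have h6 := Real.add_one_le_exp (max (max C₁ C₂) 0 * (1 + ‖s‖) ^ (3 / 2 : ℝ))
    nlinarith

namespace IsCompletedProduct

variable {e m : ℕ} {X : ℂ → ℂ}

lemma eq_of_one_lt_re (h : IsCompletedProduct e m X) {s : ℂ} (hs : 1 < s.re) :
    X s = (s * (s - 1)) ^ e * (completedSum 0 s * completedSum m s) := by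
  refine h.eq s (fun h0 => ?_) fun h1 => ?_
  · rw [h0, Complex.zero_re] at hs; linarith
  · rw [h1, Complex.one_re] at hs; linarith

lemma one_sub (h : IsCompletedProduct e m X) (s : ℂ) : X (1 - s) = X s := by
  have hdense : Dense ({0, 1} : Set ℂ)ᶜ := (Set.toFinite _).countable.dense_compl ℝ
  refine congrFun (Continuous.ext_on (f := fun s => X (1 - s)) hdense
    (h.differentiable.continuous.comp (by fun_prop)) h.differentiable.continuous fun s hs => ?_) s
  simp only [mem_compl_iff, mem_insert_iff, mem_singleton_iff, not_or] at hs
  simp only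
  rw [h.eq s hs.1 hs.2, h.eq (1 - s) (sub_ne_zero.2 (Ne.symm hs.2))
    (by simpa using hs.1), completedSum_one_sub, completedSum_one_sub]
  congr 2
  ring

lemma conj (h : IsCompletedProduct e m X) (s : ℂ) :
    X (starRingEnd ℂ s) = starRingEnd ℂ (X s) := by
  have hd : Differentiable ℂ (fun s => starRingEnd ℂ (X (starRingEnd ℂ s))) := fun s => by
    simpa [Function.comp_def] using (h.differentiable (starRingEnd ℂ s)).conj_conj
  have h1 := Complex.analyticOnNhd_univ_iff_differentiable.2 hd
  have h2 := Complex.analyticOnNhd_univ_iff_differentiable.2 h.differentiable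
  have hopen : IsOpen {s : ℂ | 1 < s.re} := isOpen_lt continuous_const Complex.continuous_re
  have heq := congrFun (h1.eq_of_eventuallyEq h2 (z₀ := 2)
    (eventually_of_mem (hopen.mem_nhds (by simp)) fun z hz => by
      have hz' : 1 < z.re := hz
      simp only
      rw [h.eq_of_one_lt_re hz', h.eq_of_one_lt_re (by simpa using hz'), completedSum_conj 0 hz',
        completedSum_conj m hz']
      simp)) s
  rw [← heq, Complex.conj_conj]

lemma exists_norm_le_exp (h : IsCompletedProduct e m X) :
    ∃ C : ℝ, ∀ s, ‖X s‖ ≤ Real.exp (C * (1 + ‖s‖) ^ (3 / 2 : ℝ)) := by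
  obtain ⟨C₁, hC₁, h1⟩ := exists_norm_completedSum_le_exp_of_half_le 0
  obtain ⟨C₂, hC₂, h2⟩ := exists_norm_completedSum_le_exp_of_half_le m
  obtain ⟨M, hM⟩ := (isCompact_closedBall (0 : ℂ) 2).exists_bound_of_continuousOn
    h.differentiable.continuous.continuousOn
  set C : ℝ := 2 * e + C₁ + C₂ + max M 0 with hC
  have hM0 : (0 : ℝ) ≤ max M 0 := le_max_right _ _
  have he0 : (0 : ℝ) ≤ 2 * e := by positivity
  have key : ∀ s : ℂ, 1 / 2 ≤ s.re → ‖X s‖ ≤ Real.exp (C * (1 + ‖s‖) ^ (3 / 2 : ℝ)) := by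
    intro s hs
    have hn := norm_nonneg s
    have hr1 : 1 + ‖s‖ ≤ (1 + ‖s‖) ^ (3 / 2 : ℝ) :=
      Real.self_le_rpow_of_one_le (by linarith) (by norm_num)
    set r := (1 + ‖s‖) ^ (3 / 2 : ℝ) with hr
    have hr0 : 1 ≤ r := by linarith
    rcases le_total ‖s‖ 2 with h3 | h3
    · have h4 := hM s (by simpa using h3)
      have h5 := Real.add_one_le_exp (C * r)
      have h6 : max M 0 ≤ C * r := by nlinarith
      linarith [le_max_left M 0]
    · have hs0 : s ≠ 0 := fun h0 => by rw [h0, norm_zero] at h3; linarith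
      have hs1 : s ≠ 1 := fun h0 => by rw [h0, norm_one] at h3; linarith
      have hq : ‖(s * (s - 1)) ^ e‖ ≤ Real.exp (2 * e * r) := by
        have h4 : ‖s - 1‖ ≤ 1 + ‖s‖ := by
          have := norm_sub_le s 1
          rw [norm_one] at this; linarith
        have h5 := Real.add_one_le_exp ‖s‖
        have h6 : ‖s * (s - 1)‖ ≤ Real.exp (2 * r) := by
          rw [norm_mul, two_mul, Real.exp_add]
          have h7 : 1 + ‖s‖ ≤ Real.exp r := by linarith [Real.add_one_le_exp r]
          exact mul_le_mul (by linarith) (h4.trans h7) (norm_nonneg _) (Real.exp_pos _).le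
        rw [norm_pow]
        calc ‖s * (s - 1)‖ ^ e ≤ Real.exp (2 * r) ^ e := by gcongr
          _ = _ := by rw [← Real.exp_nat_mul]; congr 1; ring
      rw [h.eq s hs0 hs1, norm_mul, norm_mul]
      calc ‖(s * (s - 1)) ^ e‖ * (‖completedSum 0 s‖ * ‖completedSum m s‖) ≤
          Real.exp (2 * e * r) * (Real.exp (C₁ * r) * Real.exp (C₂ * r)) := by
            gcongr
            · exact h1 s hs h3
            · exact h2 s hs h3
        _ = Real.exp (2 * e * r + (C₁ * r + C₂ * r)) := by rw [Real.exp_add, Real.exp_add]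
        _ ≤ _ := by
            rw [Real.exp_le_exp, hC]
            nlinarith
  have hC0 : 0 ≤ C := by rw [hC]; linarith
  refine ⟨C * 2 ^ (3 / 2 : ℝ), fun s => ?_⟩
  have hn := norm_nonneg s
  have hfin : ∀ x : ℝ, 0 ≤ x → x ≤ 2 * (1 + ‖s‖) → Real.exp (C * x ^ (3 / 2 : ℝ)) ≤
      Real.exp (C * 2 ^ (3 / 2 : ℝ) * (1 + ‖s‖) ^ (3 / 2 : ℝ)) := by
    intro x hx hx2
    rw [Real.exp_le_exp, mul_assoc, ← Real.mul_rpow two_pos.le (by positivity)]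
    gcongr
  rcases le_total (1 / 2) s.re with hs | hs
  · exact (key s hs).trans (hfin _ (by positivity) (by linarith))
  · have h1 := key (1 - s) (by simp; linarith)
    rw [h.one_sub] at h1
    have h2 := norm_sub_le 1 s
    rw [norm_one] at h2
    exact h1.trans (hfin _ (by positivity) (by linarith))

lemma exists_strip_bound (h : IsCompletedProduct e m X) (a b : ℝ) : ∃ C : ℝ, ∀ s : ℂ, a ≤ s.re →
    s.re ≤ b → 1 ≤ |s.im| → ‖X s‖ ≤ Real.exp (C * |s.im|) := by
  obtain ⟨C₁, h1⟩ := exists_norm_completedSum_le 0 a b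
  obtain ⟨C₂, h2⟩ := exists_norm_completedSum_le m a b
  set R := |a| + |b| with hR
  refine ⟨2 * e * (R + 1) + (|C₁| + |C₂|), fun s ha hb ht => ?_⟩
  have hre : |s.re| ≤ R := by
    rw [abs_le]
    constructor
    · linarith [neg_abs_le a, abs_nonneg b]
    · linarith [le_abs_self b, abs_nonneg a]
  have hR0 : 0 ≤ R := (abs_nonneg _).trans hre
  have hn : 1 ≤ ‖s‖ := ht.trans (Complex.abs_im_le_norm s)
  have hn1 : 1 ≤ ‖1 - s‖ := by
    have := Complex.abs_im_le_norm (1 - s)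
    simp only [Complex.sub_im, Complex.one_im, zero_sub, abs_neg] at this
    linarith
  have hs0 : s ≠ 0 := fun h0 => by rw [h0, norm_zero] at hn; linarith
  have hs1 : s ≠ 1 := fun h0 => by rw [h0, sub_self, norm_zero] at hn1; linarith
  have hb1 : ∀ C : ℝ, C ≤ Real.exp (|C| * |s.im|) := fun C => by
    have h3 := Real.add_one_le_exp (|C| * |s.im|)
    nlinarith [le_abs_self C, abs_nonneg C]
  have hq : ‖(s * (s - 1)) ^ e‖ ≤ Real.exp (2 * e * (R + 1) * |s.im|) := by
    have h3 : ‖s‖ ≤ R + |s.im| := (Complex.norm_le_abs_re_add_abs_im s).trans (by linarith)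
    have h4 : ‖s - 1‖ ≤ 1 + ‖s‖ := by
      have := norm_sub_le s 1
      rw [norm_one] at this; linarith
    have h5 : 1 + ‖s‖ ≤ Real.exp ((R + 1) * |s.im|) := by
      have := Real.add_one_le_exp ((R + 1) * |s.im|)
      nlinarith
    have h6 : ‖s * (s - 1)‖ ≤ Real.exp (2 * ((R + 1) * |s.im|)) := by
      rw [norm_mul, two_mul, Real.exp_add]
      exact mul_le_mul (by linarith) (h4.trans h5) (norm_nonneg _) (Real.exp_pos _).le
    rw [norm_pow]
    calc ‖s * (s - 1)‖ ^ e ≤ Real.exp (2 * ((R + 1) * |s.im|)) ^ e := by gcongr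
      _ = _ := by rw [← Real.exp_nat_mul]; congr 1; ring
  rw [h.eq s hs0 hs1, norm_mul, norm_mul]
  calc ‖(s * (s - 1)) ^ e‖ * (‖completedSum 0 s‖ * ‖completedSum m s‖) ≤
      Real.exp (2 * e * (R + 1) * |s.im|) *
        (Real.exp (|C₁| * |s.im|) * Real.exp (|C₂| * |s.im|)) := by
        gcongr
        · exact (h1 s ha hb hn hn1).trans (hb1 C₁)
        · exact (h2 s ha hb hn hn1).trans (hb1 C₂)
    _ = _ := by rw [← Real.exp_add, ← Real.exp_add]; congr 1; ring

lemma exists_le_norm (h : IsCompletedProduct e m X) : ∃ a₀ : ℝ, ∀ a ≤ a₀, ∃ C : ℝ, ∀ s : ℂ,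
    s.re = a → 1 ≤ |s.im| → Real.exp (-(C * |s.im|)) ≤ ‖X s‖ := by
  obtain ⟨a₁, h1⟩ := exists_le_norm_completedSum 0
  obtain ⟨a₂, h2⟩ := exists_le_norm_completedSum m
  refine ⟨1 - max a₁ a₂, fun a ha => ?_⟩
  obtain ⟨c₁, hc₁, h1⟩ := h1 (1 - a) (by linarith [le_max_left a₁ a₂])
  obtain ⟨c₂, hc₂, h2⟩ := h2 (1 - a) (by linarith [le_max_right a₁ a₂])
  set L := |Real.log (c₁ * c₂)| with hL
  refine ⟨2 * Real.pi + L, fun s hs ht => ?_⟩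
  have hre : (1 - s).re = 1 - a := by simp [hs]
  have him : |(1 - s).im| = |s.im| := by simp
  have h1 := h1 (1 - s) hre (by rwa [him])
  have h2 := h2 (1 - s) hre (by rwa [him])
  rw [him] at h1 h2
  have hn : 1 ≤ ‖s‖ := ht.trans (Complex.abs_im_le_norm s)
  have hn1 : 1 ≤ ‖1 - s‖ := by
    have := Complex.abs_im_le_norm (1 - s)
    rw [him] at this
    linarith
  have hs0 : s ≠ 0 := fun h0 => by rw [h0, norm_zero] at hn; linarith
  have hs1 : s ≠ 1 := fun h0 => by rw [h0, sub_self, norm_zero] at hn1; linarith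
  have hq : 1 ≤ ‖((1 - s) * (1 - s - 1)) ^ e‖ := by
    rw [norm_pow, norm_mul, sub_sub_cancel_left, norm_neg]
    exact one_le_pow₀ (by nlinarith)
  have hc : Real.exp (-(L * |s.im|)) ≤ c₁ * c₂ := by
    rw [← Real.le_log_iff_exp_le (by positivity)]
    have := neg_abs_le (Real.log (c₁ * c₂))
    have h0 := abs_nonneg (Real.log (c₁ * c₂))
    nlinarith
  rw [← h.one_sub, h.eq (1 - s) (sub_ne_zero.2 hs1.symm) (by simpa using hs0), norm_mul, norm_mul]
  calc Real.exp (-((2 * Real.pi + L) * |s.im|)) =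
      Real.exp (-(L * |s.im|)) * (Real.exp (-(Real.pi * |s.im|)) *
        Real.exp (-(Real.pi * |s.im|))) := by
        rw [← Real.exp_add, ← Real.exp_add]; congr 1; ring
    _ ≤ c₁ * c₂ * (Real.exp (-(Real.pi * |s.im|)) * Real.exp (-(Real.pi * |s.im|))) := by gcongr
    _ = 1 * ((c₁ * Real.exp (-(Real.pi * |s.im|))) * (c₂ * Real.exp (-(Real.pi * |s.im|)))) := by
        ring
    _ ≤ _ := by gcongr

lemma exists_re_logDeriv_le (h : IsCompletedProduct e m X) (K : ℝ) : ∃ a₁ : ℝ, ∀ s : ℂ,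
    s.re ≤ a₁ → (logDeriv X s).re ≤ -K := by
  obtain ⟨a₁, ha₁, h1⟩ := exists_le_re_logDeriv_completedSum 0 |K|
  obtain ⟨a₂, ha₂, h2⟩ := exists_le_re_logDeriv_completedSum m |K|
  refine ⟨1 - max a₁ a₂, fun w hw => ?_⟩
  have hrefl : logDeriv X w = -logDeriv X (1 - w) := by
    have e : X = fun s => X (1 - s) := funext fun s => (h.one_sub s).symm
    have hd : deriv X w = -deriv X (1 - w) := by
      conv_lhs => rw [e]
      exact deriv_comp_const_sub (f := X) 1 w
    rw [logDeriv_apply, logDeriv_apply, hd, h.one_sub]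
    ring
  rw [hrefl, Complex.neg_re, neg_le_neg_iff]
  have hsw : (1 - w).re = 1 - w.re := by simp
  set s := 1 - w with hs
  have hs1 : a₁ ≤ s.re := by linarith [le_max_left a₁ a₂]
  have hs2 : a₂ ≤ s.re := by linarith [le_max_right a₁ a₂]
  have hs3 : 1 < s.re := by linarith
  obtain ⟨hA, h1⟩ := h1 s hs1
  obtain ⟨hB, h2⟩ := h2 s hs2
  have hs0 : s ≠ 0 := fun h0 => by rw [h0, Complex.zero_re] at hs3; linarith
  have hsn : s ≠ 1 := fun h0 => by rw [h0, Complex.one_re] at hs3; linarith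
  have hsn' : s - 1 ≠ 0 := sub_ne_zero.2 hsn
  have hopen : IsOpen {s : ℂ | 1 < s.re} := isOpen_lt continuous_const Complex.continuous_re
  have hev : X =ᶠ[𝓝 s] fun s => (s * (s - 1)) ^ e * (completedSum 0 s * completedSum m s) :=
    eventually_of_mem (hopen.mem_nhds hs3) fun z hz => h.eq_of_one_lt_re hz
  have hq : DifferentiableAt ℂ (fun s : ℂ => s * (s - 1)) s := by fun_prop
  have hdA := differentiableAt_completedSum 0 hs0 hsn
  have hdB := differentiableAt_completedSum m hs0 hsn
  have hlog : logDeriv X s = e * (1 / s + 1 / (s - 1)) +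
      (logDeriv (completedSum 0) s + logDeriv (completedSum m) s) := by
    rw [logDeriv_apply, hev.deriv_eq, hev.self_of_nhds, ← logDeriv_apply,
      logDeriv_mul (f := fun s : ℂ => (s * (s - 1)) ^ e)
        (g := fun s => completedSum 0 s * completedSum m s) s (pow_ne_zero _ (mul_ne_zero hs0 hsn'))
        (mul_ne_zero hA hB) (hq.pow e) (hdA.mul hdB), logDeriv_fun_pow hq,
      logDeriv_mul (f := completedSum 0) (g := completedSum m) s hA hB hdA hdB,
      logDeriv_mul (f := fun s : ℂ => s) (g := fun s => s - 1) s hs0 hsn' (by fun_prop) (by fun_prop)]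
    congr 3
    · rw [logDeriv_apply, deriv_id'']
    · rw [logDeriv_apply, deriv_sub_const, deriv_id'']
  have hinv : ∀ z : ℂ, 0 ≤ z.re → 0 ≤ (1 / z).re := fun z hz => by
    rw [one_div, Complex.inv_re]
    exact div_nonneg hz (Complex.normSq_nonneg _)
  have h3 := hinv s (by linarith)
  have h4 := hinv (s - 1) (by simp; linarith)
  have h5 : ((e : ℂ) * (1 / s + 1 / (s - 1))).re = e * ((1 / s).re + (1 / (s - 1)).re) := by
    rw [← Complex.ofReal_natCast, Complex.re_ofReal_mul, Complex.add_re]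
  have h6 : (0 : ℝ) ≤ e * ((1 / s).re + (1 / (s - 1)).re) := by positivity
  rw [hlog, Complex.add_re, h5, Complex.add_re]
  linarith [le_abs_self K, abs_nonneg K]

theorem isXiLike (h : IsCompletedProduct e m X) (h0 : ∀ s : ℂ, s.re < 1 / 2 → X s ≠ 0) :
    IsXiLike X where
  differentiable := h.differentiable
  symm := h.one_sub
  conj := h.conj
  ne_zero := h0
  upper a b := by
    obtain ⟨C, hC⟩ := h.exists_strip_bound a b
    exact ⟨C, 1, hC⟩
  lower := by
    obtain ⟨a₀, ha⟩ := h.exists_le_norm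
    refine ⟨a₀, fun a h => ?_⟩
    obtain ⟨C, hC⟩ := ha a h
    exact ⟨C, 1, hC⟩
  logDeriv_re := h.exists_re_logDeriv_le

end IsCompletedProduct

/-! ### Identification of `Δ₃` -/

/-- The identity theorem for meromorphic functions, with values in normal form. -/
lemma eventuallyEq_of_meromorphicNFAt {f g : ℂ → ℂ} (hf : MeromorphicNFOn f univ)
    (hg : MeromorphicOn g univ) {x₀ : ℂ} (h : f =ᶠ[𝓝[≠] x₀] g) {x : ℂ} (hx : MeromorphicNFAt g x) :
    f =ᶠ[𝓝 x] g := by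
  refine ((hf (mem_univ x)).eventuallyEq_nhdsNE_iff_eventuallyEq_nhds hx).1 ?_
  have hd : MeromorphicOn (f - g) univ := hf.meromorphicOn.sub hg
  have h0 : meromorphicOrderAt (f - g) x₀ = ⊤ := by
    rw [meromorphicOrderAt_eq_top_iff]
    filter_upwards [h] with z hz
    rw [Pi.sub_apply, hz, sub_self]
  have h1 : meromorphicOrderAt (f - g) x = ⊤ := by
    by_contra hne
    exact hd.meromorphicOrderAt_ne_top_of_isPreconnected isPreconnected_univ (mem_univ x)
      (mem_univ x₀) hne h0
  rw [meromorphicOrderAt_eq_top_iff] at h1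
  filter_upwards [h1] with z hz
  exact sub_eq_zero.1 hz

/-- A continuation in the sense of `meromorphicContinuation` exists as soon as the function agrees
with some meromorphic function on an open set on which the latter is holomorphic. -/
lemma meromorphicContinuation_spec {D : Set ℂ} (hD : IsOpen D) {F g : ℂ → ℂ}
    (hF : MeromorphicOn F univ) (hd : DifferentiableOn ℂ F D) (heq : EqOn F g D) :
    MeromorphicNFOn (meromorphicContinuation D g) univ ∧
      EqOn (meromorphicContinuation D g) g D := by
  have h : ∃ G : ℂ → ℂ, MeromorphicNFOn G univ ∧ EqOn G g D := by
    refine ⟨toMeromorphicNFOn F univ, meromorphicNFOn_toMeromorphicNFOn F univ, fun z hz => ?_⟩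
    have ha : AnalyticAt ℂ F z := hd.analyticAt (hD.mem_nhds hz)
    rw [toMeromorphicNFOn_eq_toMeromorphicNFAt hF (mem_univ z),
      toMeromorphicNFAt_eq_self.2 ha.meromorphicNFAt, heq hz]
  unfold meromorphicContinuation
  rw [dif_pos h]
  exact h.choose_spec

lemma meromorphicAt_completedSum (k : ℕ) (s : ℂ) : MeromorphicAt (completedSum k) s := by
  have h1 : MeromorphicAt (completedLattice k) s :=
    (Complex.analyticOnNhd_univ_iff_differentiable.2 (differentiable_completedLattice k) s
      (mem_univ s)).meromorphicAt
  unfold completedSum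
  split_ifs <;> fun_prop

lemma isOpen_one_lt_re : IsOpen {s : ℂ | 1 < s.re} := isOpen_lt continuous_const Complex.continuous_re

lemma cosLatticeSum_spec (k : ℕ) : MeromorphicNFOn (cosLatticeSum 1 (4 * k)) univ ∧
    EqOn (cosLatticeSum 1 (4 * k)) (cosLatticeSeries 1 (4 * k)) {s | 1 < s.re} := by
  have hpi : (Real.pi : ℂ) ≠ 0 := by exact_mod_cast Real.pi_ne_zero
  have heq : EqOn (fun s => completedSum k s * (Real.pi : ℂ) ^ s * (Complex.Gamma (s + 2 * k))⁻¹)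
      (cosLatticeSeries 1 (4 * k)) {s | 1 < s.re} := by
    intro s hs
    have hs' : 1 < s.re := hs
    have hG : Complex.Gamma (s + 2 * k) ≠ 0 := Complex.Gamma_ne_zero_of_re_pos (by
      rw [re_add_two_mul]; positivity)
    have hp : (Real.pi : ℂ) ^ s ≠ 0 := by
      rw [Ne, Complex.cpow_eq_zero_iff]; exact fun h => hpi h.1
    simp only
    rw [completedSum_eq k hs, Complex.cpow_neg]
    field_simp
  refine meromorphicContinuation_spec isOpen_one_lt_re (fun s _ => ?_)
    ((differentiableOn_cosLatticeSeries k).congr heq) heq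
  have h2 : Differentiable ℂ fun s : ℂ => (Real.pi : ℂ) ^ s := fun s =>
    differentiableAt_id.const_cpow (Or.inl hpi)
  have h3 : Differentiable ℂ fun s : ℂ => (Complex.Gamma (s + 2 * k))⁻¹ :=
    Complex.differentiable_one_div_Gamma.comp (by fun_prop :
      Differentiable ℂ fun s : ℂ => s + 2 * (k : ℂ))
  have h2' := (Complex.analyticOnNhd_univ_iff_differentiable.2 h2 s (mem_univ s)).meromorphicAt
  have h3' := (Complex.analyticOnNhd_univ_iff_differentiable.2 h3 s (mem_univ s)).meromorphicAt
  exact ((meromorphicAt_completedSum k s).mul h2').mul h3'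

/-- For exponent `0` as well as for frequency `0` the numerators of the lattice series are `1`. -/
lemma cosLatticeSum_zero_one : cosLatticeSum 0 1 = cosLatticeSum 1 (4 * 0) := by
  have : cosLatticeSeries 0 1 = cosLatticeSeries 1 (4 * 0) := by
    funext s
    exact tsum_congr fun p => by simp
  rw [cosLatticeSum, cosLatticeSum, this]

/-- The poles of `Δ₃`: `1, …, 2m` from the Gamma factors, and `e` times the points `0` and `1` from
the poles of the lattice sums. -/
noncomputable def delta3Poles (e m : ℕ) : Multiset ℝ :=
  Multiset.replicate e 0 + Multiset.replicate e 1 + (Multiset.range (2 * m)).map fun j : ℕ => (j : ℝ) + 1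

lemma rootProd_delta3Poles (e m : ℕ) (s : ℂ) : rootProd (delta3Poles e m) s =
    (s * (s - 1)) ^ e * ∏ j ∈ Finset.range (2 * m), (s - (j + 1)) := by
  simp only [rootProd, delta3Poles, Multiset.map_add, Multiset.prod_add, Multiset.map_replicate,
    Multiset.prod_replicate, Multiset.map_map, Complex.ofReal_zero, sub_zero, Complex.ofReal_one,
    mul_pow]
  congr 1
  rw [Finset.prod_eq_multiset_prod, Finset.range_val]
  simp

lemma mem_delta3Poles {e m : ℕ} {a : ℝ} (h : a ∈ delta3Poles e m) :
    (e ≠ 0 ∧ (a = 0 ∨ a = 1)) ∨ ∃ j : ℕ, a = j + 1 := by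
  simp only [delta3Poles, Multiset.mem_add, Multiset.mem_replicate, Multiset.mem_map,
    Multiset.mem_range] at h
  rcases h with (h | h) | ⟨j, -, h⟩
  · exact Or.inl ⟨h.1, Or.inl h.2⟩
  · exact Or.inl ⟨h.1, Or.inr h.2⟩
  · exact Or.inr ⟨j, h.symm⟩

/-- On the critical line the poles `1, …, 2m` all pull in the same direction, whereas the
contributions of `0` and `1` cancel. -/
lemma re_logDeriv_rootProd_neg (e : ℕ) {m : ℕ} (hm : m ≠ 0) {s : ℂ} (hs : s.re = 1 / 2) :
    (logDeriv (rootProd (delta3Poles e m)) s).re < 0 := by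
  have hre : ∀ {z : ℂ}, z.re ≠ 0 → z ≠ 0 := fun h h0 => h (by rw [h0, Complex.zero_re])
  have hs0 : s ≠ 0 := hre (by rw [hs]; norm_num)
  have hs1 : s - 1 ≠ 0 := hre (by rw [Complex.sub_re, hs, Complex.one_re]; norm_num)
  have hjre : ∀ j : ℕ, (s - (j + 1)).re = -(j + 1 / 2) := fun j => by
    simp [hs]; ring
  have hj : ∀ j : ℕ, s - (j + 1) ≠ 0 := fun j => hre (by
    rw [hjre]
    have : (0 : ℝ) < j + 1 / 2 := by positivity
    linarith)
  have hq : DifferentiableAt ℂ (fun s : ℂ => s * (s - 1)) s := by fun_prop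
  have e1 : rootProd (delta3Poles e m) =
      fun s : ℂ => (s * (s - 1)) ^ e * ∏ j ∈ Finset.range (2 * m), (s - ((j : ℂ) + 1)) :=
    funext fun s => rootProd_delta3Poles e m s
  have hlog : logDeriv (rootProd (delta3Poles e m)) s = e * (1 / s + 1 / (s - 1)) +
      ∑ j ∈ Finset.range (2 * m), 1 / (s - (j + 1)) := by
    rw [e1, logDeriv_mul (f := fun s : ℂ => (s * (s - 1)) ^ e)
        (g := fun s : ℂ => ∏ j ∈ Finset.range (2 * m), (s - ((j : ℂ) + 1))) s
        (pow_ne_zero _ (mul_ne_zero hs0 hs1)) (Finset.prod_ne_zero_iff.2 fun j _ => hj j)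
        (hq.pow e) (by fun_prop),
      logDeriv_fun_pow hq,
      logDeriv_mul (f := fun s : ℂ => s) (g := fun s => s - 1) s hs0 hs1 (by fun_prop) (by fun_prop),
      logDeriv_prod (f := fun (j : ℕ) (s : ℂ) => s - ((j : ℂ) + 1)) (fun j _ => hj j)
        (fun j _ => by fun_prop)]
    congr 1
    · congr 2
      · rw [logDeriv_apply, deriv_id'']
      · rw [logDeriv_apply, deriv_sub_const, deriv_id'']
    · refine Finset.sum_congr rfl fun j _ => ?_
      rw [logDeriv_apply, deriv_sub_const, deriv_id'']
  have h1 : (1 / s + 1 / (s - 1)).re = 0 := by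
    have hn : Complex.normSq (s - 1) = Complex.normSq s := by
      rw [Complex.normSq_apply, Complex.normSq_apply, Complex.sub_re, Complex.sub_im, hs,
        Complex.one_re, Complex.one_im]
      ring
    rw [Complex.add_re, one_div, one_div, Complex.inv_re, Complex.inv_re, hn, Complex.sub_re, hs,
      Complex.one_re]
    ring
  have h2 : ∀ j ∈ Finset.range (2 * m), (1 / (s - ((j : ℂ) + 1))).re < 0 := fun j _ => by
    rw [one_div, Complex.inv_re, hjre]
    refine div_neg_of_neg_of_pos ?_ (Complex.normSq_pos.2 (hj j))
    have : (0 : ℝ) < j + 1 / 2 := by positivity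
    linarith
  have h3 : ((e : ℂ) * (1 / s + 1 / (s - 1))).re = 0 := by
    rw [← Complex.ofReal_natCast, Complex.re_ofReal_mul, h1, mul_zero]
  rw [hlog, Complex.add_re, h3, zero_add, Complex.re_sum]
  exact Finset.sum_neg h2 ⟨0, Finset.mem_range.2 (by omega)⟩

lemma Gamma_add_nat {z : ℂ} (hz : z.im ≠ 0) (n : ℕ) :
    Complex.Gamma (z + n) = Complex.Gamma z * ∏ j ∈ Finset.range n, (z + j) := by
  induction n with
  | zero => simp
  | succ n ih =>
    have h0 : z + n ≠ 0 := fun h => hz (by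
      have := congrArg Complex.im h
      simpa using this)
    rw [Finset.prod_range_succ, Nat.cast_add, Nat.cast_one, ← add_assoc,
      Complex.Gamma_add_one _ h0, ih]
    ring

/-- The product of Gamma factors and lattice sums that defines `Δ₃`, away from the singularities. -/
lemma delta3_formula {e m : ℕ} {X : ℂ → ℂ} (hX : IsCompletedProduct e m X) {s : ℂ} (hs : 1 < s.re)
    (hi : s.im ≠ 0) :
    Complex.Gamma s ^ 2 / ((Real.pi : ℂ) ^ (2 * s) * phaseFactor m s) *
      cosLatticeSum 0 1 s * cosLatticeSum 1 (4 * m) s = rootQuotient X (delta3Poles e m) s := by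
  have hpi : (Real.pi : ℂ) ≠ 0 := by exact_mod_cast Real.pi_ne_zero
  have him : ∀ {z : ℂ}, z.im ≠ 0 → z ≠ 0 := fun h h0 => h (by rw [h0, Complex.zero_im])
  have hs0 : s ≠ 0 := him hi
  have hs1 : s - 1 ≠ 0 := him (by simpa using hi)
  have hi' : (1 - s).im ≠ 0 := by simpa using hi
  have hΓ : ∀ {z : ℂ}, z.im ≠ 0 → Complex.Gamma z ≠ 0 := fun h => Complex.Gamma_ne_zero fun n hn =>
    h (by rw [hn]; simp)
  have h1 := hΓ hi
  have h2 := hΓ hi'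
  have h3 : Complex.Gamma (s + 2 * m) ≠ 0 := hΓ (by rwa [im_add_two_mul])
  have hQ : ∏ j ∈ Finset.range (2 * m), (1 - s + j) =
      ∏ j ∈ Finset.range (2 * m), (s - (j + 1)) := by
    have e1 : ∏ j ∈ Finset.range (2 * m), (1 - s + j) =
        ∏ j ∈ Finset.range (2 * m), -(s - ((j : ℂ) + 1)) :=
      Finset.prod_congr rfl fun j _ => by ring
    rw [e1, Finset.prod_neg, Finset.card_range, pow_mul, neg_one_sq, one_pow, one_mul]
  have hQ0 : ∏ j ∈ Finset.range (2 * m), (s - ((j : ℂ) + 1)) ≠ 0 :=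
    Finset.prod_ne_zero_iff.2 fun j _ => him (by simpa using hi)
  have h4 : Complex.Gamma (1 - s + 2 * m) = Complex.Gamma (1 - s) *
      ∏ j ∈ Finset.range (2 * m), (s - (j + 1)) := by
    rw [← hQ, ← Gamma_add_nat hi']
    push_cast
    rfl
  have hp : (Real.pi : ℂ) ^ s ≠ 0 := by
    rw [Ne, Complex.cpow_eq_zero_iff]; exact fun h => hpi h.1
  have h5 : (Real.pi : ℂ) ^ (2 * s) = (Real.pi : ℂ) ^ s * (Real.pi : ℂ) ^ s := by
    rw [two_mul, Complex.cpow_add _ _ hpi]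
  have hq : (s * (s - 1)) ^ e ≠ 0 := pow_ne_zero _ (mul_ne_zero hs0 hs1)
  rw [rootQuotient, rootProd_delta3Poles, hX.eq_of_one_lt_re hs, completedSum_eq 0 hs,
    completedSum_eq m hs, cosLatticeSum_zero_one, (cosLatticeSum_spec 0).2 hs,
    (cosLatticeSum_spec m).2 hs, phaseFactor, h4, h5, Complex.cpow_neg, Nat.cast_zero, mul_zero,
    mul_zero, add_zero]
  field_simp

lemma delta3_eventuallyEq {e m : ℕ} {X : ℂ → ℂ} (hX : IsCompletedProduct e m X) {p : ℂ}
    (hp : MeromorphicNFAt (rootQuotient X (delta3Poles e m)) p) :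
    delta3 m =ᶠ[𝓝 p] rootQuotient X (delta3Poles e m) := by
  have hpi : (Real.pi : ℂ) ≠ 0 := by exact_mod_cast Real.pi_ne_zero
  have hΓ : ∀ {g : ℂ → ℂ}, Differentiable ℂ g → ∀ s, MeromorphicAt (fun s => Complex.Gamma (g s)) s :=
    fun {g} hg s => (MeromorphicNFOn.Gamma.meromorphicOn (g s) (mem_univ _)).comp_analyticAt
      (Complex.analyticOnNhd_univ_iff_differentiable.2 hg s (mem_univ s))
  have hR : MeromorphicOn (fun s : ℂ => Complex.Gamma s ^ 2 /
      ((Real.pi : ℂ) ^ (2 * s) * phaseFactor m s) *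
      cosLatticeSum 0 1 s * cosLatticeSum 1 (4 * m) s) univ := by
    intro s _
    have h1 := hΓ (g := fun s => s) (by fun_prop) s
    have h2 := hΓ (g := fun s => 1 - s) (by fun_prop) s
    have h3 := hΓ (g := fun s => 1 - s + 2 * m) (by fun_prop) s
    have h4 := hΓ (g := fun s => s + 2 * m) (by fun_prop) s
    have h5 : Differentiable ℂ fun s : ℂ => (Real.pi : ℂ) ^ (2 * s) := fun s =>
      (by fun_prop : DifferentiableAt ℂ (fun s : ℂ => 2 * s) s).const_cpow (Or.inl hpi)
    have h6 := (Complex.analyticOnNhd_univ_iff_differentiable.2 h5 s (mem_univ s)).meromorphicAt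
    have h7 : MeromorphicAt (cosLatticeSum 0 1) s := by
      rw [cosLatticeSum_zero_one]
      exact (cosLatticeSum_spec 0).1.meromorphicOn s (mem_univ s)
    have h8 : MeromorphicAt (cosLatticeSum 1 (4 * m)) s :=
      (cosLatticeSum_spec m).1.meromorphicOn s (mem_univ s)
    exact (((h1.pow 2).div (h6.mul ((h3.mul h1).div (h2.mul h4)))).mul h7).mul h8
  have hquot : MeromorphicOn (rootQuotient X (delta3Poles e m)) univ := fun s _ =>
    (Complex.analyticOnNhd_univ_iff_differentiable.2 hX.differentiable s
      (mem_univ s)).meromorphicAt.div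
    (Complex.analyticOnNhd_univ_iff_differentiable.2 (differentiable_rootProd _) s
      (mem_univ s)).meromorphicAt
  refine eventuallyEq_of_meromorphicNFAt (meromorphicNFOn_toMeromorphicNFOn _ univ) hquot
    (x₀ := 2 + Complex.I) ?_ hp
  refine (hR.toMeromorphicNFOn_eq_self_on_nhdsNE (mem_univ _)).trans ?_
  have hopen : IsOpen {s : ℂ | 1 < s.re ∧ 0 < s.im} :=
    isOpen_one_lt_re.inter (isOpen_lt continuous_const Complex.continuous_im)
  refine (eventually_of_mem (hopen.mem_nhds (by simp)) fun z hz => ?_).filter_mono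
    nhdsWithin_le_nhds
  exact delta3_formula hX hz.1 hz.2.ne'

/-- The numerator of `Δ₃` exists. The factor `s(s-1)` cancels the poles of `C(0,1;s)` at `0` and
`1`, and is left out if these are cancelled by zeros of `C(1,4m;s)`. -/
lemma exists_isCompletedProduct {m : ℕ} (hm : m ≠ 0) :
    ∃ e X, IsCompletedProduct e m X ∧ (e ≠ 0 → X 0 ≠ 0) := by
  have hB : Differentiable ℂ (completedSum m) := by
    have : completedSum m = fun s => (Real.pi : ℂ) ^ (2 * m) * completedLattice m s := by
      funext s
      rw [completedSum, if_neg hm, sub_zero]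
    rw [this]
    exact (differentiable_completedLattice m).const_mul _
  have hL := differentiable_completedLattice 0
  have hA : ∀ s, completedSum 0 s = completedLattice 0 s - (1 / s + 1 / (1 - s)) := fun s => by
    simp [completedSum]
  by_cases h0 : completedSum m 0 = 0
  · have h1 : completedSum m 1 = 0 := by
      have := completedSum_one_sub m 0
      rwa [sub_zero, h0] at this
    have hds : ∀ c, Differentiable ℂ (dslope (completedSum m) c) := fun c =>
      differentiableOn_univ.1 ((Complex.differentiableOn_dslope univ_mem).2 hB.differentiableOn)
    refine ⟨0, fun s => completedLattice 0 s * completedSum m s - dslope (completedSum m) 0 s +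
      dslope (completedSum m) 1 s, ⟨((hL.mul hB).sub (hds 0)).add (hds 1), fun s hs0 hs1 => ?_⟩,
      fun h => absurd rfl h⟩
    have hs1' : s - 1 ≠ 0 := sub_ne_zero.2 hs1
    have hs1'' : 1 - s ≠ 0 := sub_ne_zero.2 hs1.symm
    rw [dslope_of_ne _ hs0, dslope_of_ne _ hs1, slope_def_field, slope_def_field, h0, h1, hA]
    field_simp
    ring
  · refine ⟨1, fun s => (s * (s - 1) * completedLattice 0 s + 1) * completedSum m s,
      ⟨by fun_prop, fun s hs0 hs1 => ?_⟩, fun _ => by simpa using h0⟩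
    have hs1' : 1 - s ≠ 0 := sub_ne_zero.2 hs1.symm
    rw [hA]
    field_simp
    ring

/-- Under the Riemann hypothesis `Δ₃ = X / P` with `X` of the type of the xi function and `P` a real
polynomial without common zeros. -/
lemma exists_delta3_eq {m : ℕ} (hm : m ≠ 0) (hRH : RiemannHypothesisFor (delta3 m)) :
    ∃ e X, IsXiLike X ∧ {s | X s = 0}.Infinite ∧ (∀ a ∈ delta3Poles e m, X (a : ℂ) ≠ 0) ∧
      delta3 m = rootQuotient X (delta3Poles e m) := by
  obtain ⟨e, X, hX, hX0⟩ := exists_isCompletedProduct hm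
  have hXan : ∀ p, AnalyticAt ℂ X p := fun p =>
    Complex.analyticOnNhd_univ_iff_differentiable.2 hX.differentiable p (mem_univ p)
  have hPan : ∀ p, AnalyticAt ℂ (rootProd (delta3Poles e m)) p := fun p =>
    Complex.analyticOnNhd_univ_iff_differentiable.2 (differentiable_rootProd _) p (mem_univ p)
  have hzero : ∀ p, rootProd (delta3Poles e m) p ≠ 0 → X p = 0 → p.re = 1 / 2 := by
    intro p hp h0
    have ha : AnalyticAt ℂ (rootQuotient X (delta3Poles e m)) p := (hXan p).div (hPan p) hp
    have hev := delta3_eventuallyEq hX ha.meromorphicNFAt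
    refine hRH p ⟨ha.congr hev.symm, ?_⟩
    rw [hev.self_of_nhds, rootQuotient, h0, zero_div]
  have hX1 : X 1 = X 0 := by simpa using hX.one_sub 0
  -- a zero at a pole would give a zero at the mirror image of the pole
  have hpole : ∀ a ∈ delta3Poles e m, X (a : ℂ) ≠ 0 := by
    intro a ha h0
    have hj : ∀ j : ℕ, X ((j : ℂ) + 1) = 0 → False := by
      intro j h0
      have h1 : X (-(j : ℂ)) = 0 := by
        rw [← hX.one_sub, sub_neg_eq_add, add_comm, h0]
      by_cases hp : rootProd (delta3Poles e m) (-(j : ℂ)) = 0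
      · obtain ⟨b, hb, hjb⟩ := rootProd_eq_zero_iff.1 hp
        have hb' : -(j : ℝ) = b := by
          have := congrArg Complex.re hjb
          simpa using this
        have hj0 : (0 : ℝ) ≤ j := j.cast_nonneg
        rcases mem_delta3Poles hb with ⟨he, rfl | rfl⟩ | ⟨i, rfl⟩
        · have : (j : ℂ) = 0 := by exact_mod_cast neg_eq_zero.1 hb'
          rw [this, neg_zero] at h1
          exact hX0 he h1
        · linarith
        · have hi0 : (0 : ℝ) ≤ i := i.cast_nonneg
          linarith
      · have h2 := hzero _ hp h1
        rw [Complex.neg_re, Complex.natCast_re] at h2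
        have hj0 : (0 : ℝ) ≤ j := j.cast_nonneg
        linarith
    rcases mem_delta3Poles ha with ⟨he, rfl | rfl⟩ | ⟨j, rfl⟩
    · exact hX0 he (by simpa using h0)
    · exact hX0 he (by rw [← hX1]; simpa using h0)
    · exact hj j (by simpa using h0)
  have hxi : IsXiLike X := by
    refine hX.isXiLike fun s hs h0 => ?_
    by_cases hp : rootProd (delta3Poles e m) s = 0
    · obtain ⟨a, ha, rfl⟩ := rootProd_eq_zero_iff.1 hp
      exact hpole a ha h0
    · exact hs.ne (hzero s hp h0)
  refine ⟨e, X, hxi, hxi.infinite_zeros hX.exists_norm_le_exp, hpole, ?_⟩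
  funext p
  refine (delta3_eventuallyEq hX (MeromorphicNFOn.div (hXan p) (hPan p).meromorphicNFAt ?_)).self_of_nhds
  by_cases hp : rootProd (delta3Poles e m) p = 0
  · obtain ⟨a, ha, rfl⟩ := rootProd_eq_zero_iff.1 hp
    exact Or.inr (hpole a ha)
  · exact Or.inl hp

end AngularLattice

theorem theorem5p5 (m : ℕ) (hm : 1 ≤ m)
    (hRH : AngularLattice.RiemannHypothesisFor (AngularLattice.delta3 m)) :
    -- lines from `σ = -∞`: every point of the critical line on the line or at its end
    (∀ γ : ℝ → ℂ, AngularLattice.IsConstantPhaseLine (AngularLattice.delta3 m) γ →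
      Tendsto (fun τ => (γ τ).re) atBot atBot →
      ∀ p : ℂ, p ∈ closure (range γ) → p.re = 1 / 2 →
        AngularLattice.IsZeroOf (AngularLattice.delta3 m) p ∨
          AngularLattice.dargdsigma (AngularLattice.delta3 m) p = 0) ∧
    -- lines from `σ = +∞`: after the crossing they stay in `σ < 1/2` and return to a zero
    (∀ γ : ℝ → ℂ, AngularLattice.IsConstantPhaseLine (AngularLattice.delta3 m) γ →
      Tendsto (fun τ => (γ τ).re) atBot atTop →
      AngularLattice.IsForwardComplete (AngularLattice.delta3 m) γ →
      ∀ τ₀ : ℝ, (γ τ₀).re = 1 / 2 →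
        ¬ AngularLattice.IsZeroOf (AngularLattice.delta3 m) (γ τ₀) →
        AngularLattice.dargdsigma (AngularLattice.delta3 m) (γ τ₀) ≠ 0 →
        (∀ τ : ℝ, τ₀ < τ → (γ τ).re < 1 / 2) ∧
          ∃ ρ : ℂ, AngularLattice.IsZeroOf (AngularLattice.delta3 m) ρ ∧ ρ.re = 1 / 2 ∧
            Tendsto γ atTop (𝓝 ρ)) := by
  have hm0 : m ≠ 0 := by omega
  obtain ⟨e, X, hX, hinf, hpole, heq⟩ := AngularLattice.exists_delta3_eq hm0 hRH
  have hS : ∀ s : ℂ, s.re = 1 / 2 →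
      (logDeriv (AngularLattice.rootProd (AngularLattice.delta3Poles e m)) s).re < 0 :=
    fun s hs => AngularLattice.re_logDeriv_rootProd_neg e hm0 hs
  have hS' : ∀ a ∈ AngularLattice.delta3Poles e m, a ≠ 1 / 2 := by
    intro a ha h
    rcases AngularLattice.mem_delta3Poles ha with ⟨-, h1 | h1⟩ | ⟨j, h1⟩
    · norm_num [h1] at h
    · norm_num [h1] at h
    · have : (0 : ℝ) ≤ j := j.cast_nonneg
      linarith
  rw [heq]
  refine ⟨fun γ hγ hlim p hp hre => Or.inl (hX.eq_zero_of_mem_closure hinf hS hS' hγ hlim hp hre),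
    fun γ hγ hlim hcomp τ₀ hτ₀ _ _ => ?_⟩
  have hanti := hX.strictAnti_of_tendsto_atTop hinf hγ hlim
  have hleft : ∀ τ, τ₀ < τ → (γ τ).re < 1 / 2 := fun τ hτ =>
    hγ.re_lt_of_lt hanti (fun p hp _ h0 => hX.logDeriv_rootQuotient_re_pos hS hp h0) hτ₀ hτ
  exact ⟨hleft, hX.exists_tendsto_zero hinf hpole hγ hanti hcomp hleft⟩
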